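/- Let $S^2\subset\mathbb{R}^3$ be the round unit sphere. Let $W^{2,2}(S^2,S^2)$ be the set of maps $u\in W^{2,2}(S^2,\mathbb{R}^3)$ with $|u|=1$ almost everywhere (as usual, maps that agree almost everywhere are identified). For $\varepsilon>0$ and $u\in W^{2,2}(S^2,S^2)$ put $$E_\varepsilon(u)=\frac12\int_{S^2}\bigl(|\nabla u|^2+\varepsilon|\Delta u|^2\bigr)\,dA_{S^2},$$ where $\nabla$ and $\Delta$ are the gradient and the Laplace-Beltrami operator of $S^2$, applied to $u$ as an $\mathbb{R}^3$-valued map. Call $u\in W^{2,2}(S^2,S^2)$ a critical point of $E_\varepsilon$ if $$\frac{d}{dt}\Big|_{t=0}E_\varepsilon\!\left(\frac{u+t\varphi}{|u+t\varphi|}\right)=0\qquad\text{for every }\varphi\in W^{2,2}(S^2,\mathbb{R}^3).$$ **Lemma.** There exist $\delta>0$ and $\varepsilon_0>0$ such that for every $0<\varepsilon\le\varepsilon_0$ the following holds: if $u_\varepsilon\in W^{2,2}(S^2,S^2)$ is a critical point of $E_\varepsilon$ with $E_\varepsilon(u_\varepsilon)<\delta$, then $E_\varepsilon(u_\varepsilon)=0$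 and $u_\varepsilon$ is a constant map. -/

import Mathlib

open MeasureTheory
open scoped ContDiff

noncomputable section

namespace EpsHarmonic

/-- Euclidean three-space. -/
abbrev E3 : Type := EuclideanSpace ℝ (Fin 3)

/-- The round unit two-sphere in `ℝ³`. -/
abbrev S2 : Type := Metric.sphere (0 : E3) 1

/-- The area measure of the round two-sphere (total mass `4π`). -/
def area : Measure S2 := (volume : Measure E3).toSphere

/-- The `i`-th tangential derivative at `x ∈ S²` of (the restriction to `S²` of) a smooth function
`φ : ℝ³ → ℝ`: the derivative of `φ` in the direction of the tangential part `eᵢ - xᵢ x` of the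
`i`-th standard basis vector. The vector with entries `tangentialDeriv i φ x` is the gradient
of `φ` on `S²` at `x`, viewed as a vector in `ℝ³`. -/
def tangentialDeriv (i : Fin 3) (φ : E3 → ℝ) (x : S2) : ℝ :=
  fderiv ℝ φ (x : E3) (EuclideanSpace.single i (1 : ℝ) - (x : E3) i • (x : E3))

/-- `g` is the weak `i`-th tangential derivative of `f` on `S²`. This is the integration by parts
formula `∫ g φ = -∫ f Dᵢφ + 2 ∫ f φ xᵢ` against all smooth functions `φ` on `S²`; the last
term is there because `∫ Dᵢh = 2 ∫ h xᵢ` on the unit sphere, whose mean curvature vector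
is `-2x`. Smooth functions on `S²` are the restrictions of smooth functions on `ℝ³`. -/
def IsWeakDeriv (i : Fin 3) (f g : S2 → ℝ) : Prop :=
  Integrable f area ∧ Integrable g area ∧
    ∀ φ : E3 → ℝ, ContDiff ℝ ∞ φ →
      ∫ x, g x * φ x ∂area =
        -(∫ x, f x * tangentialDeriv i φ x ∂area) + 2 * ∫ x, f x * φ x * (x : E3) i ∂area

/-- The Sobolev space `W^{1,2}(S²)`. -/
def MemW12 (f : S2 → ℝ) : Prop :=
  MemLp f 2 area ∧ ∀ i, ∃ g, IsWeakDeriv i f g ∧ MemLp g 2 area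

/-- The Sobolev space `W^{2,2}(S²)`. -/
def MemW22 (f : S2 → ℝ) : Prop :=
  MemLp f 2 area ∧ ∀ i, ∃ g, IsWeakDeriv i f g ∧ MemW12 g

/-- The space `W^{2,2}(S², ℝ³)`. -/
def MemW22Vec (v : S2 → E3) : Prop := ∀ k, MemW22 (fun x => v x k)

/-- The space `W^{2,2}(S², S²)`: maps into `S²` which are of class `W^{2,2}` as maps
into `ℝ³`. -/
def MemW22Sphere (u : S2 → S2) : Prop := MemW22Vec (fun x => (u x : E3))

open Classical in
/-- The weak `i`-th tangential derivative of `f` (unique up to null sets where it exists,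
and `0` otherwise). -/
def weakDeriv (i : Fin 3) (f : S2 → ℝ) : S2 → ℝ :=
  if h : ∃ g, IsWeakDeriv i f g then h.choose else 0

/-- `|∇v|²` for a map `v : S² → ℝ³`. -/
def gradSq (v : S2 → E3) (x : S2) : ℝ :=
  ∑ k, ∑ i, (weakDeriv i (fun y => v y k) x) ^ 2

/-- The Laplace-Beltrami operator `Δ = ∑ᵢ DᵢDᵢ` of `S²`, in the weak sense. -/
def laplacian (f : S2 → ℝ) (x : S2) : ℝ := ∑ i, weakDeriv i (weakDeriv i f) x

/-- `|Δv|²` for a map `v : S² → ℝ³`. -/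
def laplacianSq (v : S2 → E3) (x : S2) : ℝ :=
  ∑ k, (laplacian (fun y => v y k) x) ^ 2

/-- The `ε`-energy `E_ε(v) = ½ ∫ (|∇v|² + ε |Δv|²)`. -/
def energy (ε : ℝ) (v : S2 → E3) : ℝ :=
  (1 / 2) * ∫ x, (gradSq v x + ε * laplacianSq v x) ∂area

/-- The nearest point projection `y ↦ y / |y|` of `ℝ³ \ {0}` onto `S²`. -/
def proj (y : E3) : E3 := ‖y‖⁻¹ • y

/-- `u` is a critical point of `E_ε` on `W^{2,2}(S², S²)`: the first variation of `E_ε` at `u`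
vanishes along `t ↦ proj (u + t φ)` for every `φ ∈ W^{2,2}(S², ℝ³)`. Such `φ` are
essentially bounded, so that `u + t φ` stays away from `0` for small `t`. -/
def IsCriticalPoint (ε : ℝ) (u : S2 → S2) : Prop :=
  MemW22Sphere u ∧
    ∀ φ : S2 → E3, MemW22Vec φ →
      HasDerivAt (fun t : ℝ => energy ε (fun x => proj ((u x : E3) + t • φ x))) 0 0

end EpsHarmonic

end

/-!
The proof rests on an identity obtained by testing the Euler–Lagrange equation of `E_ε` with a second
difference quotient of `u` along rotations. For a rotation `R` by the angle `t` about a coordinate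
axis let `v = t⁻¹ (u ∘ R - u)` and `v' = v ∘ R⁻¹`. The field `η = t⁻¹ (v - v')` has normal part
`-½ (|v|² + |v'|²) u`, because `|u| = 1`. Hence `η + ½ (|v|² + |v'|²) u` is tangential along `u` and may
be used as a test field. Since `E_ε` is invariant under rotations, pairing `u` with `η` gives minus the
quadratic form of the energy at `v`. What remains is (`IsCriticalPoint.diffQuot_identity`)
`∫ |∇v|² + ε |Δv|² = ½ ∫ (density in u and v) + ½ ∫ (the same density in u and v')`, where every term of
the density is quadratic in `v` and contains at least two derivatives of `u` besides.

Summing over the three axes, let `G = ∫ |∇u|²`, and let `X` and `Y` be the sums of `∫ |∇v|²` and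
`∫ |Δv|²`. The Sobolev inequalities on the sphere bound the right-hand side by `C G (X + ε Y)` with a
constant `C` that does not depend on `ε` or `t` (`integral_sqDensity_le`). Apart from Ladyzhenskaya's
inequality (`HasW1.ladyzhenskaya`) and Agmon's (`HasW2.sup_sq_le`) this uses Bochner's identity
(`HasW2.bochner`), the interpolation `X² ≤ G Y`, and `‖Δu‖² ≤ 4 X`, which holds for a suitable small `t`
if `Δu ≠ 0` (`exists_diffQuot_scale`). When `C G < 1` this forces `X + ε Y = 0`, so that `Δu = 0`. Then
the gradient vanishes as well (`HasW2.gradient_le`) and `u` is constant (`HasW1.ae_eq_const`). Working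
with difference quotients rather than derivatives of `u` avoids any regularity theory for critical
points.

All derivatives are taken along the rotation fields `x ↦ e_a × x`. The corresponding angular
derivatives `L_a` are skew-adjoint on the sphere and commute with the Laplacian `Δ = ∑ₐ L_a L_a`, and
the tangential gradient is `D = -x × L`, so that `|Df| = |Lf|`; hence the energy is
`½ ∫ ∑ₐ |L_a u|² + ε |Δu|²` (`energy_eq`). Averaging against the zonal kernels `(1 + ⟨x, y⟩)ⁿ` commutes
with every `L_a` (`angDeriv_mollify`), is a contraction of `L²` and converges to the identity, which
reduces the inequalities and product rules to smooth functions. For these, central projection of the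
sphere onto the faces of a cube and one-dimensional integration along the faces give the endpoint
inequalities `W^{1,1} ⊂ L²` and `W^{2,1} ⊂ L^∞`, and applying these to `φ²` gives Ladyzhenskaya's and
Agmon's inequalities.
-/

noncomputable section

namespace EpsHarmonic

/-! ### Area and rotations -/

instance : IsFiniteMeasure area := by unfold area; infer_instance

instance : NeZero area := ⟨by unfold area; exact Measure.toSphere_ne_zero _⟩

/-- The self-map of the unit sphere induced by a linear isometry of `ℝ³`. -/
def sphereMap (A : E3 ≃ₗᵢ[ℝ] E3) (x : S2) : S2 :=
  ⟨A x, by simp⟩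

@[simp] lemma coe_sphereMap (A : E3 ≃ₗᵢ[ℝ] E3) (x : S2) : (sphereMap A x : E3) = A x := rfl

lemma continuous_sphereMap (A : E3 ≃ₗᵢ[ℝ] E3) : Continuous (sphereMap A) :=
  (A.continuous.comp continuous_subtype_val).subtype_mk _

open scoped Pointwise in
lemma measurePreserving_sphereMap (A : E3 ≃ₗᵢ[ℝ] E3) :
    MeasurePreserving (sphereMap A) area area := by
  refine ⟨(continuous_sphereMap A).measurable, ?_⟩
  ext s hs
  rw [Measure.map_apply (continuous_sphereMap A).measurable hs]
  unfold area
  rw [Measure.toSphere_apply' _ hs,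
    Measure.toSphere_apply' _ ((continuous_sphereMap A).measurable hs)]
  congr 1
  rw [← A.measurePreserving.measure_preimage_equiv (f := A.toMeasurableEquiv)
    (Set.Ioo (0 : ℝ) 1 • ((fun x : S2 => (x : E3)) '' s))]
  congr 1
  ext y
  simp only [Set.mem_smul, Set.mem_image, Set.mem_preimage]
  constructor
  · rintro ⟨r, hr, _, ⟨x, hx, rfl⟩, rfl⟩
    exact ⟨r, hr, _, ⟨sphereMap A x, hx, rfl⟩, (map_smul A r (x : E3)).symm⟩
  · rintro ⟨r, hr, _, ⟨x, hx, rfl⟩, h⟩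
    refine ⟨r, hr, _, ⟨sphereMap A.symm x, ?_, rfl⟩, ?_⟩
    · have : sphereMap A (sphereMap A.symm x) = x := by ext1; simp
      rwa [this]
    · have h' : r • (x : E3) = A y := h
      have : r • A.symm (x : E3) = y := by rw [← map_smul, h', A.symm_apply_apply]
      exact this

/-- The `i`-th standard basis vector of `ℝ³`. -/
abbrev basisVec (i : Fin 3) : E3 := EuclideanSpace.single i (1 : ℝ)

lemma sum_cyclic {M : Type*} [AddCommMonoid M] (f : Fin 3 → M) (a : Fin 3) :
    ∑ i, f i = f a + f (a + 1) + f (a + 2) := by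
  fin_cases a <;> simp [Fin.sum_univ_three] <;> abel

lemma forall_cyclic {p : Fin 3 → Prop} (a : Fin 3) :
    (∀ i, p i) ↔ p a ∧ p (a + 1) ∧ p (a + 2) := by
  fin_cases a <;> simp [Fin.forall_fin_succ] <;> tauto

lemma cyc_ne (a : Fin 3) : a + 1 ≠ a ∧ a + 2 ≠ a ∧ a + 1 ≠ a + 2 ∧ a ≠ a + 1 ∧ a ≠ a + 2 ∧
    a + 2 ≠ a + 1 := by
  fin_cases a <;> decide

/-- The linear field `x ↦ e_a × x` generating the rotations about the `a`-th axis. -/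
def crossVec (a : Fin 3) (x : E3) : E3 :=
  x (a + 1) • basisVec (a + 2) - x (a + 2) • basisVec (a + 1)

lemma crossVec_apply_self (a : Fin 3) (x : E3) : crossVec a x a = 0 := by
  have := cyc_ne a
  simp [crossVec, this]

lemma crossVec_apply_one (a : Fin 3) (x : E3) : crossVec a x (a + 1) = - x (a + 2) := by
  have := cyc_ne a
  simp [crossVec, this]

lemma crossVec_apply_two (a : Fin 3) (x : E3) : crossVec a x (a + 2) = x (a + 1) := by
  have := cyc_ne a
  simp [crossVec, this]

lemma contDiff_coord (i : Fin 3) : ContDiff ℝ ∞ (fun x : E3 => x i) :=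
  (EuclideanSpace.proj (𝕜 := ℝ) i : E3 →L[ℝ] ℝ).contDiff

lemma contDiff_crossVec (a : Fin 3) : ContDiff ℝ ∞ (crossVec a) := by
  unfold crossVec
  exact ((contDiff_coord _).smul contDiff_const).sub ((contDiff_coord _).smul contDiff_const)

lemma crossVec_add (a : Fin 3) (x y : E3) : crossVec a (x + y) = crossVec a x + crossVec a y := by
  simp only [crossVec, PiLp.add_apply, add_smul]; abel

lemma crossVec_smul (a : Fin 3) (c : ℝ) (x : E3) : crossVec a (c • x) = c • crossVec a x := by
  simp only [crossVec, PiLp.smul_apply, smul_eq_mul, mul_smul, smul_sub]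

lemma inner_eq_sum (x y : E3) : inner ℝ x y = ∑ i, x i * y i := by
  simp [PiLp.inner_apply, mul_comm]

lemma inner_crossVec (a : Fin 3) (x y : E3) :
    inner ℝ (crossVec a x) y = - inner ℝ x (crossVec a y) := by
  rw [inner_eq_sum, inner_eq_sum, sum_cyclic _ a, sum_cyclic _ a, crossVec_apply_self,
    crossVec_apply_one, crossVec_apply_two, crossVec_apply_self,
    crossVec_apply_one, crossVec_apply_two]
  ring

/-- The angular derivative `φ ↦ Dφ(x)(e_a × x)`, the derivative along the rotation field of the
`a`-th axis. In contrast to `tangentialDeriv`, it commutes with the Laplacian of the sphere,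
it is skew-adjoint, and it is defined for functions on all of `ℝ³`. -/
def angDeriv (a : Fin 3) (φ : E3 → ℝ) (x : E3) : ℝ := fderiv ℝ φ x (crossVec a x)

lemma _root_.ContDiff.angDeriv {φ : E3 → ℝ} (h : ContDiff ℝ ∞ φ) (a : Fin 3) :
    ContDiff ℝ ∞ (angDeriv a φ) :=
  (h.fderiv_right (m := ∞) (by simp)).clm_apply (contDiff_crossVec a)

lemma _root_.ContDiff.diffAt {φ : E3 → ℝ} (h : ContDiff ℝ ∞ φ) (x : E3) : DifferentiableAt ℝ φ x :=
  h.differentiable (by simp) x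

lemma angDeriv_add {φ ψ : E3 → ℝ} (h : ContDiff ℝ ∞ φ) (h' : ContDiff ℝ ∞ ψ) (a : Fin 3) (x : E3) :
    angDeriv a (fun y => φ y + ψ y) x = angDeriv a φ x + angDeriv a ψ x := by
  unfold angDeriv
  rw [fderiv_fun_add (h.diffAt x) (h'.diffAt x)]; rfl

lemma angDeriv_sub {φ ψ : E3 → ℝ} (h : ContDiff ℝ ∞ φ) (h' : ContDiff ℝ ∞ ψ) (a : Fin 3) (x : E3) :
    angDeriv a (fun y => φ y - ψ y) x = angDeriv a φ x - angDeriv a ψ x := by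
  unfold angDeriv
  rw [fderiv_fun_sub (h.diffAt x) (h'.diffAt x)]; rfl

lemma angDeriv_mul {φ ψ : E3 → ℝ} (h : ContDiff ℝ ∞ φ) (h' : ContDiff ℝ ∞ ψ) (a : Fin 3) (x : E3) :
    angDeriv a (fun y => φ y * ψ y) x = φ x * angDeriv a ψ x + angDeriv a φ x * ψ x := by
  unfold angDeriv
  rw [fderiv_fun_mul (h.diffAt x) (h'.diffAt x)]
  simp; ring

lemma fderiv_coord (i : Fin 3) (x v : E3) : fderiv ℝ (fun y : E3 => y i) x v = v i := by
  have h : HasFDerivAt (fun y : E3 => y i) (EuclideanSpace.proj (𝕜 := ℝ) i : E3 →L[ℝ] ℝ) x :=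
    (EuclideanSpace.proj (𝕜 := ℝ) i : E3 →L[ℝ] ℝ).hasFDerivAt
  rw [h.fderiv]; rfl

lemma angDeriv_coord (a i : Fin 3) (x : E3) : angDeriv a (fun y => y i) x = crossVec a x i :=
  fderiv_coord i x _

/-- The rotation by the angle `t` about the `a`-th axis, as a linear map. -/
def rotLin (a : Fin 3) (t : ℝ) : E3 →ₗ[ℝ] E3 where
  toFun x := x a • basisVec a + Real.cos t • (x - x a • basisVec a) + Real.sin t • crossVec a x
  map_add' x y := by
    simp only [crossVec_add, PiLp.add_apply, add_smul, smul_add, smul_sub]; abel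
  map_smul' c x := by
    simp only [crossVec_smul, PiLp.smul_apply, smul_eq_mul, mul_smul, smul_add, smul_sub,
      RingHom.id_apply, smul_comm c]

lemma rotLin_apply_self (a : Fin 3) (t : ℝ) (x : E3) : rotLin a t x a = x a := by
  simp [rotLin, crossVec_apply_self]

lemma rotLin_apply_one (a : Fin 3) (t : ℝ) (x : E3) :
    rotLin a t x (a + 1) = Real.cos t * x (a + 1) - Real.sin t * x (a + 2) := by
  have := cyc_ne a
  simp [rotLin, crossVec_apply_one, this]; ring

lemma rotLin_apply_two (a : Fin 3) (t : ℝ) (x : E3) :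
    rotLin a t x (a + 2) = Real.cos t * x (a + 2) + Real.sin t * x (a + 1) := by
  have := cyc_ne a
  simp [rotLin, crossVec_apply_two, this]

lemma ext_cyclic (a : Fin 3) {x y : E3} (h0 : x a = y a) (h1 : x (a + 1) = y (a + 1))
    (h2 : x (a + 2) = y (a + 2)) : x = y := by
  ext i
  revert i
  exact (forall_cyclic (p := fun i => x i = y i) a).2 ⟨h0, h1, h2⟩

lemma norm_sq_cyclic (a : Fin 3) (x : E3) : ‖x‖ ^ 2 = x a ^ 2 + x (a + 1) ^ 2 + x (a + 2) ^ 2 := by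
  rw [EuclideanSpace.real_norm_sq_eq, sum_cyclic _ a]

lemma norm_rotLin (a : Fin 3) (t : ℝ) (x : E3) : ‖rotLin a t x‖ = ‖x‖ := by
  have : ‖rotLin a t x‖ ^ 2 = ‖x‖ ^ 2 := by
    rw [norm_sq_cyclic a, norm_sq_cyclic a x, rotLin_apply_self, rotLin_apply_one,
      rotLin_apply_two]
    have := Real.sin_sq_add_cos_sq t
    linear_combination (x (a + 1) ^ 2 + x (a + 2) ^ 2) * this
  exact (sq_eq_sq₀ (norm_nonneg _) (norm_nonneg _)).1 this

/-- The rotation by the angle `t` about the `a`-th axis. -/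
def rot (a : Fin 3) (t : ℝ) : E3 ≃ₗᵢ[ℝ] E3 :=
  LinearIsometry.toLinearIsometryEquiv ⟨rotLin a t, norm_rotLin a t⟩ rfl

lemma rot_apply_self (a : Fin 3) (t : ℝ) (x : E3) : rot a t x a = x a := rotLin_apply_self a t x

lemma rot_apply_one (a : Fin 3) (t : ℝ) (x : E3) :
    rot a t x (a + 1) = Real.cos t * x (a + 1) - Real.sin t * x (a + 2) := rotLin_apply_one a t x

lemma rot_apply_two (a : Fin 3) (t : ℝ) (x : E3) :
    rot a t x (a + 2) = Real.cos t * x (a + 2) + Real.sin t * x (a + 1) := rotLin_apply_two a t x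

lemma rot_add (a : Fin 3) (s t : ℝ) (x : E3) : rot a (s + t) x = rot a s (rot a t x) := by
  apply ext_cyclic a <;> simp only [rot_apply_self, rot_apply_one, rot_apply_two,
    Real.cos_add, Real.sin_add] <;> ring

lemma rot_zero (a : Fin 3) (x : E3) : rot a 0 x = x := by
  apply ext_cyclic a <;> simp [rot_apply_self, rot_apply_one, rot_apply_two]

lemma rot_def (a : Fin 3) (t : ℝ) (x : E3) : rot a t x =
    x a • basisVec a + Real.cos t • (x - x a • basisVec a) + Real.sin t • crossVec a x := rfl

lemma hasDerivAt_rot (a : Fin 3) (t : ℝ) (x : E3) :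
    HasDerivAt (fun s => rot a s x) (crossVec a (rot a t x)) t := by
  have h : HasDerivAt (fun s => rot a s x)
      ((-Real.sin t) • (x - x a • basisVec a) + Real.cos t • crossVec a x) t := by
    simp only [rot_def]
    exact (((Real.hasDerivAt_cos t).smul_const (x - x a • basisVec a)).const_add
      (x a • basisVec a)).add ((Real.hasDerivAt_sin t).smul_const (crossVec a x))
  convert h using 1
  have := cyc_ne a
  apply ext_cyclic a <;>
    (simp [crossVec_apply_self, crossVec_apply_one, crossVec_apply_two, rot_apply_one,
      rot_apply_two, this]; try ring)

lemma hasDerivAt_comp_rot {φ : E3 → ℝ} (h : ContDiff ℝ ∞ φ) (a : Fin 3) (t : ℝ) (x : E3) :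
    HasDerivAt (fun s => φ (rot a s x)) (angDeriv a φ (rot a t x)) t :=
  ((h.diffAt _).hasFDerivAt).comp_hasDerivAt t (hasDerivAt_rot a t x)

/-- Rotation of the sphere about the `a`-th axis. -/
abbrev srot (a : Fin 3) (t : ℝ) : S2 → S2 := sphereMap (rot a t)

/-! ### Smooth functions on the sphere -/

lemma _root_.ContDiff.continuous_sphere {φ : E3 → ℝ} (h : ContDiff ℝ ∞ φ) :
    Continuous (fun x : S2 => φ x) := h.continuous.comp continuous_subtype_val

lemma exists_bound_sphere {φ : E3 → ℝ} (h : ContDiff ℝ ∞ φ) :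
    ∃ C : ℝ, 0 ≤ C ∧ ∀ x : S2, |φ x| ≤ C := by
  obtain ⟨C, hC⟩ := isCompact_univ.exists_bound_of_continuousOn
    (h.continuous_sphere.continuousOn (s := Set.univ))
  exact ⟨max C 0, le_max_right _ _, fun x => (hC x trivial : |φ x| ≤ C).trans (le_max_left _ _)⟩

lemma _root_.ContDiff.memLp_sphere {φ : E3 → ℝ} (h : ContDiff ℝ ∞ φ) (p : ENNReal) :
    MemLp (fun x : S2 => φ x) p area := by
  obtain ⟨C, -, hC⟩ := exists_bound_sphere h
  exact MemLp.of_bound h.continuous_sphere.aestronglyMeasurable C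
    (Filter.Eventually.of_forall hC)

lemma _root_.ContDiff.integrable_sphere {φ : E3 → ℝ} (h : ContDiff ℝ ∞ φ) :
    Integrable (fun x : S2 => φ x) area := memLp_one_iff_integrable.1 (h.memLp_sphere 1)

lemma integrable_mul_smooth {f : S2 → ℝ} (hf : Integrable f area) {φ : E3 → ℝ}
    (h : ContDiff ℝ ∞ φ) : Integrable (fun x => f x * φ x) area := by
  obtain ⟨C, -, hC⟩ := exists_bound_sphere h
  exact hf.mul_bdd h.continuous_sphere.aestronglyMeasurable (Filter.Eventually.of_forall hC)

lemma integral_sphereMap (A : E3 ≃ₗᵢ[ℝ] E3) (f : S2 → ℝ) :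
    ∫ x, f (sphereMap A x) ∂area = ∫ x, f x ∂area := by
  have hA : MeasurableEmbedding (sphereMap A) :=
    (continuous_sphereMap A).measurableEmbedding (fun x y h => by
      have : A x = A y := congrArg Subtype.val h
      exact Subtype.ext (A.injective this))
  exact (measurePreserving_sphereMap A).integral_comp hA f

lemma integral_angDeriv {φ : E3 → ℝ} (h : ContDiff ℝ ∞ φ) (a : Fin 3) :
    ∫ x : S2, angDeriv a φ x ∂area = 0 := by
  obtain ⟨C, -, hC⟩ := exists_bound_sphere (h.angDeriv a)
  have key := (hasDerivAt_integral_of_dominated_loc_of_deriv_le (μ := area)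
    (F := fun t (x : S2) => φ (rot a t x)) (F' := fun t (x : S2) => angDeriv a φ (rot a t x))
    (x₀ := 0) (bound := fun _ => C) (s := Set.univ) Filter.univ_mem ?_ ?_ ?_ ?_ ?_ ?_).2
  · have h2 : (fun t => ∫ x : S2, φ (rot a t x) ∂area) = fun t => ∫ x : S2, φ x ∂area := by
      ext t
      exact integral_sphereMap (rot a t) (fun x : S2 => φ x)
    rw [h2] at key
    have := key.unique (hasDerivAt_const _ _)
    simpa [rot_zero] using this
  · exact Filter.Eventually.of_forall fun t =>
      (h.continuous.comp ((rot a t).continuous.comp continuous_subtype_val)).aestronglyMeasurable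
  · simpa [rot_zero] using h.integrable_sphere
  · exact ((h.angDeriv a).continuous.comp
      ((rot a 0).continuous.comp continuous_subtype_val)).aestronglyMeasurable
  · exact Filter.Eventually.of_forall fun x t _ => hC (srot a t x)
  · exact integrable_const _
  · exact Filter.Eventually.of_forall fun x t _ => hasDerivAt_comp_rot h a t x

/-- `g` is the weak angular derivative of `f` about the `a`-th axis. -/
def HasAngDeriv (a : Fin 3) (f g : S2 → ℝ) : Prop :=
  Integrable f area ∧ Integrable g area ∧
    ∀ φ : E3 → ℝ, ContDiff ℝ ∞ φ → ∫ x, g x * φ x ∂area = -∫ x, f x * angDeriv a φ x ∂area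

lemma _root_.ContDiff.hasAngDeriv {φ : E3 → ℝ} (h : ContDiff ℝ ∞ φ) (a : Fin 3) :
    HasAngDeriv a (fun x => φ x) (fun x => angDeriv a φ x) := by
  refine ⟨h.integrable_sphere, (h.angDeriv a).integrable_sphere, fun ψ hψ => ?_⟩
  have := integral_angDeriv (h.mul hψ) a
  simp only [angDeriv_mul h hψ] at this
  rw [integral_add (h.mul (hψ.angDeriv a)).integrable_sphere
    ((h.angDeriv a).mul hψ).integrable_sphere] at this
  linarith

/-! ### Commutators and the Bochner identity -/

lemma hasFDerivAt_crossVec (a : Fin 3) (x : E3) :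
    ∃ A : E3 →L[ℝ] E3, HasFDerivAt (crossVec a) A x ∧ ∀ v, A v = crossVec a v := by
  let B : E3 →L[ℝ] E3 := LinearMap.toContinuousLinearMap
    { toFun := crossVec a, map_add' := crossVec_add a, map_smul' := crossVec_smul a }
  exact ⟨B, B.hasFDerivAt, fun v => rfl⟩

lemma angDeriv_angDeriv {φ : E3 → ℝ} (h : ContDiff ℝ ∞ φ) (a b : Fin 3) (x : E3) :
    angDeriv a (angDeriv b φ) x = fderiv ℝ (fderiv ℝ φ) x (crossVec a x) (crossVec b x) +
      fderiv ℝ φ x (crossVec b (crossVec a x)) := by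
  obtain ⟨A, hA, hA'⟩ := hasFDerivAt_crossVec b x
  have h1 : HasFDerivAt (fderiv ℝ φ) (fderiv ℝ (fderiv ℝ φ) x) x :=
    ((h.fderiv_right (m := ∞) (by simp)).differentiable (by simp) x).hasFDerivAt
  have h2 := h1.clm_apply hA
  have h3 : fderiv ℝ (angDeriv b φ) x = _ := h2.fderiv
  unfold angDeriv at h3 ⊢
  rw [h3]
  simp [hA', add_comm]

lemma angDeriv_comm {φ : E3 → ℝ} (h : ContDiff ℝ ∞ φ) (a : Fin 3) (x : E3) :
    angDeriv a (angDeriv (a + 1) φ) x - angDeriv (a + 1) (angDeriv a φ) x =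
      - angDeriv (a + 2) φ x := by
  rw [angDeriv_angDeriv h, angDeriv_angDeriv h]
  have hs : IsSymmSndFDerivAt ℝ φ x :=
    h.contDiffAt.isSymmSndFDerivAt (by simp only [minSmoothness_of_isRCLikeNormedField]; exact WithTop.coe_le_coe.2 le_top)
  rw [hs.eq (crossVec (a + 1) x) (crossVec a x)]
  have : crossVec (a + 1) (crossVec a x) - crossVec a (crossVec (a + 1) x)
      = - crossVec (a + 2) x := by
    fin_cases a <;> ext i <;> fin_cases i <;> simp [crossVec]
  unfold angDeriv
  have h2 := congrArg (fderiv ℝ φ x) this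
  rw [map_sub, map_neg] at h2
  linarith

/-- The Laplace–Beltrami operator as the sum of the squares of the angular derivatives. -/
def angLaplacian (φ : E3 → ℝ) (x : E3) : ℝ := ∑ a, angDeriv a (angDeriv a φ) x

lemma _root_.ContDiff.angLaplacian {φ : E3 → ℝ} (h : ContDiff ℝ ∞ φ) : ContDiff ℝ ∞ (angLaplacian φ) := by
  unfold EpsHarmonic.angLaplacian
  exact ContDiff.sum fun a _ => (h.angDeriv a).angDeriv a

/-- The angular derivatives commute with the Laplacian. -/
lemma angLaplacian_angDeriv {φ : E3 → ℝ} (h : ContDiff ℝ ∞ φ) (b : Fin 3) (x : E3) :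
    angLaplacian (angDeriv b φ) x = angDeriv b (angLaplacian φ) x := by
  have hc (ψ : E3 → ℝ) (hψ : ContDiff ℝ ∞ ψ) (a : Fin 3) : angDeriv a (angDeriv (a + 1) ψ) =
      fun y => angDeriv (a + 1) (angDeriv a ψ) y - angDeriv (a + 2) ψ y := by
    ext y; linarith [angDeriv_comm hψ a y]
  have e1 : b + 1 + 1 = b + 2 := by fin_cases b <;> rfl
  have e2 : b + 1 + 2 = b := by fin_cases b <;> rfl
  have e3 : b + 2 + 1 = b := by fin_cases b <;> rfl
  have e4 : b + 2 + 2 = b + 1 := by fin_cases b <;> rfl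
  have hA := h.angDeriv b
  have hB := h.angDeriv (b + 1)
  have hC := h.angDeriv (b + 2)
  have l1 : angLaplacian φ = fun y => angDeriv b (angDeriv b φ) y +
      angDeriv (b + 1) (angDeriv (b + 1) φ) y + angDeriv (b + 2) (angDeriv (b + 2) φ) y := by
    ext y; exact sum_cyclic _ b
  rw [l1, angDeriv_add ((hA.angDeriv b).add (hB.angDeriv _)) (hC.angDeriv _),
    angDeriv_add (hA.angDeriv b) (hB.angDeriv _)]
  unfold angLaplacian
  rw [sum_cyclic _ b]
  -- `BBA = ABB + CB + BC` and `CCA = ACC - BC - CB` for `A, B, C = L_b, L_{b+1}, L_{b+2}`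
  have p1 : angDeriv (b + 1) (angDeriv b φ) =
      fun y => angDeriv b (angDeriv (b + 1) φ) y + angDeriv (b + 2) φ y := by
    ext y; linarith [congrFun (hc φ h b) y]
  have p2 : angDeriv (b + 2) (angDeriv b φ) =
      fun y => angDeriv b (angDeriv (b + 2) φ) y - angDeriv (b + 1) φ y := by
    have := hc φ h (b + 2)
    rwa [e3, e4] at this
  have p3 := congrFun (hc _ hB b) x
  have p4 := congrFun (hc _ hC (b + 2)) x
  rw [e3, e4] at p4
  rw [p1, p2, angDeriv_add (hB.angDeriv b) hC, angDeriv_sub (hC.angDeriv b) hB]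
  linarith

lemma integral_mul_angLaplacian {φ ψ : E3 → ℝ} (h : ContDiff ℝ ∞ φ) (h' : ContDiff ℝ ∞ ψ) :
    ∫ x : S2, φ x * angLaplacian ψ x ∂area =
      - ∑ a, ∫ x : S2, angDeriv a φ x * angDeriv a ψ x ∂area := by
  unfold angLaplacian
  simp only [Finset.mul_sum]
  rw [integral_finsetSum _ fun a _ => (h.mul ((h'.angDeriv a).angDeriv a)).integrable_sphere,
    ← Finset.sum_neg_distrib]
  refine Finset.sum_congr rfl fun a _ => ?_
  have := (h.hasAngDeriv a).2.2 _ (h'.angDeriv a)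
  linarith

/-- Bochner's identity `∫ |∇∇φ|² = ∫ (Δφ)²`, where the full second derivative is measured by the
angular derivatives; it follows from the fact that they commute with the Laplacian. -/
lemma integral_sq_angDeriv_angDeriv {φ : E3 → ℝ} (h : ContDiff ℝ ∞ φ) :
    ∑ a, ∑ b, ∫ x : S2, (angDeriv b (angDeriv a φ) x) ^ 2 ∂area =
      ∫ x : S2, (angLaplacian φ x) ^ 2 ∂area := by
  have h1 (a : Fin 3) : ∑ b, ∫ x : S2, (angDeriv b (angDeriv a φ) x) ^ 2 ∂area =
      - ∫ x : S2, angDeriv a φ x * angDeriv a (angLaplacian φ) x ∂area := by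
    have := integral_mul_angLaplacian (h.angDeriv a) (h.angDeriv a)
    simp only [angLaplacian_angDeriv h] at this
    simp only [pow_two]
    linarith
  have h2 := integral_mul_angLaplacian h.angLaplacian h
  rw [Finset.sum_congr rfl fun a _ => h1 a, Finset.sum_neg_distrib]
  simp only [pow_two, h2, mul_comm]

/-! ### The `L²` norm on the sphere -/

/-- The norm of `L²(S²)`, as a real number. -/
abbrev l2 (f : S2 → ℝ) : ℝ := lpNorm f 2 area

lemma l2_sq {f : S2 → ℝ} (hf : MemLp f 2 area) : (l2 f) ^ 2 = ∫ x, f x ^ 2 ∂area := by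
  have := lpNorm_eq_integral_norm_rpow_toReal (μ := area) (p := 2) (by simp) (by simp)
    hf.aestronglyMeasurable
  rw [l2, this]
  have h0 : 0 ≤ ∫ x, ‖f x‖ ^ (2 : ENNReal).toReal ∂area := by positivity
  rw [← Real.rpow_natCast, ← Real.rpow_mul h0]
  simp

lemma abs_integral_mul_le {f g : S2 → ℝ} (hf : MemLp f 2 area) (hg : MemLp g 2 area) :
    |∫ x, f x * g x ∂area| ≤ l2 f * l2 g := by
  have h1 : ∫ x, f x * g x ∂area = inner ℝ (hf.toLp f) (hg.toLp g) := by
    rw [L2.inner_def]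
    refine integral_congr_ae ?_
    filter_upwards [hf.coeFn_toLp, hg.coeFn_toLp] with x h1 h2
    simp [h1, h2, mul_comm]
  rw [h1]
  refine (abs_real_inner_le_norm _ _).trans_eq ?_
  rw [Lp.norm_toLp, Lp.norm_toLp, toReal_eLpNorm hf.1, toReal_eLpNorm hg.1]

lemma l2_le_of_sq_le {f : S2 → ℝ} (hf : MemLp f 2 area) {c : ℝ} (hc : 0 ≤ c)
    (h : ∫ x, f x ^ 2 ∂area ≤ c ^ 2) : l2 f ≤ c := by
  rw [← l2_sq hf] at h
  exact (sq_le_sq₀ lpNorm_nonneg hc).1 h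

lemma l2_le_of_bound {f : S2 → ℝ} (hf : MemLp f 2 area) {c : ℝ} (hc : 0 ≤ c)
    (h : ∀ x, |f x| ≤ c) : l2 f ≤ c * (area.real Set.univ).sqrt := by
  refine l2_le_of_sq_le hf (by positivity) ?_
  rw [mul_pow, Real.sq_sqrt measureReal_nonneg]
  calc ∫ x, f x ^ 2 ∂area ≤ ∫ x, c ^ 2 ∂area :=
        integral_mono hf.integrable_sq (integrable_const _) fun x => sq_le_sq.2 (by
          rw [abs_of_nonneg hc]; exact h x)
    _ = c ^ 2 * area.real Set.univ := by simp [mul_comm]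

/-! ### Zonal mollification -/

lemma HasAngDeriv.mul_smooth {a : Fin 3} {f g : S2 → ℝ} (h : HasAngDeriv a f g) {ψ : E3 → ℝ}
    (hψ : ContDiff ℝ ∞ ψ) :
    HasAngDeriv a (fun x => f x * ψ x) (fun x => g x * ψ x + f x * angDeriv a ψ x) := by
  refine ⟨integrable_mul_smooth h.1 hψ, (integrable_mul_smooth h.2.1 hψ).add
    (integrable_mul_smooth h.1 (hψ.angDeriv a)), fun φ hφ => ?_⟩
  have := h.2.2 _ (hψ.mul hφ)
  simp only [angDeriv_mul hψ hφ] at this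
  have e1 : ∀ x : S2, f x * (ψ x * angDeriv a φ x + angDeriv a ψ x * φ x) =
      f x * ψ x * angDeriv a φ x + f x * angDeriv a ψ x * φ x := fun x => by ring
  have e2 : ∀ x : S2, (g x * ψ x + f x * angDeriv a ψ x) * φ x =
      g x * (ψ x * φ x) + f x * angDeriv a ψ x * φ x := fun x => by ring
  simp only [e1] at this
  simp only [e2]
  have i1 := integrable_mul_smooth (integrable_mul_smooth h.1 (hψ.angDeriv a)) hφ
  rw [integral_add (integrable_mul_smooth (integrable_mul_smooth h.1 hψ) (hφ.angDeriv a)) i1]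
    at this
  rw [integral_add (integrable_mul_smooth h.2.1 (hψ.mul hφ)) i1, this]
  ring

lemma HasAngDeriv.integral_eq_zero {a : Fin 3} {f g : S2 → ℝ} (h : HasAngDeriv a f g) :
    ∫ x, g x ∂area = 0 := by
  have := h.2.2 (fun _ => 1) contDiff_const
  simpa [angDeriv] using this

/-- The zonal kernel `(1 + ⟨x, y⟩)ⁿ`, integrated against `f`. On the sphere it concentrates at
`y = x` as `n → ∞`. -/
def zonal (n : ℕ) (f : S2 → ℝ) (x : E3) : ℝ := ∫ y : S2, (1 + inner ℝ x (y : E3)) ^ n * f y ∂area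

lemma contDiff_zonalKernel (n : ℕ) (x : E3) :
    ContDiff ℝ ∞ (fun y : E3 => (1 + inner ℝ x y) ^ n) :=
  (contDiff_const.add (contDiff_const.inner ℝ contDiff_id)).pow n

lemma integrable_zonal (n : ℕ) {f : S2 → ℝ} (hf : Integrable f area) (x : E3) :
    Integrable (fun y : S2 => (1 + inner ℝ x (y : E3)) ^ n * f y) area := by
  simpa only [mul_comm] using integrable_mul_smooth hf (contDiff_zonalKernel n x)

/-- Raising the exponent of the kernel costs only a sum of coordinates times zonal integrals with the
old exponent. This gives smoothness and the commutation rule by induction on the exponent. -/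
lemma zonal_succ (n : ℕ) {f : S2 → ℝ} (hf : Integrable f area) (x : E3) :
    zonal (n + 1) f x = zonal n f x + ∑ i, x i * zonal n (fun y => f y * (y : E3) i) x := by
  have hi (i : Fin 3) := integrable_zonal n (integrable_mul_smooth hf (contDiff_coord i)) x
  unfold zonal
  simp only [← integral_const_mul]
  rw [← integral_finsetSum _ (fun i _ => (hi i).const_mul _), ← integral_add
    (integrable_zonal n hf x) (integrable_finsetSum _ fun i _ => (hi i).const_mul _)]
  congr 1
  ext y
  have : ∑ i, x i * ((1 + inner ℝ x (y : E3)) ^ n * (f y * (y : E3) i)) =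
      (1 + inner ℝ x (y : E3)) ^ n * f y * inner ℝ x (y : E3) := by
    conv_rhs => rw [inner_eq_sum x (y : E3), Finset.mul_sum]
    exact Finset.sum_congr rfl fun i _ => by rw [inner_eq_sum]; ring
  rw [this]
  ring

lemma contDiff_zonal (n : ℕ) {f : S2 → ℝ} (hf : Integrable f area) :
    ContDiff ℝ ∞ (zonal n f) := by
  induction n generalizing f with
  | zero => unfold zonal; simpa using contDiff_const
  | succ n ih =>
    rw [funext (zonal_succ n hf)]
    exact (ih hf).add (ContDiff.sum fun i _ => (contDiff_coord i).mul
      (ih (integrable_mul_smooth hf (contDiff_coord i))))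

lemma zonal_add (n : ℕ) {f g : S2 → ℝ} (hf : Integrable f area) (hg : Integrable g area) (x : E3) :
    zonal n (fun y => f y + g y) x = zonal n f x + zonal n g x := by
  unfold zonal
  rw [← integral_add (integrable_zonal n hf x) (integrable_zonal n hg x)]
  simp only [mul_add]

lemma angDeriv_sum {ι : Type*} (s : Finset ι) {φ : ι → E3 → ℝ} (h : ∀ i, ContDiff ℝ ∞ (φ i))
    (a : Fin 3) (x : E3) :
    angDeriv a (fun y => ∑ i ∈ s, φ i y) x = ∑ i ∈ s, angDeriv a (φ i) x := by
  unfold angDeriv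
  rw [fderiv_fun_sum fun i _ => (h i).diffAt x]
  simp

/-- Zonal mollification commutes with the angular derivatives, since the kernel is invariant
under simultaneous rotation of both variables. -/
lemma angDeriv_zonal (n : ℕ) {a : Fin 3} {f g : S2 → ℝ} (h : HasAngDeriv a f g) (x : E3) :
    angDeriv a (zonal n f) x = zonal n g x := by
  induction n generalizing f g with
  | zero =>
    unfold zonal
    simp [angDeriv, h.integral_eq_zero]
  | succ n ih =>
    have hi (i : Fin 3) := integrable_mul_smooth h.1 (contDiff_coord i)
    have hgi (i : Fin 3) := integrable_mul_smooth h.2.1 (contDiff_coord i)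
    have hci (i : Fin 3) : ContDiff ℝ ∞ (fun y : E3 => crossVec a y i) := by
      have := (contDiff_coord i).angDeriv a
      rwa [funext (angDeriv_coord a i)] at this
    have hfc (i : Fin 3) := integrable_mul_smooth h.1 (hci i)
    rw [funext (zonal_succ n h.1), angDeriv_add (contDiff_zonal n h.1)
      (ContDiff.sum fun i _ => (contDiff_coord i).mul (contDiff_zonal n (hi i))),
      angDeriv_sum _ (fun i => (contDiff_coord i).mul (contDiff_zonal n (hi i))), ih h,
      zonal_succ n h.2.1]
    have key (i : Fin 3) := ih (h.mul_smooth (contDiff_coord i))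
    simp only [angDeriv_mul (contDiff_coord _) (contDiff_zonal n (hi _)), key, angDeriv_coord,
      zonal_add n (hgi _) (hfc _), mul_add, Finset.sum_add_distrib]
    have cancel : ∑ i, x i * zonal n (fun y => f y * crossVec a (y : E3) i) x +
        ∑ i, crossVec a x i * zonal n (fun y => f y * (y : E3) i) x = 0 := by
      unfold zonal
      simp only [← integral_const_mul]
      rw [← integral_finsetSum _ (fun i _ => (integrable_zonal n (hfc i) x).const_mul _),
        ← integral_finsetSum _ (fun i _ => (integrable_zonal n (hi i) x).const_mul _),
        ← integral_add (integrable_finsetSum _ fun i _ => (integrable_zonal n (hfc i) x).const_mul _)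
        (integrable_finsetSum _ fun i _ => (integrable_zonal n (hi i) x).const_mul _)]
      refine integral_eq_zero_of_ae (Filter.Eventually.of_forall fun y => ?_)
      have h1 := inner_crossVec a x (y : E3)
      have e1 := inner_eq_sum (crossVec a x) (y : E3)
      have e2 := inner_eq_sum x (crossVec a (y : E3))
      have t1 : ∑ i, x i * ((1 + inner ℝ x (y : E3)) ^ n * (f y * crossVec a (y : E3) i)) =
          (1 + inner ℝ x (y : E3)) ^ n * f y * inner ℝ x (crossVec a (y : E3)) := by
        rw [e2, Finset.mul_sum]
        exact Finset.sum_congr rfl fun i _ => by ring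
      have t2 : ∑ i, crossVec a x i * ((1 + inner ℝ x (y : E3)) ^ n * (f y * (y : E3) i)) =
          (1 + inner ℝ x (y : E3)) ^ n * f y * inner ℝ (crossVec a x) (y : E3) := by
        rw [e1, Finset.mul_sum]
        exact Finset.sum_congr rfl fun i _ => by ring
      simp only [t1, t2, h1, Pi.zero_apply]
      ring
    linarith

lemma exists_isometry_map (x y : S2) : ∃ A : E3 ≃ₗᵢ[ℝ] E3, A x = y := by
  refine ⟨(ℝ ∙ ((x : E3) - (y : E3)))ᗮ.reflection, ?_⟩
  exact Submodule.reflection_sub (by simp)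

/-- The total mass of the zonal kernel. -/
def zonalMass (n : ℕ) : ℝ := zonal n (fun _ => 1) (basisVec 0)

lemma zonal_one (n : ℕ) (x : S2) : zonal n (fun _ => 1) x = zonalMass n := by
  obtain ⟨A, hA⟩ := exists_isometry_map ⟨basisVec 0, by simp⟩ x
  unfold zonalMass zonal
  rw [← integral_sphereMap A]
  simp only [← hA, coe_sphereMap, A.inner_map_map]

lemma one_add_inner (x y : S2) : 1 + inner ℝ (x : E3) (y : E3) = 2 - dist x y ^ 2 / 2 := by
  have : dist x y = ‖(x : E3) - y‖ := by rw [Subtype.dist_eq, dist_eq_norm]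
  rw [this, norm_sub_sq_real]
  simp
  ring

lemma one_add_inner_nonneg (x y : S2) : 0 ≤ 1 + inner ℝ (x : E3) (y : E3) := by
  have := abs_real_inner_le_norm (x : E3) (y : E3)
  simp at this
  linarith [(abs_le.1 this).1]

/-- Up to a constant factor, the mass of the kernel is at least its value at distance `η` from its peak;
the factor is the area of the spherical cap of radius `η`. -/
lemma exists_zonalMass_lower {η : ℝ} (hη : 0 < η) (hη2 : η ≤ 1) :
    ∃ c : ℝ, 0 < c ∧ ∀ n, c * (2 - η ^ 2 / 2) ^ n ≤ zonalMass n := by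
  let x : S2 := ⟨basisVec 0, by simp⟩
  refine ⟨area.real (Metric.ball x η), ?_, fun n => ?_⟩
  · have : area (Metric.ball x η) ≠ 0 := by
      unfold area
      exact Metric.isOpen_ball.measure_ne_zero _ ⟨x, Metric.mem_ball_self hη⟩
    exact ENNReal.toReal_pos this (measure_ne_top _ _)
  · rw [← zonal_one n x]
    unfold zonal
    have hi := integrable_zonal n (integrable_const (1 : ℝ)) (x : E3)
    calc area.real (Metric.ball x η) * (2 - η ^ 2 / 2) ^ n
        = ∫ y in Metric.ball x η, (2 - η ^ 2 / 2) ^ n ∂area := by simp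
      _ ≤ ∫ y in Metric.ball x η, (1 + inner ℝ (x : E3) (y : E3)) ^ n * 1 ∂area := by
          refine setIntegral_mono_on (integrable_const _).integrableOn hi.integrableOn
            measurableSet_ball fun y hy => ?_
          rw [one_add_inner, mul_one]
          have : dist x y < η := by rw [dist_comm]; exact hy
          have h0 : 0 ≤ dist x y := dist_nonneg
          refine pow_le_pow_left₀ (by nlinarith) ?_ n
          nlinarith
      _ ≤ _ := setIntegral_le_integral hi (Filter.Eventually.of_forall fun y => by
          simpa using pow_nonneg (one_add_inner_nonneg x y) n)

lemma zonalMass_pos (n : ℕ) : 0 < zonalMass n := by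
  obtain ⟨c, hc, h⟩ := exists_zonalMass_lower one_pos le_rfl
  exact lt_of_lt_of_le (by positivity) (h n)

/-- The zonal mollification of `f`: its average against the kernel `(1 + ⟨x, y⟩)ⁿ`, as a
function on `ℝ³`. -/
def mollify (n : ℕ) (f : S2 → ℝ) (x : E3) : ℝ := (zonalMass n)⁻¹ * zonal n f x

lemma contDiff_mollify (n : ℕ) {f : S2 → ℝ} (hf : Integrable f area) :
    ContDiff ℝ ∞ (mollify n f) := contDiff_const.mul (contDiff_zonal n hf)

lemma angDeriv_mollify (n : ℕ) {a : Fin 3} {f g : S2 → ℝ} (h : HasAngDeriv a f g) :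
    angDeriv a (mollify n f) = mollify n g := by
  ext x
  unfold mollify
  rw [angDeriv_mul contDiff_const (contDiff_zonal n h.1), angDeriv_zonal n h]
  simp [angDeriv]

lemma mollify_const (n : ℕ) (c : ℝ) (x : S2) : mollify n (fun _ => c) x = c := by
  have : zonal n (fun _ => c) x = c * zonalMass n := by
    rw [← zonal_one n x]
    unfold zonal
    rw [← integral_const_mul]
    simp [mul_comm]
  unfold mollify
  rw [this]
  field_simp [(zonalMass_pos n).ne']

lemma mollify_sub (n : ℕ) {f g : S2 → ℝ} (hf : Integrable f area) (hg : Integrable g area)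
    (x : E3) : mollify n (fun y => f y - g y) x = mollify n f x - mollify n g x := by
  unfold mollify zonal
  rw [← mul_sub, ← integral_sub (integrable_zonal n hf x) (integrable_zonal n hg x)]
  simp only [mul_sub]

lemma mollify_add (n : ℕ) {f g : S2 → ℝ} (hf : Integrable f area) (hg : Integrable g area)
    (x : E3) : mollify n (fun y => f y + g y) x = mollify n f x + mollify n g x := by
  unfold mollify
  rw [zonal_add n hf hg, mul_add]

lemma mollify_const_mul (n : ℕ) (c : ℝ) (f : S2 → ℝ) (x : E3) :
    mollify n (fun y => c * f y) x = c * mollify n f x := by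
  unfold mollify zonal
  simp only [mul_left_comm _ c, integral_const_mul]

lemma mollify_mono (n : ℕ) {f g : S2 → ℝ} (hf : Integrable f area) (hg : Integrable g area)
    (h : ∀ x, f x ≤ g x) (x : S2) : mollify n f x ≤ mollify n g x := by
  unfold mollify zonal
  refine mul_le_mul_of_nonneg_left ?_ (inv_nonneg.2 (zonalMass_pos n).le)
  exact integral_mono (integrable_zonal n hf x) (integrable_zonal n hg x) fun y =>
    mul_le_mul_of_nonneg_left (h y) (pow_nonneg (one_add_inner_nonneg x y) n)

/-- Jensen's inequality for the mollification, which averages against a probability density. -/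
lemma mollify_sq_le (n : ℕ) {f : S2 → ℝ} (hf : MemLp f 2 area) (x : S2) :
    mollify n f x ^ 2 ≤ mollify n (fun y => f y ^ 2) x := by
  have hfi : Integrable f area := hf.integrable (by norm_num)
  set m := mollify n f x with hm
  -- the variance of `f` under the probability density given by the kernel is nonnegative
  have h1 : 0 ≤ mollify n (fun y => (f y - m) ^ 2) x := by
    have h := mollify_mono n (f := fun _ => 0) (g := fun y => (f y - m) ^ 2)
      (integrable_const 0) (hf.sub (memLp_const m)).integrable_sq (fun y => sq_nonneg _) x
    rwa [mollify_const] at h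
  have e : (fun y => (f y - m) ^ 2) = fun y => (f y ^ 2 - (2 * m) * f y) + m ^ 2 := by
    ext y; ring
  rw [e, mollify_add n (f := fun y => f y ^ 2 - 2 * m * f y)
      (hf.integrable_sq.sub (hfi.const_mul (2 * m))) (integrable_const _),
    mollify_sub n hf.integrable_sq (hfi.const_mul _), mollify_const] at h1
  rw [mollify_const_mul, ← hm] at h1
  nlinarith

/-- Mollification preserves the integral, the kernel being symmetric. -/
lemma integral_mollify (n : ℕ) {f : S2 → ℝ} (hf : Integrable f area) :
    ∫ x : S2, mollify n f x ∂area = ∫ x, f x ∂area := by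
  unfold mollify zonal
  rw [integral_const_mul, integral_integral_swap]
  · have (y : S2) : ∫ x : S2, (1 + inner ℝ (x : E3) (y : E3)) ^ n * f y ∂area =
        zonalMass n * f y := by
      rw [integral_mul_const, ← zonal_one n y]
      unfold zonal
      simp only [real_inner_comm, mul_one]
    simp only [this, integral_const_mul]
    rw [inv_mul_cancel_left₀ (zonalMass_pos n).ne']
  · have h1 : Integrable (fun p : S2 × S2 => f p.2) (area.prod area) := hf.comp_snd area
    refine h1.bdd_mul (c := 2 ^ n) ?_ (Filter.Eventually.of_forall fun p => ?_)
    · exact Continuous.aestronglyMeasurable (by fun_prop)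
    · rw [norm_pow]
      refine pow_le_pow_left₀ (norm_nonneg _) ?_ n
      rw [Real.norm_of_nonneg (one_add_inner_nonneg _ _), one_add_inner]
      have := sq_nonneg (dist p.1 p.2)
      linarith

lemma l2_mollify_le (n : ℕ) {f : S2 → ℝ} (hf : MemLp f 2 area) :
    l2 (fun x => mollify n f x) ≤ l2 f := by
  have hfi : Integrable f area := hf.integrable (by norm_num)
  refine l2_le_of_sq_le ((contDiff_mollify n hfi).memLp_sphere 2) lpNorm_nonneg ?_
  rw [l2_sq hf, ← integral_mollify n hf.integrable_sq]
  exact integral_mono ((contDiff_mollify n hfi).memLp_sphere 2).integrable_sq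
    (contDiff_mollify n hf.integrable_sq).integrable_sphere fun x => mollify_sq_le n hf x

lemma tendsto_mollify_continuous {g : S2 → ℝ} (hg : Continuous g) :
    Filter.Tendsto (fun n => l2 (fun x => mollify n g x - g x)) Filter.atTop (nhds 0) := by
  obtain ⟨M, hM⟩ := isCompact_univ.exists_bound_of_continuousOn (hg.continuousOn (s := Set.univ))
  have hM' (x : S2) : |g x| ≤ M := hM x trivial
  have hM0 : 0 ≤ M := (abs_nonneg _).trans (hM' ⟨basisVec 0, by simp⟩)
  have hgL : MemLp g 2 area := MemLp.of_bound hg.aestronglyMeasurable M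
    (Filter.Eventually.of_forall hM')
  have hgi : Integrable g area := hgL.integrable (by norm_num)
  have huc := CompactSpace.uniformContinuous_of_continuous hg
  set V := area.real Set.univ with hV
  have hV0 : 0 ≤ V := measureReal_nonneg
  rw [Metric.tendsto_atTop]
  intro ε hε
  obtain ⟨η', hη', hgη'⟩ := Metric.uniformContinuous_iff.1 huc (ε / (2 * (V.sqrt + 1))) (by positivity)
  set η := min η' 1 with hη
  have hη0 : 0 < η := lt_min hη' one_pos
  have hη1 : η ≤ 1 := min_le_right _ _
  obtain ⟨c, hc, hcn⟩ := exists_zonalMass_lower (η := η / 2) (by positivity) (by linarith)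
  -- off the ball of radius `η` the kernel is smaller by a geometric factor than its mass
  set r := (2 - η ^ 2 / 2) / (2 - (η / 2) ^ 2 / 2) with hr
  have hd : 0 < 2 - (η / 2) ^ 2 / 2 := by nlinarith
  have hr0 : 0 ≤ r := div_nonneg (by nlinarith) hd.le
  have hr1 : r < 1 := by rw [hr, div_lt_one hd]; nlinarith
  have htend : Filter.Tendsto (fun n : ℕ => 2 * M * V / c * r ^ n) Filter.atTop (nhds 0) := by
    simpa using (tendsto_pow_atTop_nhds_zero_of_lt_one hr0 hr1).const_mul (2 * M * V / c)
  obtain ⟨n₀, hn₀⟩ := Metric.tendsto_atTop.1 htend (ε / (2 * (V.sqrt + 1))) (by positivity)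
  refine ⟨n₀, fun n hn => ?_⟩
  have hsmall : 2 * M * V / c * r ^ n ≤ ε / (2 * (V.sqrt + 1)) := by
    have := hn₀ n hn
    rw [Real.dist_eq, sub_zero] at this
    exact (le_abs_self _).trans this.le
  have hpt (x : S2) : |mollify n g x - g x| ≤ ε / (2 * (V.sqrt + 1)) + 2 * M * V / c * r ^ n := by
    have hm := zonalMass_pos n
    have e1 : mollify n g x - g x =
        (zonalMass n)⁻¹ * ∫ y : S2, (1 + inner ℝ (x : E3) (y : E3)) ^ n * (g y - g x) ∂area := by
      have := mollify_sub n hgi (integrable_const (g x)) (x : E3)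
      rw [mollify_const] at this
      rw [← this]
      rfl
    rw [e1, abs_mul, abs_of_pos (inv_pos.2 hm)]
    have hi := integrable_zonal n (integrable_const (1 : ℝ)) (x : E3)
    simp only [mul_one] at hi
    have h2 : |∫ y : S2, (1 + inner ℝ (x : E3) (y : E3)) ^ n * (g y - g x) ∂area| ≤
        ∫ y : S2, (1 + inner ℝ (x : E3) (y : E3)) ^ n * (ε / (2 * (V.sqrt + 1))) +
          2 * M * (2 - η ^ 2 / 2) ^ n ∂area := by
      refine norm_integral_le_of_norm_le (f := fun y : S2 =>
        (1 + inner ℝ (x : E3) (y : E3)) ^ n * (g y - g x)) (g := fun y : S2 => (1 + inner ℝ (x : E3) (y : E3)) ^ n *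
          (ε / (2 * (V.sqrt + 1))) + 2 * M * (2 - η ^ 2 / 2) ^ n)
        ((hi.mul_const _).add (integrable_const _)) (Filter.Eventually.of_forall fun y => ?_)
      have hk := pow_nonneg (one_add_inner_nonneg x y) n
      rw [norm_mul, Real.norm_of_nonneg hk]
      have hε' : 0 ≤ ε / (2 * (V.sqrt + 1)) := by positivity
      have hp : 0 ≤ (2 - η ^ 2 / 2) ^ n := pow_nonneg (by nlinarith) n
      by_cases hxy : dist y x < η
      · have h3 : ‖g y - g x‖ ≤ ε / (2 * (V.sqrt + 1)) :=
          (hgη' (hxy.trans_le (min_le_left _ _))).le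
        have := mul_le_mul_of_nonneg_left h3 hk
        have h4 : 0 ≤ 2 * M * (2 - η ^ 2 / 2) ^ n := by positivity
        linarith
      · have h3 : ‖g y - g x‖ ≤ 2 * M := (norm_sub_le _ _).trans (by
          have h5 := hM' x; have h6 := hM' y
          simp only [Real.norm_eq_abs]; linarith)
        have h4 : (1 + inner ℝ (x : E3) (y : E3)) ^ n ≤ (2 - η ^ 2 / 2) ^ n := by
          refine pow_le_pow_left₀ (one_add_inner_nonneg x y) ?_ n
          rw [one_add_inner, dist_comm]
          have : η ≤ dist y x := not_lt.1 hxy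
          nlinarith
        have h5 := mul_le_mul h4 h3 (norm_nonneg _) hp
        have h6 := mul_nonneg hk hε'
        linarith
    rw [integral_add (hi.mul_const _) (integrable_const _), integral_mul_const,
      integral_const] at h2
    have h7 : ∫ y : S2, (1 + inner ℝ (x : E3) (y : E3)) ^ n ∂area = zonalMass n := by
      rw [← zonal_one n x]; unfold zonal; simp
    rw [h7, smul_eq_mul, ← hV] at h2
    have h8 : (2 - η ^ 2 / 2) ^ n = r ^ n * (2 - (η / 2) ^ 2 / 2) ^ n := by
      rw [hr, div_pow, div_mul_cancel₀ _ (pow_ne_zero n hd.ne')]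
    calc (zonalMass n)⁻¹ * |∫ y : S2, (1 + inner ℝ (x : E3) (y : E3)) ^ n * (g y - g x) ∂area|
        ≤ (zonalMass n)⁻¹ * (zonalMass n * (ε / (2 * (V.sqrt + 1))) +
            V * (2 * M * (2 - η ^ 2 / 2) ^ n)) :=
          mul_le_mul_of_nonneg_left h2 (inv_nonneg.2 hm.le)
      _ = ε / (2 * (V.sqrt + 1)) + (zonalMass n)⁻¹ * (V * (2 * M * (2 - η ^ 2 / 2) ^ n)) := by
          field_simp
      _ ≤ _ := by
          refine add_le_add le_rfl ?_
          rw [h8, inv_mul_le_iff₀ hm]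
          have h9 : 0 ≤ 2 * M * V / c * r ^ n := by positivity
          calc V * (2 * M * (r ^ n * (2 - (η / 2) ^ 2 / 2) ^ n))
              = (c * (2 - (η / 2) ^ 2 / 2) ^ n) * (2 * M * V / c * r ^ n) := by field_simp
            _ ≤ _ := mul_le_mul_of_nonneg_right (hcn n) h9
  have hL : MemLp (fun x : S2 => mollify n g x - g x) 2 area :=
    ((contDiff_mollify n hgi).memLp_sphere 2).sub hgL
  have hfin := l2_le_of_bound hL (c := ε / (V.sqrt + 1)) (by positivity) fun x =>
    (hpt x).trans (by
      calc _ ≤ ε / (2 * (V.sqrt + 1)) + ε / (2 * (V.sqrt + 1)) := by linarith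
        _ = ε / (V.sqrt + 1) := by field_simp; ring)
  rw [Real.dist_eq, sub_zero, abs_of_nonneg lpNorm_nonneg]
  refine hfin.trans_lt ?_
  rw [← hV, div_mul_eq_mul_div, div_lt_iff₀ (by positivity)]
  nlinarith [Real.sqrt_nonneg V]

/-- Convergence on all of `L²`, by density of the continuous functions and the contraction property
of the mollification. -/
lemma tendsto_mollify {f : S2 → ℝ} (hf : MemLp f 2 area) :
    Filter.Tendsto (fun n => l2 (fun x => mollify n f x - f x)) Filter.atTop (nhds 0) := by
  rw [Metric.tendsto_atTop]
  intro ε hε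
  obtain ⟨g, hg, hgL⟩ := hf.exists_boundedContinuous_eLpNorm_sub_le (by simp)
    (ε := ENNReal.ofReal (ε / 4)) (by simpa using hε)
  have hfg : l2 (fun x => f x - g x) ≤ ε / 4 := by
    have h := (hf.sub hgL)
    rw [← ofReal_lpNorm h] at hg
    exact (ENNReal.ofReal_le_ofReal_iff (by positivity)).1 hg
  obtain ⟨n₀, hn₀⟩ := Metric.tendsto_atTop.1 (tendsto_mollify_continuous g.continuous) (ε / 4)
    (by positivity)
  refine ⟨n₀, fun n hn => ?_⟩
  have h1 := hn₀ n hn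
  rw [Real.dist_eq, sub_zero, abs_of_nonneg lpNorm_nonneg] at h1 ⊢
  have hfi : Integrable f area := hf.integrable (by norm_num)
  have hgi : Integrable g area := hgL.integrable (by norm_num)
  have e : (fun x : S2 => mollify n f x - f x) =
      ((fun x : S2 => mollify n (fun y => f y - g y) x) + fun x : S2 => (mollify n g x - g x)) -
        fun x => (f x - g x) := by
    ext x; simp [mollify_sub n hfi hgi]
  have m1 : MemLp (fun x : S2 => mollify n (fun y => f y - g y) x) 2 area :=
    (contDiff_mollify n (hfi.sub hgi)).memLp_sphere 2
  have m2 : MemLp (fun x : S2 => mollify n g x - g x) 2 area :=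
    ((contDiff_mollify n hgi).memLp_sphere 2).sub hgL
  rw [e]
  have h2 := lpNorm_sub_le (m1.add m2) (g := fun x => f x - g x) (p := 2) (by norm_num)
  have h3 := lpNorm_add_le m1 (g := fun x : S2 => mollify n g x - g x) (p := 2) (by norm_num)
  have h4 := l2_mollify_le n (hf.sub hgL)
  have h5 : l2 (fun x : S2 => mollify n (fun y => f y - g y) x) ≤ l2 (fun x => f x - g x) := h4
  linarith

/-! ### Central projection onto the faces of a cube -/

/-- The square `[-1, 1]²`. -/
def square : Set (ℝ × ℝ) := Set.Icc (-1) 1 ×ˢ Set.Icc (-1) 1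

/-- The point `e_i + a e_{i+1} + c e_{i+2}` on a face of the cube `[-1, 1]³`. -/
def facePoint (i : Fin 3) (p : ℝ × ℝ) : E3 :=
  basisVec i + p.1 • basisVec (i + 1) + p.2 • basisVec (i + 2)

lemma facePoint_apply (i : Fin 3) (p : ℝ × ℝ) :
    facePoint i p i = 1 ∧ facePoint i p (i + 1) = p.1 ∧ facePoint i p (i + 2) = p.2 := by
  have := cyc_ne i
  simp [facePoint, this]

lemma norm_sq_facePoint (i : Fin 3) (p : ℝ × ℝ) :
    ‖facePoint i p‖ ^ 2 = 1 + p.1 ^ 2 + p.2 ^ 2 := by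
  obtain ⟨h0, h1, h2⟩ := facePoint_apply i p
  rw [norm_sq_cyclic i, h0, h1, h2, one_pow]

lemma norm_facePoint (i : Fin 3) (p : ℝ × ℝ) :
    ‖facePoint i p‖ = Real.sqrt (1 + p.1 ^ 2 + p.2 ^ 2) := by
  rw [← norm_sq_facePoint i, Real.sqrt_sq (norm_nonneg _)]

lemma facePoint_norm_pos (i : Fin 3) (p : ℝ × ℝ) : 0 < ‖facePoint i p‖ := by
  rw [norm_facePoint]; positivity

/-- The sign attached to a boolean. -/
def sgn (s : Bool) : ℝ := if s then 1 else -1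

lemma sgn_sq (s : Bool) : sgn s * sgn s = 1 := by cases s <;> simp [sgn]

lemma abs_sgn (s : Bool) : |sgn s| = 1 := by cases s <;> simp [sgn]

/-- The central projection of the face of the cube with `x_i = ±1` onto the sphere. -/
def faceMap (i : Fin 3) (s : Bool) (p : ℝ × ℝ) : S2 :=
  ⟨(sgn s * ‖facePoint i p‖⁻¹) • facePoint i p, by
    have := facePoint_norm_pos i p
    simp [norm_smul, abs_sgn, this.ne']⟩

lemma coe_faceMap (i : Fin 3) (s : Bool) (p : ℝ × ℝ) : (faceMap i s p : E3) =
    (sgn s * (Real.sqrt (1 + p.1 ^ 2 + p.2 ^ 2))⁻¹) • facePoint i p := by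
  rw [← norm_facePoint i]; rfl

lemma continuous_facePoint (i : Fin 3) : Continuous (facePoint i) := by
  unfold facePoint; fun_prop

lemma continuous_faceMap (i : Fin 3) (s : Bool) : Continuous (faceMap i s) := by
  unfold faceMap
  refine Continuous.subtype_mk ?_ _
  exact (continuous_const.mul ((continuous_facePoint i).norm.inv₀
    fun p => (facePoint_norm_pos i p).ne')).smul (continuous_facePoint i)

/-- The isometry carrying the face `x_0 = 1` to the face `x_i = ±1`. -/
def faceIso (i : Fin 3) (s : Bool) : E3 ≃ₗᵢ[ℝ] E3 :=
  (LinearIsometryEquiv.piLpCongrLeft 2 ℝ ℝ (Equiv.addLeft i)).trans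
    (if s then LinearIsometryEquiv.refl ℝ E3 else LinearIsometryEquiv.neg ℝ)

lemma faceIso_apply (i : Fin 3) (s : Bool) (x : E3) (j : Fin 3) :
    faceIso i s x (i + j) = sgn s * x j := by
  cases s <;> simp [faceIso, sgn, Equiv.piCongrLeft'_apply]

lemma faceIso_facePoint (i : Fin 3) (s : Bool) (p : ℝ × ℝ) :
    faceIso i s (facePoint 0 p) = sgn s • facePoint i p := by
  obtain ⟨h0, h1, h2⟩ := facePoint_apply i p
  obtain ⟨k0, k1, k2⟩ := facePoint_apply 0 p
  have l0 := faceIso_apply i s (facePoint 0 p) 0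
  rw [add_zero] at l0
  apply ext_cyclic i
  · rw [l0, k0]; simp [h0]
  · rw [faceIso_apply]; rw [zero_add] at k1; simp [k1, h1]
  · rw [faceIso_apply]; rw [zero_add] at k2; simp [k2, h2]

lemma sphereMap_faceMap (i : Fin 3) (s : Bool) (p : ℝ × ℝ) :
    sphereMap (faceIso i s) (faceMap 0 true p) = faceMap i s p := by
  ext1
  rw [coe_sphereMap, coe_faceMap, coe_faceMap, map_smul, faceIso_facePoint, smul_smul]
  simp [sgn, mul_comm]

/-- The part of the sphere over the face of the cube with `x_0 = 1`. -/
def faceCone : Set S2 :=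
  {x | 0 < (x : E3) 0 ∧ ((x : E3) 1 / (x : E3) 0, (x : E3) 2 / (x : E3) 0) ∈ square}

lemma facePoint_ratio {y : E3} (h : y 0 ≠ 0) : facePoint 0 (y 1 / y 0, y 2 / y 0) = (y 0)⁻¹ • y := by
  obtain ⟨k0, k1, k2⟩ := facePoint_apply 0 (y 1 / y 0, y 2 / y 0)
  rw [zero_add] at k1 k2
  apply ext_cyclic 0
  · rw [k0]; simp [h]
  · rw [zero_add, k1]; simp; ring
  · rw [zero_add, k2]; simp; ring

lemma faceMap_ratio {y : E3} (h : 0 < y 0) :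
    (faceMap 0 true (y 1 / y 0, y 2 / y 0) : E3) = ‖y‖⁻¹ • y := by
  unfold faceMap
  simp only [facePoint_ratio h.ne', sgn, if_true, one_mul, norm_smul, norm_inv, mul_inv, inv_inv,
    smul_smul, Real.norm_of_nonneg h.le]
  rw [mul_right_comm, mul_inv_cancel₀ h.ne', one_mul]

open scoped Pointwise in
/-- The volume of a truncated cone over a plane set. -/
lemma volume_cone {Q : Set (ℝ × ℝ)} (hQ : MeasurableSet Q) {r₀ : ℝ} (hr₀ : 0 ≤ r₀) :
    volume {y : E3 | (0 < y 0 ∧ y 0 < r₀) ∧ (y 1 / y 0, y 2 / y 0) ∈ Q} =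
      ENNReal.ofReal (r₀ ^ 3 / 3) * volume Q := by
  have h1 := EuclideanSpace.volume_preserving_symm_measurableEquiv_toLp (Fin 3)
  have h2 := volume_preserving_piFinSuccAbove (fun _ : Fin 3 => ℝ) 0
  have h3 := (MeasurePreserving.id (volume : Measure ℝ)).prod
    (volume_preserving_finTwoArrow ℝ)
  have h := (h3.comp h2).comp h1
  set T : Set (ℝ × (ℝ × ℝ)) := {q | (0 < q.1 ∧ q.1 < r₀) ∧ (q.2.1 / q.1, q.2.2 / q.1) ∈ Q} with hT
  have hTm : MeasurableSet T := by
    refine MeasurableSet.inter ?_ ?_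
    · exact (measurableSet_lt measurable_const measurable_fst).inter
        (measurableSet_lt measurable_fst measurable_const)
    · exact (((measurable_fst.comp measurable_snd).div measurable_fst).prodMk
        ((measurable_snd.comp measurable_snd).div measurable_fst)) hQ
  have hpre := h.measure_preimage hTm.nullMeasurableSet
  refine Eq.trans hpre ?_
  rw [Measure.volume_eq_prod, Measure.prod_apply hTm]
  have hslice (r : ℝ) : volume (Prod.mk r ⁻¹' T) =
      (Set.Ioo 0 r₀).indicator (fun r => ENNReal.ofReal (r ^ 2) * volume Q) r := by
    by_cases hr : r ∈ Set.Ioo 0 r₀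
    · have hr0 : r ≠ 0 := hr.1.ne'
      rw [Set.indicator_of_mem hr]
      have : Prod.mk r ⁻¹' T = r • Q := by
        ext z
        rw [Set.mem_smul_set_iff_inv_smul_mem₀ hr0]
        simp only [hT, Set.mem_preimage, Set.mem_ofPred_eq]
        have : (z.1 / r, z.2 / r) = r⁻¹ • z := by
          ext <;> simp [div_eq_inv_mul]
        rw [this]
        exact ⟨fun h => h.2, fun h => ⟨hr, h⟩⟩
      rw [this, Measure.addHaar_smul]
      simp
    · rw [Set.indicator_of_notMem hr]
      have : Prod.mk r ⁻¹' T = ∅ := by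
        ext z
        simp only [hT, Set.mem_preimage, Set.mem_ofPred_eq, Set.mem_empty_iff_false, iff_false]
        exact fun h => hr h.1
      rw [this, measure_empty]
  refine (lintegral_congr hslice).trans ?_
  rw [lintegral_indicator measurableSet_Ioo, lintegral_mul_const _ (by fun_prop)]
  congr 1
  rw [← ofReal_integral_eq_lintegral_ofReal, ← integral_Ioc_eq_integral_Ioo,
    ← intervalIntegral.integral_of_le hr₀]
  · congr 1; simp; norm_num
  · exact (intervalIntegral.intervalIntegrable_pow 2 (μ := volume) (a := 0) (b := r₀)).1.mono_set Set.Ioo_subset_Ioc_self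
  · exact Filter.Eventually.of_forall fun r => sq_nonneg r

/-- The area measure of the square, carried to the sphere by central projection. -/
def faceMeasure (i : Fin 3) (s : Bool) : Measure S2 :=
  (volume.restrict square).map (faceMap i s)

lemma faceMeasure_zero_apply {t : Set S2} (ht : MeasurableSet t) :
    faceMeasure 0 true t = volume (faceMap 0 true ⁻¹' t ∩ square) := by
  have hm := (continuous_faceMap 0 true).measurable
  rw [faceMeasure, Measure.map_apply hm ht, Measure.restrict_apply (hm ht)]

lemma measurableSet_square : MeasurableSet square := measurableSet_Icc.prod measurableSet_Icc

open scoped Pointwise in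
/-- Both measures are three times the volume of a cone with its vertex at the origin: the spherical
cone over a set is contained in the cone of height `1` over its central projection. -/
lemma area_inter_faceCone_le {t : Set S2} (ht : MeasurableSet t) :
    area (t ∩ faceCone) ≤ faceMeasure 0 true t := by
  have hm := (continuous_faceMap 0 true).measurable
  have hc : MeasurableSet faceCone := by
    have hi (i : Fin 3) : Measurable (fun x : S2 => (x : E3) i) :=
      ((contDiff_coord i).continuous.comp continuous_subtype_val).measurable
    exact (measurableSet_lt measurable_const (hi 0)).inter
      ((((hi 1).div (hi 0)).prodMk ((hi 2).div (hi 0))) measurableSet_square)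
  rw [faceMeasure_zero_apply ht, area, Measure.toSphere_apply' _ (ht.inter hc)]
  have h1 := volume_cone ((hm ht).inter measurableSet_square) zero_le_one
  have hsub : Set.Ioo (0 : ℝ) 1 • ((fun x : S2 => (x : E3)) '' (t ∩ faceCone)) ⊆
      {y : E3 | (0 < y 0 ∧ y 0 < 1) ∧
        (y 1 / y 0, y 2 / y 0) ∈ faceMap 0 true ⁻¹' t ∩ square} := by
    rintro _ ⟨r, hr, _, ⟨x, ⟨hxt, hx0, hxs⟩, rfl⟩, rfl⟩
    have hx1 : (x : E3) 0 ≤ 1 := by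
      have h2 := norm_sq_cyclic 0 (x : E3)
      simp only [norm_eq_of_mem_sphere] at h2
      nlinarith [sq_nonneg ((x : E3) (0 + 1)), sq_nonneg ((x : E3) (0 + 2))]
    have e1 : (r • (x : E3)) 1 / (r • (x : E3)) 0 = (x : E3) 1 / (x : E3) 0 := by
      simp [mul_div_mul_left _ _ hr.1.ne']
    have e2 : (r • (x : E3)) 2 / (r • (x : E3)) 0 = (x : E3) 2 / (x : E3) 0 := by
      simp [mul_div_mul_left _ _ hr.1.ne']
    refine ⟨⟨?_, ?_⟩, ?_, ?_⟩
    · simpa using mul_pos hr.1 hx0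
    · simp only [PiLp.smul_apply, smul_eq_mul]
      nlinarith [hr.1, hr.2]
    · change faceMap 0 true ((r • (x : E3)) 1 / (r • (x : E3)) 0,
        (r • (x : E3)) 2 / (r • (x : E3)) 0) ∈ t
      rw [e1, e2]
      have : faceMap 0 true ((x : E3) 1 / (x : E3) 0, (x : E3) 2 / (x : E3) 0) = x := by
        ext1; rw [faceMap_ratio hx0]; simp
      rwa [this]
    · change ((r • (x : E3)) 1 / (r • (x : E3)) 0, (r • (x : E3)) 2 / (r • (x : E3)) 0) ∈ square
      rwa [e1, e2]
  calc _ ≤ (Module.finrank ℝ E3 : ENNReal) *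
        (ENNReal.ofReal (1 ^ 3 / 3) * volume (faceMap 0 true ⁻¹' t ∩ square)) := by
        rw [← h1]
        exact mul_le_mul_right (measure_mono hsub) _
    _ = _ := by
        rw [← mul_assoc, finrank_euclideanSpace_fin, one_pow, ENNReal.ofReal_div_of_pos (by norm_num)]
        simp [ENNReal.mul_inv_cancel]

open scoped Pointwise in
/-- The cone of height `1/2` over the face lies in the unit ball, since the points of the face have
norm at most `√3 < 2`; halving the height divides the volume by `8`. -/
lemma faceMeasure_zero_le {t : Set S2} (ht : MeasurableSet t) :
    faceMeasure 0 true t ≤ 8 * area t := by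
  have hm := (continuous_faceMap 0 true).measurable
  rw [faceMeasure_zero_apply ht, area, Measure.toSphere_apply' _ ht]
  have h1 := volume_cone ((hm ht).inter measurableSet_square) (r₀ := 1 / 2) (by norm_num)
  have hsub : {y : E3 | (0 < y 0 ∧ y 0 < 1 / 2) ∧
        (y 1 / y 0, y 2 / y 0) ∈ faceMap 0 true ⁻¹' t ∩ square} ⊆
      Set.Ioo (0 : ℝ) 1 • ((fun x : S2 => (x : E3)) '' t) := by
    rintro y ⟨⟨hy0, hy1⟩, hyt, hys⟩
    have hne : y ≠ 0 := by rintro rfl; simp at hy0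
    have hn : 0 < ‖y‖ := norm_pos_iff.2 hne
    refine ⟨‖y‖, ⟨hn, ?_⟩, _, ⟨_, hyt, rfl⟩, ?_⟩
    · obtain ⟨⟨a1, a2⟩, b1, b2⟩ := hys
      simp only [le_div_iff₀ hy0, div_le_iff₀ hy0] at a1 a2 b1 b2
      have h2 := norm_sq_cyclic 0 y
      rw [zero_add, zero_add] at h2
      have : ‖y‖ ^ 2 < 1 ^ 2 := by rw [h2]; nlinarith
      exact (sq_lt_sq₀ hn.le zero_le_one).1 this
    · simp only [faceMap_ratio hy0, smul_smul, mul_inv_cancel₀ hn.ne', one_smul]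
  calc volume (faceMap 0 true ⁻¹' t ∩ square)
      = 24 * (ENNReal.ofReal ((1 / 2) ^ 3 / 3) * volume (faceMap 0 true ⁻¹' t ∩ square)) := by
        rw [← mul_assoc]
        have : (24 : ENNReal) = ENNReal.ofReal 24 := by simp
        rw [this, ← ENNReal.ofReal_mul (by norm_num)]
        norm_num
    _ ≤ 24 * volume (Set.Ioo (0 : ℝ) 1 • ((fun x : S2 => (x : E3)) '' t)) := by
        rw [← h1]
        exact mul_le_mul_right (measure_mono hsub) _
    _ = _ := by
        rw [← mul_assoc, finrank_euclideanSpace_fin]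
        congr 1
        norm_num

lemma faceMeasure_eq_map (i : Fin 3) (s : Bool) :
    faceMeasure i s = (faceMeasure 0 true).map (sphereMap (faceIso i s)) := by
  unfold faceMeasure
  rw [Measure.map_map (continuous_sphereMap _).measurable (continuous_faceMap _ _).measurable]
  congr 1
  ext1 p
  exact (sphereMap_faceMap i s p).symm

lemma faceMeasure_le (i : Fin 3) (s : Bool) : faceMeasure i s ≤ (8 : ENNReal) • area := by
  refine Measure.le_iff.2 fun t ht => ?_
  have hA := measurePreserving_sphereMap (faceIso i s)
  rw [faceMeasure_eq_map, Measure.map_apply hA.measurable ht]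
  refine (faceMeasure_zero_le (hA.measurable ht)).trans_eq ?_
  rw [hA.measure_preimage ht.nullMeasurableSet]
  rfl

/-- Every point of the sphere lies over one of the six faces of the cube. -/
lemma exists_faceCone (x : S2) : ∃ i s, ∃ y ∈ faceCone, sphereMap (faceIso i s) y = x := by
  obtain ⟨i, -, hi⟩ := Finset.exists_max_image Finset.univ (fun i => |(x : E3) i|) ⟨0, by simp⟩
  have hmax (j : Fin 3) : |(x : E3) j| ≤ |(x : E3) i| := hi j (by simp)
  have hne : (x : E3) i ≠ 0 := by
    intro h0
    have : (x : E3) = 0 := by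
      ext j
      have := hmax j
      rw [h0, abs_zero] at this
      exact abs_eq_zero.1 (le_antisymm this (abs_nonneg _))
    have h1 : ‖(x : E3)‖ = 1 := norm_eq_of_mem_sphere x
    rw [this] at h1
    simp at h1
  let s : Bool := decide (0 < (x : E3) i)
  have hs : sgn s * (x : E3) i = |(x : E3) i| := by
    by_cases h : 0 < (x : E3) i
    · simp [s, sgn, h, abs_of_pos h]
    · have : (x : E3) i < 0 := lt_of_le_of_ne (not_lt.1 h) hne
      simp [s, sgn, h, abs_of_neg this]
  let y := sphereMap (faceIso i s).symm x
  have hy : faceIso i s y = x := (faceIso i s).apply_symm_apply x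
  have hyj (j : Fin 3) : (y : E3) j = sgn s * (x : E3) (i + j) := by
    rw [← hy, faceIso_apply, ← mul_assoc, sgn_sq, one_mul]
  have hpos : 0 < |(x : E3) i| := abs_pos.2 hne
  have h0 : (y : E3) 0 = |(x : E3) i| := by rw [hyj, add_zero, hs]
  have hr (j : Fin 3) : (y : E3) j / (y : E3) 0 ∈ Set.Icc (-1 : ℝ) 1 := by
    rw [Set.mem_Icc, ← abs_le, abs_div, h0, abs_abs, div_le_one hpos, hyj, abs_mul, abs_sgn, one_mul]
    exact hmax _
  exact ⟨i, s, y, ⟨by rw [h0]; exact hpos, hr 1, hr 2⟩, Subtype.ext hy⟩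

lemma area_le_sum_faceMeasure : area ≤ ∑ i, ∑ s, faceMeasure i s := by
  refine Measure.le_iff.2 fun t ht => ?_
  have hA (i : Fin 3) (s : Bool) := measurePreserving_sphereMap (faceIso i s)
  have hcov : t ⊆ ⋃ i, ⋃ s, sphereMap (faceIso i s) '' (sphereMap (faceIso i s) ⁻¹' t ∩ faceCone) := by
    intro x hx
    obtain ⟨i, s, y, hy, rfl⟩ := exists_faceCone x
    exact Set.mem_iUnion.2 ⟨i, Set.mem_iUnion.2 ⟨s, y, ⟨hx, hy⟩, rfl⟩⟩
  have hinj (i : Fin 3) (s : Bool) : Function.Injective (sphereMap (faceIso i s)) := fun x y h => by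
    have : faceIso i s x = faceIso i s y := congrArg Subtype.val h
    exact Subtype.ext ((faceIso i s).injective this)
  have him (i : Fin 3) (s : Bool) (w : Set S2) : area (sphereMap (faceIso i s) '' w) = area w := by
    have hme := (continuous_sphereMap (faceIso i s)).measurableEmbedding (hinj i s)
    have := hme.map_apply area (sphereMap (faceIso i s) '' w)
    rw [(hA i s).map_eq, (hinj i s).preimage_image] at this
    exact this
  calc area t ≤ area (⋃ i, ⋃ s, sphereMap (faceIso i s) ''
        (sphereMap (faceIso i s) ⁻¹' t ∩ faceCone)) := measure_mono hcov
    _ ≤ ∑ i, area (⋃ s, sphereMap (faceIso i s) ''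
        (sphereMap (faceIso i s) ⁻¹' t ∩ faceCone)) := measure_iUnion_fintype_le _ _
    _ ≤ ∑ i, ∑ s, area (sphereMap (faceIso i s) ''
        (sphereMap (faceIso i s) ⁻¹' t ∩ faceCone)) :=
        Finset.sum_le_sum fun i _ => measure_iUnion_fintype_le _ _
    _ ≤ ∑ i, ∑ s, faceMeasure i s t := by
        refine Finset.sum_le_sum fun i _ => Finset.sum_le_sum fun s _ => ?_
        rw [him, faceMeasure_eq_map, Measure.map_apply (hA i s).measurable ht]
        exact area_inter_faceCone_le ((hA i s).measurable ht)
    _ = (∑ i, ∑ s, faceMeasure i s) t := by simp [Measure.finsetSum_apply]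

/-! ### Endpoint Sobolev inequalities for smooth functions -/

/-- The one-dimensional inequality `W^{1,1} ⊂ L^∞` on `[-1, 1]`: a value differs from the mean value
by at most the total variation. -/
lemma ofReal_abs_le_lintegral {h h' : ℝ → ℝ} (hd : ∀ t, HasDerivAt h (h' t) t)
    (hc : Continuous h') {t : ℝ} (ht : t ∈ Set.Icc (-1 : ℝ) 1) :
    ENNReal.ofReal |h t| ≤ ∫⁻ s in Set.Icc (-1 : ℝ) 1, ENNReal.ofReal (|h s| + |h' s|) := by
  have hcont : Continuous h := continuous_iff_continuousAt.2 fun s => (hd s).continuousAt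
  have hi {f : ℝ → ℝ} (hf : Continuous f) : IntegrableOn f (Set.Icc (-1 : ℝ) 1) :=
    hf.integrableOn_Icc
  set B := ∫ s in Set.Icc (-1 : ℝ) 1, |h' s| with hB
  have h1 : ∀ s ∈ Set.Icc (-1 : ℝ) 1, |h t| ≤ |h s| + B := by
    intro s hs
    have hftc : h t - h s = ∫ r in s..t, h' r :=
      (intervalIntegral.integral_eq_sub_of_hasDerivAt (fun r _ => hd r)
        (hc.intervalIntegrable _ _)).symm
    have h2 : |h t - h s| ≤ B := by
      rw [hftc]
      refine (intervalIntegral.norm_integral_le_integral_norm_uIoc (f := h')).trans ?_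
      refine setIntegral_mono_set (hi hc.abs) (Filter.Eventually.of_forall fun _ => abs_nonneg _) ?_
      exact (Set.uIoc_subset_uIcc.trans (Set.uIcc_subset_Icc hs ht)).eventuallyLE
    linarith [abs_sub_abs_le_abs_sub (h t) (h s)]
  have h3 := setIntegral_mono_on (integrableOn_const (by simp)) ((hi hcont.abs).add
    (integrableOn_const (by simp))) measurableSet_Icc h1
  have h4 : ∫ s in Set.Icc (-1 : ℝ) 1, (|h s| + B) = (∫ s in Set.Icc (-1 : ℝ) 1, |h s|) + 2 * B := by
    rw [integral_add (hi hcont.abs) (integrableOn_const (by simp))]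
    simp; norm_num
  have h5 : ∫ s in Set.Icc (-1 : ℝ) 1, |h t| = 2 * |h t| := by
    simp; norm_num
  have h3' : 2 * |h t| ≤ (∫ s in Set.Icc (-1 : ℝ) 1, |h s|) + 2 * B := by
    rw [← h4, ← h5]; exact h3
  have h6 : 0 ≤ ∫ s in Set.Icc (-1 : ℝ) 1, |h s| := integral_nonneg fun _ => abs_nonneg _
  rw [← ofReal_integral_eq_lintegral_ofReal (f := fun s => |h s| + |h' s|)
    (hi (hcont.abs.add hc.abs)) (Filter.Eventually.of_forall fun _ => add_nonneg (abs_nonneg _) (abs_nonneg _)),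
    integral_add (hi hcont.abs) (hi hc.abs)]
  exact ENNReal.ofReal_le_ofReal (by linarith)

/-- `|φ| + ∑ₐ |Lₐ φ|`. -/
def angSize (φ : E3 → ℝ) (x : E3) : ℝ := |φ x| + ∑ a, |angDeriv a φ x|

lemma angSize_nonneg (φ : E3 → ℝ) (x : E3) : 0 ≤ angSize φ x :=
  add_nonneg (abs_nonneg _) (Finset.sum_nonneg fun _ _ => abs_nonneg _)

lemma continuous_angSize {φ : E3 → ℝ} (h : ContDiff ℝ ∞ φ) : Continuous (angSize φ) :=
  h.continuous.abs.add (continuous_finsetSum _ fun a _ => (h.angDeriv a).continuous.abs)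

lemma hasDerivAt_norm_inv {d t : ℝ} (hd : 0 < d) :
    HasDerivAt (fun a : ℝ => (Real.sqrt (d + a ^ 2))⁻¹)
      (-(t / (Real.sqrt (d + t ^ 2) * (d + t ^ 2)))) t := by
  have hp : 0 < d + t ^ 2 := by positivity
  have h1 : HasDerivAt (fun a : ℝ => d + a ^ 2) (2 * t) t := by
    simpa using (hasDerivAt_pow 2 t).const_add d
  have h2 := (h1.sqrt hp.ne').inv (Real.sqrt_pos.2 hp).ne'
  refine h2.congr_deriv ?_
  rw [Real.sq_sqrt hp.le]
  have := Real.sqrt_pos.2 hp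
  field_simp

/-- Along the first coordinate of a face the central projection moves in a combination of two of the
rotation fields, with coefficients of absolute value at most `1`. -/
lemma faceMap_deriv_fst {φ : E3 → ℝ} (h : ContDiff ℝ ∞ φ) (i : Fin 3) (s : Bool) (a c : ℝ) :
    HasDerivAt (fun t => φ (faceMap i s (t, c)))
      ((angDeriv (i + 2) φ (faceMap i s (a, c)) - c * angDeriv i φ (faceMap i s (a, c))) /
        (1 + a ^ 2 + c ^ 2)) a := by
  have hD : HasDerivAt (fun t => (faceMap i s (t, c) : E3))
      ((1 + a ^ 2 + c ^ 2)⁻¹ • (crossVec (i + 2) (faceMap i s (a, c)) -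
        c • crossVec i (faceMap i s (a, c)))) a := by
    have h1 : HasDerivAt (fun t : ℝ => facePoint i (t, c)) (basisVec (i + 1)) a := by
      unfold facePoint
      have := (((hasDerivAt_id a).smul_const (basisVec (i + 1))).const_add (basisVec i)).add_const
        (c • basisVec (i + 2))
      simpa using this
    have h2 := (hasDerivAt_norm_inv (d := 1 + c ^ 2) (t := a) (by positivity)).const_mul (sgn s)
    have h3 := h2.smul h1
    have e : (fun t => (faceMap i s (t, c) : E3)) = fun t =>
        (sgn s * (Real.sqrt (1 + c ^ 2 + t ^ 2))⁻¹) • facePoint i (t, c) := by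
      ext1 t
      rw [coe_faceMap]
      simp only [add_right_comm]
    rw [e]
    refine h3.congr_deriv ?_
    rw [coe_faceMap]
    have hne := cyc_ne i
    have i1 : i + 2 + 1 = i := by fin_cases i <;> rfl
    have i2 : i + 2 + 2 = i + 1 := by fin_cases i <;> rfl
    obtain ⟨k0, k1, k2⟩ := facePoint_apply i (a, c)
    have hρ : 0 < Real.sqrt (1 + a ^ 2 + c ^ 2) := by positivity
    have hρ2 : 0 < 1 + a ^ 2 + c ^ 2 := by positivity
    simp only [add_right_comm 1 (c ^ 2) (a ^ 2)]
    apply ext_cyclic i <;>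
      (simp [crossVec, hne, k0, k1, k2, i1, i2]; try field_simp; try ring)
  have h4 := ((h.diffAt (faceMap i s (a, c))).hasFDerivAt).comp_hasDerivAt a hD
  refine h4.congr_deriv ?_
  simp only [map_smul, map_sub, smul_eq_mul, angDeriv]
  rw [div_eq_inv_mul]

lemma faceMap_deriv_snd {φ : E3 → ℝ} (h : ContDiff ℝ ∞ φ) (i : Fin 3) (s : Bool) (a c : ℝ) :
    HasDerivAt (fun t => φ (faceMap i s (a, t)))
      ((a * angDeriv i φ (faceMap i s (a, c)) - angDeriv (i + 1) φ (faceMap i s (a, c))) /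
        (1 + a ^ 2 + c ^ 2)) c := by
  have hD : HasDerivAt (fun t => (faceMap i s (a, t) : E3))
      ((1 + a ^ 2 + c ^ 2)⁻¹ • (a • crossVec i (faceMap i s (a, c)) -
        crossVec (i + 1) (faceMap i s (a, c)))) c := by
    have h1 : HasDerivAt (fun t : ℝ => facePoint i (a, t)) (basisVec (i + 2)) c := by
      unfold facePoint
      have := ((hasDerivAt_id c).smul_const (basisVec (i + 2))).const_add
        (basisVec i + a • basisVec (i + 1))
      simpa using this
    have h2 := (hasDerivAt_norm_inv (d := 1 + a ^ 2) (t := c) (by positivity)).const_mul (sgn s)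
    have h3 := h2.smul h1
    have e : (fun t => (faceMap i s (a, t) : E3)) = fun t =>
        (sgn s * (Real.sqrt (1 + a ^ 2 + t ^ 2))⁻¹) • facePoint i (a, t) := by
      ext1 t
      rw [coe_faceMap]
    rw [e]
    refine h3.congr_deriv ?_
    rw [coe_faceMap]
    have hne := cyc_ne i
    have i1 : i + 1 + 1 = i + 2 := by fin_cases i <;> rfl
    have i2 : i + 1 + 2 = i := by fin_cases i <;> rfl
    obtain ⟨k0, k1, k2⟩ := facePoint_apply i (a, c)
    have hρ : 0 < Real.sqrt (1 + a ^ 2 + c ^ 2) := by positivity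
    have hρ2 : 0 < 1 + a ^ 2 + c ^ 2 := by positivity
    apply ext_cyclic i <;>
      (simp [crossVec, hne, k0, k1, k2, i1, i2]; try field_simp; try ring)
  have h4 := ((h.diffAt (faceMap i s (a, c))).hasFDerivAt).comp_hasDerivAt c hD
  refine h4.congr_deriv ?_
  simp only [map_smul, map_sub, smul_eq_mul, angDeriv]
  rw [div_eq_inv_mul]

lemma abs_two_le_angSize (φ : E3 → ℝ) (x : E3) {a b : Fin 3} (hab : a ≠ b) :
    |φ x| + (|angDeriv a φ x| + |angDeriv b φ x|) ≤ angSize φ x := by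
  unfold angSize
  refine add_le_add le_rfl ?_
  rw [← Finset.sum_pair hab (f := fun a => |angDeriv a φ x|)]
  exact Finset.sum_le_sum_of_subset_of_nonneg (Finset.subset_univ _) fun _ _ _ => abs_nonneg _

/-- The one-dimensional estimate along the first coordinate of a face, keeping only the two angular
derivatives that occur. -/
lemma ofReal_le_lintegral_fst {φ : E3 → ℝ} (h : ContDiff ℝ ∞ φ) (i : Fin 3) (s : Bool) {a c : ℝ}
    (ha : a ∈ Set.Icc (-1 : ℝ) 1) (hc : c ∈ Set.Icc (-1 : ℝ) 1) :
    ENNReal.ofReal |φ (faceMap i s (a, c))| ≤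
      ∫⁻ t in Set.Icc (-1 : ℝ) 1, ENNReal.ofReal (angSize φ (faceMap i s (t, c))) := by
  have hcont (b : Fin 3) : Continuous fun t => angDeriv b φ (faceMap i s (t, c)) :=
    (h.angDeriv b).continuous.comp (continuous_subtype_val.comp
      ((continuous_faceMap i s).comp (by fun_prop)))
  refine (ofReal_abs_le_lintegral (fun t => faceMap_deriv_fst h i s t c) ?_ ha).trans ?_
  · exact (((hcont _).sub (continuous_const.mul (hcont _))).div (by fun_prop)
      fun t => by positivity)
  · refine lintegral_mono fun t => ENNReal.ofReal_le_ofReal ?_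
    refine le_trans (add_le_add le_rfl ?_) (abs_two_le_angSize φ _ (cyc_ne i).2.1)
    rw [abs_div, abs_of_pos (by positivity : 0 < 1 + t ^ 2 + c ^ 2)]
    refine (div_le_self (abs_nonneg _) (by nlinarith [sq_nonneg t, sq_nonneg c])).trans ?_
    refine (abs_sub _ _).trans (add_le_add le_rfl ?_)
    rw [abs_mul]
    exact mul_le_of_le_one_left (abs_nonneg _) (abs_le.2 hc)

lemma ofReal_le_lintegral_snd {φ : E3 → ℝ} (h : ContDiff ℝ ∞ φ) (i : Fin 3) (s : Bool) {a c : ℝ}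
    (ha : a ∈ Set.Icc (-1 : ℝ) 1) (hc : c ∈ Set.Icc (-1 : ℝ) 1) :
    ENNReal.ofReal |φ (faceMap i s (a, c))| ≤
      ∫⁻ t in Set.Icc (-1 : ℝ) 1, ENNReal.ofReal (angSize φ (faceMap i s (a, t))) := by
  have hcont (b : Fin 3) : Continuous fun t => angDeriv b φ (faceMap i s (a, t)) :=
    (h.angDeriv b).continuous.comp (continuous_subtype_val.comp
      ((continuous_faceMap i s).comp (by fun_prop)))
  refine (ofReal_abs_le_lintegral (fun t => faceMap_deriv_snd h i s a t) ?_ hc).trans ?_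
  · exact (((continuous_const.mul (hcont _)).sub (hcont _)).div (by fun_prop)
      fun t => by positivity)
  · refine lintegral_mono fun t => ENNReal.ofReal_le_ofReal ?_
    refine le_trans (add_le_add le_rfl ?_) (abs_two_le_angSize φ _ (cyc_ne i).2.2.2.1)
    rw [abs_div, abs_of_pos (by positivity : 0 < 1 + a ^ 2 + t ^ 2)]
    refine (div_le_self (abs_nonneg _) (by nlinarith [sq_nonneg a, sq_nonneg t])).trans ?_
    refine (abs_sub _ _).trans (add_le_add ?_ le_rfl)
    rw [abs_mul]
    exact mul_le_of_le_one_left (abs_nonneg _) (abs_le.2 ha)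

lemma lintegral_faceMeasure {F : S2 → ENNReal} (hF : Measurable F) (i : Fin 3) (s : Bool) :
    ∫⁻ x, F x ∂(faceMeasure i s) = ∫⁻ a in Set.Icc (-1 : ℝ) 1, ∫⁻ c in Set.Icc (-1 : ℝ) 1,
      F (faceMap i s (a, c)) := by
  have hm := (continuous_faceMap i s).measurable
  rw [faceMeasure, lintegral_map hF hm, square, Measure.volume_eq_prod, ← Measure.prod_restrict,
    lintegral_prod (fun p => F (faceMap i s p)) (hF.comp hm).aemeasurable]

/-- The endpoint Sobolev inequality `W^{1,1}(S²) ⊂ L²(S²)` for smooth functions. -/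
lemma integral_sq_le_sq_integral {φ : E3 → ℝ} (h : ContDiff ℝ ∞ φ) :
    ∫ x : S2, φ x ^ 2 ∂area ≤ 384 * (∫ x : S2, angSize φ x ∂area) ^ 2 := by
  have hcG : Continuous fun x : S2 => angSize φ x :=
    (continuous_angSize h).comp continuous_subtype_val
  have hG : Integrable (fun x : S2 => angSize φ x) area := by
    refine (h.integrable_sphere.abs).add (integrable_finsetSum _ fun a _ => ?_)
    exact (h.angDeriv a).integrable_sphere.abs
  set I : ENNReal := ∫⁻ x : S2, ENNReal.ofReal (angSize φ x) ∂area with hI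
  have hmG : Measurable fun x : S2 => ENNReal.ofReal (angSize φ x) :=
    hcG.measurable.ennreal_ofReal
  have hm2 : Measurable fun x : S2 => ENNReal.ofReal (φ x ^ 2) :=
    ((h.continuous_sphere.pow 2).measurable).ennreal_ofReal
  have hface (i : Fin 3) (s : Bool) :
      ∫⁻ x, ENNReal.ofReal (φ x ^ 2) ∂(faceMeasure i s) ≤ (8 * I) ^ 2 := by
    set A : ℝ → ENNReal := fun c =>
      ∫⁻ t in Set.Icc (-1 : ℝ) 1, ENNReal.ofReal (angSize φ (faceMap i s (t, c))) with hA
    set B : ℝ → ENNReal := fun a =>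
      ∫⁻ t in Set.Icc (-1 : ℝ) 1, ENNReal.ofReal (angSize φ (faceMap i s (a, t))) with hB
    have hjm : Measurable fun p : ℝ × ℝ => ENNReal.ofReal (angSize φ (faceMap i s p)) :=
      hmG.comp (continuous_faceMap i s).measurable
    have hAm : Measurable A := hjm.lintegral_prod_left'
    have hBm : Measurable B := hjm.lintegral_prod_right'
    have hBI : ∫⁻ a in Set.Icc (-1 : ℝ) 1, B a = ∫⁻ x : S2, ENNReal.ofReal (angSize φ x)
        ∂(faceMeasure i s) := (lintegral_faceMeasure hmG i s).symm
    have hAI : ∫⁻ c in Set.Icc (-1 : ℝ) 1, A c = ∫⁻ x : S2, ENNReal.ofReal (angSize φ x)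
        ∂(faceMeasure i s) := by
      rw [lintegral_faceMeasure hmG, hA, lintegral_lintegral_swap]
      exact (hjm.comp measurable_swap).aemeasurable
    have hle : ∫⁻ x : S2, ENNReal.ofReal (angSize φ x) ∂(faceMeasure i s) ≤ 8 * I := by
      refine (lintegral_mono' (faceMeasure_le i s) le_rfl).trans_eq ?_
      rw [lintegral_smul_measure, smul_eq_mul]
    rw [lintegral_faceMeasure hm2]
    -- the Gagliardo–Nirenberg argument: one factor of `φ²` is bounded by an integral along the first
    -- coordinate, the other by one along the second, and the product integrates separately
    calc ∫⁻ a in Set.Icc (-1 : ℝ) 1, ∫⁻ c in Set.Icc (-1 : ℝ) 1,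
          ENNReal.ofReal (φ (faceMap i s (a, c)) ^ 2)
        ≤ ∫⁻ a in Set.Icc (-1 : ℝ) 1, ∫⁻ c in Set.Icc (-1 : ℝ) 1, B a * A c := by
          refine setLIntegral_mono' measurableSet_Icc fun a ha =>
            setLIntegral_mono' measurableSet_Icc fun c hc => ?_
          rw [← sq_abs, pow_two, ENNReal.ofReal_mul (abs_nonneg _)]
          exact mul_le_mul' (ofReal_le_lintegral_snd h i s ha hc)
            (ofReal_le_lintegral_fst h i s ha hc)
      _ = (∫⁻ a in Set.Icc (-1 : ℝ) 1, B a) * ∫⁻ c in Set.Icc (-1 : ℝ) 1, A c := by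
          simp only [lintegral_const_mul _ hAm]
          rw [lintegral_mul_const _ hBm]
      _ ≤ _ := by
          rw [hAI, hBI, pow_two]
          exact mul_le_mul' hle hle
  have htot : ∫⁻ x : S2, ENNReal.ofReal (φ x ^ 2) ∂area ≤ 384 * I ^ 2 := by
    calc _ ≤ ∫⁻ x : S2, ENNReal.ofReal (φ x ^ 2) ∂(∑ i, ∑ s, faceMeasure i s) :=
          lintegral_mono' area_le_sum_faceMeasure le_rfl
      _ = ∑ i, ∑ s, ∫⁻ x, ENNReal.ofReal (φ x ^ 2) ∂(faceMeasure i s) := by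
          simp only [lintegral_finsetSum_measure]
      _ ≤ ∑ _i : Fin 3, ∑ _s : Bool, (8 * I) ^ 2 :=
          Finset.sum_le_sum fun i _ => Finset.sum_le_sum fun s _ => hface i s
      _ = 384 * I ^ 2 := by
          simp
          ring
  have hII : I = ENNReal.ofReal (∫ x : S2, angSize φ x ∂area) :=
    (ofReal_integral_eq_lintegral_ofReal hG
      (Filter.Eventually.of_forall fun x => angSize_nonneg φ x)).symm
  have h0 : 0 ≤ ∫ x : S2, angSize φ x ∂area := integral_nonneg fun x => angSize_nonneg φ x
  rw [← ofReal_integral_eq_lintegral_ofReal (h.memLp_sphere 2).integrable_sq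
    (Filter.Eventually.of_forall fun x => sq_nonneg _), hII, ← ENNReal.ofReal_pow h0] at htot
  have e384 : (384 : ENNReal) = ENNReal.ofReal 384 := by simp
  rw [e384, ← ENNReal.ofReal_mul (by norm_num)] at htot
  exact (ENNReal.ofReal_le_ofReal_iff (by positivity)).1 htot

/-- The endpoint Sobolev inequality `W^{2,1}(S²) ⊂ L^∞(S²)` for smooth functions. -/
lemma abs_le_integral_angSize {φ : E3 → ℝ} (h : ContDiff ℝ ∞ φ) (x : S2) :
    |φ x| ≤ 8 * ∫ y : S2, (angSize φ y + ∑ b, angSize (angDeriv b φ) y) ∂area := by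
  have hci {ψ : E3 → ℝ} (hψ : ContDiff ℝ ∞ ψ) : Continuous fun x : S2 => angSize ψ x :=
    (continuous_angSize hψ).comp continuous_subtype_val
  set G : S2 → ℝ := fun y => angSize φ y + ∑ b, angSize (angDeriv b φ) y with hG
  have hGc : Continuous G :=
    (hci h).add (continuous_finsetSum _ fun b _ => hci (h.angDeriv b))
  have hG0 (y : S2) : 0 ≤ G y :=
    add_nonneg (angSize_nonneg _ _) (Finset.sum_nonneg fun _ _ => angSize_nonneg _ _)
  have hGi : Integrable G area := by
    have := hGc.continuousOn.integrableOn_compact isCompact_univ (μ := area)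
    rwa [integrableOn_univ] at this
  -- the one-dimensional estimate is used along the first coordinate of the face that contains the
  -- projection of `x`, and then along the second
  obtain ⟨i, s, y, ⟨hy0, hy1, hy2⟩, hyx⟩ := exists_faceCone x
  set a := (y : E3) 1 / (y : E3) 0
  set c := (y : E3) 2 / (y : E3) 0
  have hx : x = faceMap i s (a, c) := by
    rw [← sphereMap_faceMap, ← hyx]
    congr 1
    ext1; rw [faceMap_ratio hy0]; simp
  have key : ENNReal.ofReal |φ x| ≤ 8 * ∫⁻ y, ENNReal.ofReal (G y) ∂area := by
    calc ENNReal.ofReal |φ x|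
        ≤ ∫⁻ t in Set.Icc (-1 : ℝ) 1, ENNReal.ofReal (angSize φ (faceMap i s (t, c))) := by
          rw [hx]; exact ofReal_le_lintegral_fst h i s hy1 hy2
      _ ≤ ∫⁻ t in Set.Icc (-1 : ℝ) 1, ∫⁻ r in Set.Icc (-1 : ℝ) 1,
            ENNReal.ofReal (G (faceMap i s (t, r))) := by
          refine setLIntegral_mono' measurableSet_Icc fun t ht => ?_
          have hm {ψ : E3 → ℝ} (hψ : ContDiff ℝ ∞ ψ) :
              Measurable fun r => ENNReal.ofReal (angSize ψ (faceMap i s (t, r))) :=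
            ((hci hψ).comp ((continuous_faceMap i s).comp (by fun_prop))).measurable.ennreal_ofReal
          have e : (fun r => ENNReal.ofReal (G (faceMap i s (t, r)))) = fun r =>
              ENNReal.ofReal (angSize φ (faceMap i s (t, r))) +
              ∑ b, ENNReal.ofReal (angSize (angDeriv b φ) (faceMap i s (t, r))) := by
            ext r
            rw [hG, ENNReal.ofReal_add (angSize_nonneg _ _)
              (Finset.sum_nonneg fun _ _ => angSize_nonneg _ _),
              ENNReal.ofReal_sum_of_nonneg fun _ _ => angSize_nonneg _ _]
          rw [e, lintegral_add_left (hm h), lintegral_finsetSum _ fun b _ => hm (h.angDeriv b),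
            angSize, ENNReal.ofReal_add (abs_nonneg _) (Finset.sum_nonneg fun _ _ => abs_nonneg _),
            ENNReal.ofReal_sum_of_nonneg fun _ _ => abs_nonneg _]
          exact add_le_add (ofReal_le_lintegral_snd h i s ht hy2)
            (Finset.sum_le_sum fun b _ => ofReal_le_lintegral_snd (h.angDeriv b) i s ht hy2)
      _ = ∫⁻ y, ENNReal.ofReal (G y) ∂(faceMeasure i s) :=
          (lintegral_faceMeasure hGc.measurable.ennreal_ofReal i s).symm
      _ ≤ _ := by
          refine (lintegral_mono' (faceMeasure_le i s) le_rfl).trans_eq ?_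
          rw [lintegral_smul_measure, smul_eq_mul]
  rw [← ofReal_integral_eq_lintegral_ofReal hGi (Filter.Eventually.of_forall hG0)] at key
  have e8 : (8 : ENNReal) = ENNReal.ofReal 8 := by simp
  rw [e8, ← ENNReal.ofReal_mul (by norm_num)] at key
  exact (ENNReal.ofReal_le_ofReal_iff (mul_nonneg (by norm_num) (integral_nonneg hG0))).1 key

/-! ### Convergence in `L²` and weak derivatives -/

/-- The fundamental lemma of the calculus of variations on the sphere, deduced from the one on `ℝ³`
for the area measure pushed forward along the inclusion. -/
lemma ae_eq_zero_of_integral_smooth {f : S2 → ℝ} (hf : Integrable f area)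
    (h : ∀ φ : E3 → ℝ, ContDiff ℝ ∞ φ → ∫ x, f x * φ x ∂area = 0) : f =ᵐ[area] 0 := by
  have hme : MeasurableEmbedding (Subtype.val : S2 → E3) :=
    MeasurableEmbedding.subtype_coe Metric.isClosed_sphere.measurableSet
  set f' : E3 → ℝ := Function.extend Subtype.val f 0 with hf'
  have hext (x : S2) : f' x = f x := Subtype.val_injective.extend_apply _ _ _
  have hint : Integrable f' (area.map Subtype.val) := by
    rw [hme.integrable_map_iff]
    exact hf.congr (Filter.Eventually.of_forall fun x => (hext x).symm)
  have h1 := ae_eq_zero_of_integral_contDiff_smul_eq_zero hint.locallyIntegrable fun g hg _ => by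
    rw [hme.integral_map]
    simpa [hext, mul_comm] using h g hg
  filter_upwards [hme.ae_map_iff.1 h1] with x hx
  rw [← hext x, hx]; rfl

lemma integrable_mul_of_memLp {f g : S2 → ℝ} (hf : MemLp f 2 area) (hg : MemLp g 2 area) :
    Integrable (fun x => f x * g x) area := hf.integrable_mul hg

lemma memLp_sub {p : ENNReal} {f g : S2 → ℝ} (hf : MemLp f p area) (hg : MemLp g p area) :
    MemLp (fun x => f x - g x) p area := hf.sub hg

/-- Convergence in `L²(S²)`. -/
structure TendstoL2 (f : ℕ → S2 → ℝ) (g : S2 → ℝ) : Prop where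
  memLp_seq : ∀ n, MemLp (f n) 2 area
  memLp : MemLp g 2 area
  tendsto : Filter.Tendsto (fun n => l2 (fun x => f n x - g x)) Filter.atTop (nhds 0)

lemma TendstoL2.integral_mul {f f' : ℕ → S2 → ℝ} {g g' : S2 → ℝ} (h : TendstoL2 f g)
    (h' : TendstoL2 f' g') :
    Filter.Tendsto (fun n => ∫ x, f n x * f' n x ∂area) Filter.atTop
      (nhds (∫ x, g x * g' x ∂area)) := by
  rw [tendsto_iff_dist_tendsto_zero]
  have hb : ∀ n, dist (∫ x, f n x * f' n x ∂area) (∫ x, g x * g' x ∂area) ≤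
      l2 (fun x => f n x - g x) * l2 (fun x => f' n x - g' x) +
      l2 (fun x => f n x - g x) * l2 g' + l2 g * l2 (fun x => f' n x - g' x) := by
    intro n
    have m1 := memLp_sub (h.memLp_seq n) h.memLp
    have m2 := memLp_sub (h'.memLp_seq n) h'.memLp
    have i1 := integrable_mul_of_memLp m1 m2
    have i2 := integrable_mul_of_memLp m1 h'.memLp
    have i3 := integrable_mul_of_memLp h.memLp m2
    have e : (∫ x, f n x * f' n x ∂area) - ∫ x, g x * g' x ∂area =
        (∫ x, (f n x - g x) * (f' n x - g' x) ∂area) + (∫ x, (f n x - g x) * g' x ∂area) +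
          ∫ x, g x * (f' n x - g' x) ∂area := by
      rw [← integral_sub (integrable_mul_of_memLp (h.memLp_seq n) (h'.memLp_seq n))
        (integrable_mul_of_memLp h.memLp h'.memLp), ← integral_add i1 i2]
      have i12 := i1.add i2
      refine Eq.trans ?_ (integral_add i12 i3)
      refine integral_congr_ae (Filter.Eventually.of_forall fun x => ?_)
      simp only
      ring
    rw [Real.dist_eq, e]
    refine (abs_add_three _ _ _).trans ?_
    exact add_le_add (add_le_add (abs_integral_mul_le m1 m2) (abs_integral_mul_le m1 h'.memLp))
      (abs_integral_mul_le h.memLp m2)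
  refine squeeze_zero (fun n => dist_nonneg) hb ?_
  simpa using ((h.tendsto.mul h'.tendsto).add (h.tendsto.mul_const (l2 g'))).add
    (h'.tendsto.const_mul (l2 g))

lemma TendstoL2.const {f : S2 → ℝ} (hf : MemLp f 2 area) : TendstoL2 (fun _ => f) f :=
  ⟨fun _ => hf, hf, by simp⟩

lemma TendstoL2.integral_mul_right {f : ℕ → S2 → ℝ} {g : S2 → ℝ} (h : TendstoL2 f g)
    {ψ : S2 → ℝ} (hψ : MemLp ψ 2 area) :
    Filter.Tendsto (fun n => ∫ x, f n x * ψ x ∂area) Filter.atTop (nhds (∫ x, g x * ψ x ∂area)) :=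
  h.integral_mul (TendstoL2.const hψ)

lemma TendstoL2.of_le {f f' : ℕ → S2 → ℝ} {g g' : S2 → ℝ} (h : TendstoL2 f g)
    (hm : ∀ n, MemLp (f' n) 2 area) (hm' : MemLp g' 2 area) {C : ℝ}
    (hle : ∀ n x, |f' n x - g' x| ≤ C * |f n x - g x|) : TendstoL2 f' g' := by
  refine ⟨hm, hm', ?_⟩
  have hb (n : ℕ) : l2 (fun x => f' n x - g' x) ≤ |C| * l2 (fun x => f n x - g x) := by
    have m1 := memLp_sub (h.memLp_seq n) h.memLp
    have m2 := memLp_sub (hm n) hm'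
    refine l2_le_of_sq_le m2 (mul_nonneg (abs_nonneg _) lpNorm_nonneg) ?_
    rw [mul_pow, l2_sq m1, ← integral_const_mul]
    refine integral_mono m2.integrable_sq (m1.integrable_sq.const_mul _) fun x => ?_
    rw [← mul_pow]
    refine sq_le_sq.2 ((hle n x).trans ?_)
    rw [abs_mul, abs_abs]
    exact mul_le_mul_of_nonneg_right (le_abs_self C) (abs_nonneg _)
  refine squeeze_zero (fun n => lpNorm_nonneg) hb ?_
  simpa using h.tendsto.const_mul |C|

lemma TendstoL2.mul_smooth {f : ℕ → S2 → ℝ} {g : S2 → ℝ} (h : TendstoL2 f g) {ψ : E3 → ℝ}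
    (hψ : ContDiff ℝ ∞ ψ) : TendstoL2 (fun n x => f n x * ψ x) (fun x => g x * ψ x) := by
  obtain ⟨C, hC0, hC⟩ := exists_bound_sphere hψ
  have hb {k : S2 → ℝ} (hk : MemLp k 2 area) : MemLp (fun x => k x * ψ x) 2 area := by
    have := (hψ.memLp_sphere ⊤).mul (r := 2) hk
    exact this
  refine h.of_le (fun n => hb (h.memLp_seq n)) (hb h.memLp) (C := C) fun n x => ?_
  rw [← sub_mul, abs_mul, mul_comm]
  exact mul_le_mul_of_nonneg_right (hC x) (abs_nonneg _)

lemma TendstoL2.add {f f' : ℕ → S2 → ℝ} {g g' : S2 → ℝ} (h : TendstoL2 f g)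
    (h' : TendstoL2 f' g') : TendstoL2 (fun n x => f n x + f' n x) (fun x => g x + g' x) := by
  refine ⟨fun n => (h.memLp_seq n).add (h'.memLp_seq n), h.memLp.add h'.memLp, ?_⟩
  refine squeeze_zero (fun n => lpNorm_nonneg) (fun n => ?_)
    (by simpa using h.tendsto.add h'.tendsto)
  have := lpNorm_add_le ((h.memLp_seq n).sub h.memLp) (g := fun x => f' n x - g' x) (p := 2)
    (by norm_num)
  refine le_trans (le_of_eq ?_) this
  congr 1
  ext x
  simp only [Pi.add_apply, Pi.sub_apply]
  ring

lemma TendstoL2.const_mul {f : ℕ → S2 → ℝ} {g : S2 → ℝ} (h : TendstoL2 f g) (c : ℝ) :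
    TendstoL2 (fun n x => c * f n x) (fun x => c * g x) :=
  h.of_le (fun n => (h.memLp_seq n).const_mul c) (h.memLp.const_mul c) (C := |c|) fun n x => by
    rw [← mul_sub, abs_mul]

lemma TendstoL2.sum {ι : Type*} (s : Finset ι) {f : ι → ℕ → S2 → ℝ} {g : ι → S2 → ℝ}
    (h : ∀ i, TendstoL2 (f i) (g i)) :
    TendstoL2 (fun n x => ∑ i ∈ s, f i n x) (fun x => ∑ i ∈ s, g i x) := by
  classical
  induction s using Finset.induction_on with
  | empty => simpa using TendstoL2.const (memLp_const (0 : ℝ))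
  | insert i s hi ih => simpa [Finset.sum_insert hi] using (h i).add ih

lemma TendstoL2.comp_sphereMap {f : ℕ → S2 → ℝ} {g : S2 → ℝ} (h : TendstoL2 f g)
    (A : E3 ≃ₗᵢ[ℝ] E3) : TendstoL2 (fun n x => f n (sphereMap A x)) (fun x => g (sphereMap A x)) := by
  have hA := measurePreserving_sphereMap A
  refine ⟨fun n => (h.memLp_seq n).comp_measurePreserving hA, h.memLp.comp_measurePreserving hA, ?_⟩
  refine h.tendsto.congr fun n => ?_
  have m := (h.memLp_seq n).sub h.memLp
  have m' := m.comp_measurePreserving hA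
  rw [← sq_eq_sq₀ lpNorm_nonneg lpNorm_nonneg]
  have h1 := l2_sq m
  have h2 := l2_sq m'
  have h3 := integral_sphereMap A fun x => (f n x - g x) ^ 2
  exact h1.trans (h3.symm.trans h2.symm)

lemma tendstoL2_mollify {f : S2 → ℝ} (hf : MemLp f 2 area) :
    TendstoL2 (fun n x => mollify n f x) f :=
  ⟨fun n => (contDiff_mollify n (hf.integrable (by norm_num))).memLp_sphere 2, hf,
    tendsto_mollify hf⟩

lemma TendstoL2.comp {f : ℕ → S2 → ℝ} {g : S2 → ℝ} (h : TendstoL2 f g) {u : ℕ → ℕ}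
    (hu : Filter.Tendsto u Filter.atTop Filter.atTop) : TendstoL2 (fun n => f (u n)) g :=
  ⟨fun n => h.memLp_seq (u n), h.memLp, h.tendsto.comp hu⟩

lemma TendstoL2.integral_sq {f : ℕ → S2 → ℝ} {g : S2 → ℝ} (h : TendstoL2 f g) :
    Filter.Tendsto (fun n => ∫ x, f n x ^ 2 ∂area) Filter.atTop (nhds (∫ x, g x ^ 2 ∂area)) := by
  simpa only [pow_two] using h.integral_mul h

lemma TendstoL2.l2 {f : ℕ → S2 → ℝ} {g : S2 → ℝ} (h : TendstoL2 f g) :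
    Filter.Tendsto (fun n => l2 (f n)) Filter.atTop (nhds (l2 g)) := by
  have h1 := (Real.continuous_sqrt.tendsto _).comp h.integral_sq
  have e (k : S2 → ℝ) (hk : MemLp k 2 area) : Real.sqrt (∫ x, k x ^ 2 ∂area) = EpsHarmonic.l2 k := by
    rw [← l2_sq hk, Real.sqrt_sq lpNorm_nonneg]
  rw [e g h.memLp] at h1
  exact h1.congr fun n => e _ (h.memLp_seq n)

/-- Weak angular derivatives pass to weak limits. -/
lemma HasAngDeriv.of_tendsto {a : Fin 3} {f g : ℕ → S2 → ℝ} {f' g' : S2 → ℝ}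
    (h : ∀ n, HasAngDeriv a (f n) (g n)) (hf : Integrable f' area) (hg : Integrable g' area)
    (hft : ∀ φ : E3 → ℝ, ContDiff ℝ ∞ φ → Filter.Tendsto (fun n => ∫ x, f n x * φ x ∂area)
      Filter.atTop (nhds (∫ x, f' x * φ x ∂area)))
    (hgt : ∀ φ : E3 → ℝ, ContDiff ℝ ∞ φ → Filter.Tendsto (fun n => ∫ x, g n x * φ x ∂area)
      Filter.atTop (nhds (∫ x, g' x * φ x ∂area))) : HasAngDeriv a f' g' := by
  refine ⟨hf, hg, fun φ hφ => ?_⟩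
  refine tendsto_nhds_unique (hgt φ hφ) ?_
  refine (hft _ (hφ.angDeriv a)).neg.congr fun n => ?_
  exact ((h n).2.2 φ hφ).symm

lemma HasAngDeriv.of_tendstoL2 {a : Fin 3} {f g : ℕ → S2 → ℝ} {f' g' : S2 → ℝ}
    (h : ∀ n, HasAngDeriv a (f n) (g n)) (hf : TendstoL2 f f') (hg : TendstoL2 g g') :
    HasAngDeriv a f' g' :=
  HasAngDeriv.of_tendsto h (hf.memLp.integrable (by norm_num)) (hg.memLp.integrable (by norm_num))
    (fun _ hφ => hf.integral_mul_right (hφ.memLp_sphere 2))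
    (fun _ hφ => hg.integral_mul_right (hφ.memLp_sphere 2))

lemma HasAngDeriv.congr {a : Fin 3} {f g f' g' : S2 → ℝ} (h : HasAngDeriv a f g)
    (hf : f =ᵐ[area] f') (hg : g =ᵐ[area] g') : HasAngDeriv a f' g' := by
  refine ⟨h.1.congr hf, h.2.1.congr hg, fun φ hφ => ?_⟩
  have h1 : ∫ x, g' x * φ x ∂area = ∫ x, g x * φ x ∂area := by
    refine integral_congr_ae ?_
    filter_upwards [hg] with x hx; rw [hx]
  have h2 : ∫ x, f' x * angDeriv a φ x ∂area = ∫ x, f x * angDeriv a φ x ∂area := by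
    refine integral_congr_ae ?_
    filter_upwards [hf] with x hx; rw [hx]
  rw [h1, h2, h.2.2 φ hφ]

lemma HasAngDeriv.add {a : Fin 3} {f g f' g' : S2 → ℝ} (h : HasAngDeriv a f g)
    (h' : HasAngDeriv a f' g') : HasAngDeriv a (fun x => f x + f' x) (fun x => g x + g' x) := by
  refine ⟨h.1.add h'.1, h.2.1.add h'.2.1, fun φ hφ => ?_⟩
  simp only [add_mul]
  rw [integral_add (integrable_mul_smooth h.2.1 hφ) (integrable_mul_smooth h'.2.1 hφ),
    integral_add (integrable_mul_smooth h.1 (hφ.angDeriv a))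
      (integrable_mul_smooth h'.1 (hφ.angDeriv a)), h.2.2 φ hφ, h'.2.2 φ hφ]
  ring

lemma HasAngDeriv.const_mul {a : Fin 3} {f g : S2 → ℝ} (h : HasAngDeriv a f g) (c : ℝ) :
    HasAngDeriv a (fun x => c * f x) (fun x => c * g x) := by
  refine ⟨h.1.const_mul c, h.2.1.const_mul c, fun φ hφ => ?_⟩
  simp only [mul_assoc, integral_const_mul]
  rw [h.2.2 φ hφ]
  ring

lemma HasAngDeriv.unique {a : Fin 3} {f g g' : S2 → ℝ} (h : HasAngDeriv a f g)
    (h' : HasAngDeriv a f g') : g =ᵐ[area] g' := by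
  have : (fun x => g x - g' x) =ᵐ[area] 0 := by
    refine ae_eq_zero_of_integral_smooth (h.2.1.sub h'.2.1) fun φ hφ => ?_
    simp only [sub_mul]
    rw [integral_sub (integrable_mul_smooth h.2.1 hφ) (integrable_mul_smooth h'.2.1 hφ),
      h.2.2 φ hφ, h'.2.2 φ hφ, sub_self]
  filter_upwards [this] with x hx
  exact sub_eq_zero.1 hx

/-- `f ∈ W^{1,2}(S²)` with weak angular derivatives `F a`. -/
structure HasW1 (f : S2 → ℝ) (F : Fin 3 → S2 → ℝ) : Prop where
  memLp : MemLp f 2 area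
  memLp_deriv : ∀ a, MemLp (F a) 2 area
  deriv : ∀ a, HasAngDeriv a f (F a)

/-- `f ∈ W^{2,2}(S²)` with weak angular derivatives `F a` and second derivatives
`H a b = L_b L_a f`. -/
structure HasW2 (f : S2 → ℝ) (F : Fin 3 → S2 → ℝ) (H : Fin 3 → Fin 3 → S2 → ℝ) : Prop where
  fst : HasW1 f F
  snd : ∀ a, HasW1 (F a) (H a)

lemma HasW1.integrable {f : S2 → ℝ} {F : Fin 3 → S2 → ℝ} (h : HasW1 f F) : Integrable f area :=
  h.memLp.integrable (by norm_num)

lemma _root_.ContDiff.hasW1 {φ : E3 → ℝ} (h : ContDiff ℝ ∞ φ) :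
    HasW1 (fun x => φ x) (fun a x => angDeriv a φ x) :=
  ⟨h.memLp_sphere 2, fun a => (h.angDeriv a).memLp_sphere 2, fun a => h.hasAngDeriv a⟩

lemma HasW1.add {f f' : S2 → ℝ} {F F' : Fin 3 → S2 → ℝ} (h : HasW1 f F) (h' : HasW1 f' F') :
    HasW1 (fun x => f x + f' x) (fun a x => F a x + F' a x) :=
  ⟨h.memLp.add h'.memLp, fun a => (h.memLp_deriv a).add (h'.memLp_deriv a),
    fun a => (h.deriv a).add (h'.deriv a)⟩

lemma HasW1.const_mul {f : S2 → ℝ} {F : Fin 3 → S2 → ℝ} (h : HasW1 f F) (c : ℝ) :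
    HasW1 (fun x => c * f x) (fun a x => c * F a x) :=
  ⟨h.memLp.const_mul c, fun a => (h.memLp_deriv a).const_mul c, fun a => (h.deriv a).const_mul c⟩

lemma HasW2.add {f f' : S2 → ℝ} {F F' : Fin 3 → S2 → ℝ} {H H' : Fin 3 → Fin 3 → S2 → ℝ}
    (h : HasW2 f F H) (h' : HasW2 f' F' H') :
    HasW2 (fun x => f x + f' x) (fun a x => F a x + F' a x) (fun a b x => H a b x + H' a b x) :=
  ⟨h.fst.add h'.fst, fun a => (h.snd a).add (h'.snd a)⟩

lemma HasW2.const_mul {f : S2 → ℝ} {F : Fin 3 → S2 → ℝ} {H : Fin 3 → Fin 3 → S2 → ℝ}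
    (h : HasW2 f F H) (c : ℝ) :
    HasW2 (fun x => c * f x) (fun a x => c * F a x) (fun a b x => c * H a b x) :=
  ⟨h.fst.const_mul c, fun a => (h.snd a).const_mul c⟩

lemma HasW1.mollified {f : S2 → ℝ} {F : Fin 3 → S2 → ℝ} (h : HasW1 f F) (n : ℕ) :
    HasW1 (fun x => mollify n f x) (fun a x => mollify n (F a) x) := by
  have h1 := ContDiff.hasW1 (contDiff_mollify n h.integrable)
  simp only [angDeriv_mollify n (h.deriv _)] at h1
  exact h1

/-- The product rule for two functions of class `W^{1,2}`; the product and its derivatives are in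
general only integrable. -/
lemma HasW1.hasAngDeriv_mul {f g : S2 → ℝ} {F G : Fin 3 → S2 → ℝ} (h : HasW1 f F) (h' : HasW1 g G)
    (a : Fin 3) : HasAngDeriv a (fun x => f x * g x) (fun x => f x * G a x + F a x * g x) := by
  have tf := tendstoL2_mollify h.memLp
  have tg := tendstoL2_mollify h'.memLp
  have tF := tendstoL2_mollify (h.memLp_deriv a)
  have tG := tendstoL2_mollify (h'.memLp_deriv a)
  refine HasAngDeriv.of_tendsto
    (f := fun n x => mollify n f x * mollify n g x)
    (g := fun n x => mollify n f x * mollify n (G a) x +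
      mollify n (F a) x * mollify n g x) (fun n => ?_)
    (h.memLp.integrable_mul h'.memLp) ((h.memLp.integrable_mul (h'.memLp_deriv a)).add
      ((h.memLp_deriv a).integrable_mul h'.memLp)) (fun φ hφ => ?_) fun φ hφ => ?_
  · have c1 := contDiff_mollify n h.integrable
    have c2 := contDiff_mollify n h'.integrable
    have := (c1.mul c2).hasAngDeriv a
    simp only [angDeriv_mul c1 c2, angDeriv_mollify n (h.deriv a),
      angDeriv_mollify n (h'.deriv a)] at this
    exact this
  · simpa only [mul_assoc] using tf.integral_mul (tg.mul_smooth hφ)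
  · have t1 := (tf.integral_mul (tG.mul_smooth hφ)).add (tF.integral_mul (tg.mul_smooth hφ))
    have e {p q r s : S2 → ℝ} (hp : MemLp p 2 area) (hq : MemLp q 2 area) (hr : MemLp r 2 area)
        (hs : MemLp s 2 area) : (∫ x, p x * (q x * φ x) ∂area) + ∫ x, r x * (s x * φ x) ∂area =
        ∫ x, (p x * q x + r x * s x) * φ x ∂area := by
      have i1 := integrable_mul_smooth (hp.integrable_mul hq) hφ
      have i2 := integrable_mul_smooth (hr.integrable_mul hs) hφ
      simp only [Pi.mul_apply] at i1 i2
      simp only [add_mul, ← mul_assoc]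
      rw [integral_add i1 i2]
    rw [e h.memLp (h'.memLp_deriv a) (h.memLp_deriv a) h'.memLp] at t1
    exact t1.congr fun n => e (tf.memLp_seq n) (tG.memLp_seq n) (tF.memLp_seq n) (tg.memLp_seq n)

/-- Integration by parts: the angular derivatives are skew-adjoint on `W^{1,2}(S²)`. -/
lemma HasW1.integral_mul_deriv {f g : S2 → ℝ} {F G : Fin 3 → S2 → ℝ} (h : HasW1 f F)
    (h' : HasW1 g G) (a : Fin 3) : ∫ x, f x * G a x ∂area = -∫ x, F a x * g x ∂area := by
  have := (h.hasAngDeriv_mul h' a).integral_eq_zero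
  rw [integral_add (integrable_mul_of_memLp h.memLp (h'.memLp_deriv a))
    (integrable_mul_of_memLp (h.memLp_deriv a) h'.memLp)] at this
  linarith

/-! ### The normalizing factor -/

/-- The factor `(1 + s)^{-1/2}`. -/
def nrmFactor (s : ℝ) : ℝ := (Real.sqrt (1 + s))⁻¹

lemma nrmFactor_pos {s : ℝ} (hs : 0 ≤ s) : 0 < nrmFactor s :=
  inv_pos.2 (Real.sqrt_pos.2 (by linarith))

lemma nrmFactor_le_one {s : ℝ} (hs : 0 ≤ s) : nrmFactor s ≤ 1 :=
  inv_le_one_of_one_le₀ (Real.one_le_sqrt.2 (by linarith))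

lemma nrmFactor_sq {s : ℝ} (hs : 0 ≤ s) : nrmFactor s ^ 2 * (1 + s) = 1 := by
  unfold nrmFactor
  rw [inv_pow, Real.sq_sqrt (by linarith)]
  field_simp

lemma abs_nrmFactor_sub_le {s t : ℝ} (hs : 0 ≤ s) (ht : 0 ≤ t) :
    |nrmFactor s - nrmFactor t| ≤ |s - t| := by
  set p := nrmFactor s
  set q := nrmFactor t
  have hp : 0 < p := nrmFactor_pos hs
  have hq : 0 < q := nrmFactor_pos ht
  have hp1 : p ≤ 1 := nrmFactor_le_one hs
  have hq1 : q ≤ 1 := nrmFactor_le_one ht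
  have e1 : p ^ 2 * (1 + s) = 1 := nrmFactor_sq hs
  have e2 : q ^ 2 * (1 + t) = 1 := nrmFactor_sq ht
  have e : (p - q) * (p + q) = p ^ 2 * q ^ 2 * (t - s) := by
    linear_combination q ^ 2 * e1 - p ^ 2 * e2
  have e' : |p - q| * (p + q) = p ^ 2 * q ^ 2 * |s - t| := by
    have e3 := congrArg abs e
    rwa [abs_mul, abs_mul, abs_of_pos (add_pos hp hq), abs_of_pos (by positivity : 0 < p ^ 2 * q ^ 2),
      abs_sub_comm t s] at e3
  have h3 : p ^ 2 * q ^ 2 ≤ p + q := by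
    have : p ^ 2 * q ^ 2 ≤ p * 1 := by
      have : p * q ^ 2 ≤ 1 := mul_le_one₀ hp1 (by positivity) (pow_le_one₀ hq.le hq1)
      nlinarith
    linarith
  have h4 := mul_le_mul_of_nonneg_right h3 (abs_nonneg (s - t))
  rw [← e'] at h4
  have : 0 < p + q := by positivity
  nlinarith [abs_nonneg (p - q)]

lemma hasDerivAt_nrmFactor {s : ℝ} (hs : 0 ≤ s) :
    HasDerivAt nrmFactor (-(1 / 2) * nrmFactor s ^ 3) s := by
  have hp : 0 < 1 + s := by linarith
  have h1 : HasDerivAt (fun a : ℝ => 1 + a) 1 s := (hasDerivAt_id s).const_add 1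
  have h2 := (h1.sqrt hp.ne').inv (Real.sqrt_pos.2 hp).ne'
  refine h2.congr_deriv ?_
  unfold nrmFactor
  have := Real.sqrt_pos.2 hp
  field_simp

lemma contDiff_nrmFactor_comp {ψ : E3 → ℝ} (h : ContDiff ℝ ∞ ψ) (h0 : ∀ x, 0 ≤ ψ x) :
    ContDiff ℝ ∞ (fun x => nrmFactor (ψ x)) := by
  unfold nrmFactor
  refine ((contDiff_const.add h).sqrt fun x => ?_).inv fun x => ?_
  · have := h0 x; linarith
  · have := h0 x; exact (Real.sqrt_pos.2 (by linarith)).ne'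

/-- Off the sphere the kernel `(1 + ⟨x, y⟩)ⁿ` may be negative when `n` is odd. With even exponents the
mollification of a nonnegative function is nonnegative on all of `ℝ³`, so that `nrmFactor` of it
is smooth there. -/
lemma mollify_even_nonneg (n : ℕ) {f : S2 → ℝ} (h0 : ∀ x, 0 ≤ f x) (x : E3) :
    0 ≤ mollify (2 * n) f x := by
  unfold mollify zonal
  refine mul_nonneg (inv_nonneg.2 (zonalMass_pos _).le) (integral_nonneg fun y => ?_)
  exact mul_nonneg (by rw [pow_mul]; positivity) (h0 y)

lemma memLp_nrmFactor {f : S2 → ℝ} (hf : AEStronglyMeasurable f area) (h0 : ∀ x, 0 ≤ f x)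
    (p : ENNReal) : MemLp (fun x => nrmFactor (f x)) p area := by
  have hm : Measurable nrmFactor := by unfold nrmFactor; fun_prop
  refine MemLp.of_bound (hm.comp_aemeasurable hf.aemeasurable).aestronglyMeasurable 1
    (Filter.Eventually.of_forall fun x => ?_)
  rw [Real.norm_of_nonneg (nrmFactor_pos (h0 x)).le]
  exact nrmFactor_le_one (h0 x)

/-- The chain rule for `(1 + f)^{-1/2}`. -/
lemma HasW1.nrmFactor_comp {f : S2 → ℝ} {F : Fin 3 → S2 → ℝ} (h : HasW1 f F) (h0 : ∀ x, 0 ≤ f x) :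
    HasW1 (fun x => nrmFactor (f x))
      (fun a x => -(1 / 2) * (nrmFactor (f x) ^ 3 * F a x)) := by
  have heven : Filter.Tendsto (fun n : ℕ => 2 * n) Filter.atTop Filter.atTop :=
    Filter.tendsto_id.const_mul_atTop' two_pos
  set fn : ℕ → E3 → ℝ := fun n => mollify (2 * n) f with hfn
  have hfn0 (n : ℕ) (x : E3) : 0 ≤ fn n x := mollify_even_nonneg n h0 x
  have hc (n : ℕ) : ContDiff ℝ ∞ (fn n) := contDiff_mollify _ h.integrable
  have tf : TendstoL2 (fun n x => fn n x) f := (tendstoL2_mollify h.memLp).comp heven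
  have m1 (n : ℕ) := memLp_nrmFactor (hc n).continuous_sphere.aestronglyMeasurable
    (fun x => hfn0 n x) 2
  have m2 := memLp_nrmFactor h.memLp.1 h0
  have t1 : TendstoL2 (fun n x => nrmFactor (fn n x))
      (fun x => nrmFactor (f x)) :=
    tf.of_le m1 (m2 2) (C := 1) fun n x => by
      rw [one_mul]; exact abs_nrmFactor_sub_le (hfn0 n x) (h0 x)
  have m3 : MemLp (fun x => nrmFactor (f x) ^ 3) ⊤ area := by
    refine MemLp.of_bound ((m2 2).1.pow 3) 1 (Filter.Eventually.of_forall fun x => ?_)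
    have h1 := nrmFactor_pos (h0 x)
    rw [Real.norm_of_nonneg (by positivity)]
    exact pow_le_one₀ h1.le (nrmFactor_le_one (h0 x))
  have m3' (n : ℕ) := (contDiff_nrmFactor_comp (hc n) (hfn0 n)).pow 3
  have t3 : TendstoL2 (fun n x => nrmFactor (fn n x) ^ 3)
      (fun x => nrmFactor (f x) ^ 3) :=
    t1.of_le (fun n => (m3' n).memLp_sphere 2) (m3.mono_exponent le_top) (C := 3) fun n x => by
      have p0 := nrmFactor_pos (hfn0 n x)
      have q0 := nrmFactor_pos (h0 x)
      have p1 := nrmFactor_le_one (hfn0 n x)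
      have q1 := nrmFactor_le_one (h0 x)
      set p := nrmFactor (fn n x)
      set q := nrmFactor (f x)
      have : p ^ 3 - q ^ 3 = (p ^ 2 + p * q + q ^ 2) * (p - q) := by ring
      rw [this, abs_mul, abs_of_nonneg (by positivity)]
      exact mul_le_mul_of_nonneg_right (by nlinarith) (abs_nonneg _)
  have mder (a : Fin 3) : MemLp (fun x => -(1 / 2) * (nrmFactor (f x) ^ 3 * F a x)) 2
      area := (MemLp.mul (r := 2) (h.memLp_deriv a) m3).const_mul _
  refine ⟨m2 2, mder, fun a => ?_⟩
  have tF : TendstoL2 (fun n x => mollify (2 * n) (F a) x) (F a) :=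
    (tendstoL2_mollify (h.memLp_deriv a)).comp heven
  refine HasAngDeriv.of_tendsto (f := fun n x => nrmFactor (fn n x))
    (g := fun n x => -(1 / 2) * (nrmFactor (fn n x) ^ 3 *
      mollify (2 * n) (F a) x)) (fun n => ?_) ((m2 2).integrable (by norm_num))
    ((mder a).integrable (by norm_num)) (fun φ hφ => t1.integral_mul_right (hφ.memLp_sphere 2))
    fun φ hφ => ?_
  · have := (contDiff_nrmFactor_comp (hc n) (hfn0 n)).hasAngDeriv a
    have e (x : E3) : angDeriv a (fun x => nrmFactor (fn n x)) x =
        -(1 / 2) * (nrmFactor (fn n x) ^ 3 * mollify (2 * n) (F a) x) := by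
      have h1 := (hasDerivAt_nrmFactor (hfn0 n x)).comp_hasFDerivAt x ((hc n).diffAt x).hasFDerivAt
      have h2 : angDeriv a (fn n) x = mollify (2 * n) (F a) x :=
        congrFun (angDeriv_mollify _ (h.deriv a)) x
      rw [← h2]
      unfold angDeriv
      have h3 : fderiv ℝ (fun x => nrmFactor (fn n x)) x = _ := h1.fderiv
      rw [h3]
      simp
      ring
    simp only [e] at this
    exact this
  · have := (t3.integral_mul (tF.mul_smooth hφ)).const_mul (-(1 / 2))
    simpa only [← integral_const_mul, mul_assoc] using this

/-! ### Rotations of Sobolev functions -/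

/-- The entry `⟨R e_b, e_c⟩` of the matrix of the rotation `R` by the angle `t` about the
`a`-th axis. -/
def rotEntry (a : Fin 3) (t : ℝ) (b c : Fin 3) : ℝ := rot a t (basisVec b) c

lemma rotEntry_orthogonal (a : Fin 3) (t : ℝ) (c d : Fin 3) :
    ∑ b, rotEntry a t b c * rotEntry a t b d = if c = d then 1 else 0 := by
  have h (b c : Fin 3) : rotEntry a t b c = (rot a t).symm (basisVec c) b := by
    have h1 : rotEntry a t b c = inner ℝ (basisVec c) (rot a t (basisVec b)) := by
      simp [rotEntry, EuclideanSpace.inner_single_left]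
    rw [h1, ← (rot a t).symm.inner_map_map, (rot a t).symm_apply_apply]
    simp [EuclideanSpace.inner_single_right]
  simp only [h]
  rw [← inner_eq_sum, LinearIsometryEquiv.inner_map_map]
  simp [EuclideanSpace.inner_single_left]

/-- A rotation carries the rotation fields to combinations of each other: `R(e_b × x) = Re_b × Rx`. -/
lemma rot_crossVec (a b : Fin 3) (t : ℝ) (x : E3) :
    rot a t (crossVec b x) = ∑ c, rotEntry a t b c • crossVec c (rot a t x) := by
  have e1 : a + 1 + 1 = a + 2 := by fin_cases a <;> rfl
  have e2 : a + 1 + 2 = a := by fin_cases a <;> rfl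
  have e3 : a + 2 + 1 = a := by fin_cases a <;> rfl
  have e4 : a + 2 + 2 = a + 1 := by fin_cases a <;> rfl
  have hne := cyc_ne a
  have key : ∀ b, rot a t (crossVec b x) = ∑ c, rotEntry a t b c • crossVec c (rot a t x) := by
    have ht := Real.sin_sq_add_cos_sq t
    rw [forall_cyclic a]
    refine ⟨?_, ?_, ?_⟩ <;> rw [sum_cyclic _ a] <;> apply ext_cyclic a <;>
      simp [rotEntry, rot_apply_self, rot_apply_one, rot_apply_two, crossVec, e1, e2, e3, e4, hne] <;>
      first
        | ring1
        | linear_combination (x (a + 1)) * ht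
        | linear_combination (- x (a + 1)) * ht
        | linear_combination (x (a + 2)) * ht
        | linear_combination (- x (a + 2)) * ht
  exact key b

lemma contDiff_comp_rot {φ : E3 → ℝ} (h : ContDiff ℝ ∞ φ) (a : Fin 3) (t : ℝ) :
    ContDiff ℝ ∞ (fun x => φ (rot a t x)) :=
  h.comp (rot a t).toContinuousLinearEquiv.contDiff

lemma angDeriv_comp_rot {φ : E3 → ℝ} (h : ContDiff ℝ ∞ φ) (a b : Fin 3) (t : ℝ) (x : E3) :
    angDeriv b (fun y => φ (rot a t y)) x = ∑ c, rotEntry a t b c * angDeriv c φ (rot a t x) := by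
  have h1 : HasFDerivAt (fun y => rot a t y)
      ((rot a t).toContinuousLinearEquiv : E3 →L[ℝ] E3) x :=
    (rot a t).toContinuousLinearEquiv.hasFDerivAt
  have h2 := ((h.diffAt (rot a t x)).hasFDerivAt).comp x h1
  have h3 : fderiv ℝ (fun y => φ (rot a t y)) x = _ := h2.fderiv
  unfold angDeriv
  rw [h3]
  change fderiv ℝ φ (rot a t x) (rot a t (crossVec b x)) = _
  rw [rot_crossVec, map_sum]
  simp

lemma HasW1.comp_rot {f : S2 → ℝ} {F : Fin 3 → S2 → ℝ} (h : HasW1 f F) (a : Fin 3) (t : ℝ) :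
    HasW1 (fun x => f (srot a t x)) (fun b x => ∑ c, rotEntry a t b c * F c (srot a t x)) := by
  have tf := (tendstoL2_mollify h.memLp).comp_sphereMap (rot a t)
  have tF (b : Fin 3) := TendstoL2.sum Finset.univ fun c =>
    ((tendstoL2_mollify (h.memLp_deriv c)).comp_sphereMap (rot a t)).const_mul (rotEntry a t b c)
  refine ⟨tf.memLp, fun b => (tF b).memLp, fun b => ?_⟩
  refine HasAngDeriv.of_tendstoL2 (fun n => ?_) tf (tF b)
  have hc := contDiff_mollify n h.integrable
  have := (contDiff_comp_rot hc a t).hasAngDeriv b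
  simp only [angDeriv_comp_rot hc, angDeriv_mollify n (h.deriv _)] at this
  exact this

lemma HasW1.sum {ι : Type*} (s : Finset ι) {f : ι → S2 → ℝ} {F : ι → Fin 3 → S2 → ℝ}
    (h : ∀ i, HasW1 (f i) (F i)) :
    HasW1 (fun x => ∑ i ∈ s, f i x) (fun a x => ∑ i ∈ s, F i a x) := by
  classical
  induction s using Finset.induction_on with
  | empty =>
    have := ContDiff.hasW1 (contDiff_const (c := (0 : ℝ)) (E := E3) (𝕜 := ℝ) (n := ∞))
    simpa [angDeriv] using this
  | insert i s hi ih => simpa [Finset.sum_insert hi] using (h i).add ih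

lemma HasW2.comp_rot {f : S2 → ℝ} {F : Fin 3 → S2 → ℝ} {H : Fin 3 → Fin 3 → S2 → ℝ}
    (h : HasW2 f F H) (a : Fin 3) (t : ℝ) :
    HasW2 (fun x => f (srot a t x)) (fun b x => ∑ c, rotEntry a t b c * F c (srot a t x))
      (fun b d x => ∑ c, rotEntry a t b c * ∑ e, rotEntry a t d e * H c e (srot a t x)) :=
  ⟨h.fst.comp_rot a t, fun _ => HasW1.sum _ fun c => ((h.snd c).comp_rot a t).const_mul _⟩

/-- The inner product of two gradients, written in angular derivatives, is invariant under rotations. -/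
lemma sum_rotEntry_mul (a : Fin 3) (t : ℝ) (p q : Fin 3 → ℝ) :
    ∑ b, (∑ c, rotEntry a t b c * p c) * (∑ d, rotEntry a t b d * q d) = ∑ c, p c * q c := by
  simp only [Finset.sum_mul_sum]
  rw [Finset.sum_comm]
  refine Finset.sum_congr rfl fun c _ => ?_
  rw [Finset.sum_comm]
  have (d : Fin 3) : ∑ b, rotEntry a t b c * p c * (rotEntry a t b d * q d) =
      (if c = d then 1 else 0) * (p c * q d) := by
    rw [← rotEntry_orthogonal a t c d, Finset.sum_mul]
    exact Finset.sum_congr rfl fun b _ => by ring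
  simp [this]

/-- The Laplacian, as the trace of the second angular derivatives, is invariant under rotations. -/
lemma sum_rotEntry_trace (a : Fin 3) (t : ℝ) (H : Fin 3 → Fin 3 → ℝ) :
    ∑ b, ∑ c, rotEntry a t b c * ∑ e, rotEntry a t b e * H c e = ∑ c, H c c := by
  simp only [Finset.mul_sum]
  rw [Finset.sum_comm]
  refine Finset.sum_congr rfl fun c _ => ?_
  rw [Finset.sum_comm]
  have (e : Fin 3) : ∑ b, rotEntry a t b c * (rotEntry a t b e * H c e) =
      (if c = e then 1 else 0) * H c e := by
    rw [← rotEntry_orthogonal a t c e, Finset.sum_mul]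
    exact Finset.sum_congr rfl fun b _ => by ring
  simp [this]

/-! ### Difference quotients -/

/-- Differentiation under the integral along the flow of a rotation field. -/
lemma hasDerivAt_integral_rot {φ ψ : E3 → ℝ} (h : ContDiff ℝ ∞ φ) (hψ : ContDiff ℝ ∞ ψ)
    (a : Fin 3) (t : ℝ) :
    HasDerivAt (fun s => ∫ x : S2, φ (rot a s x) * ψ x ∂area)
      (∫ x : S2, angDeriv a φ (rot a t x) * ψ x ∂area) t := by
  obtain ⟨C, hC0, hC⟩ := exists_bound_sphere (h.angDeriv a)
  obtain ⟨D, hD0, hD⟩ := exists_bound_sphere hψ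
  refine (hasDerivAt_integral_of_dominated_loc_of_deriv_le (μ := area)
    (F := fun t (x : S2) => φ (rot a t x) * ψ x)
    (F' := fun t (x : S2) => angDeriv a φ (rot a t x) * ψ x)
    (bound := fun _ => C * D) (s := Set.univ) Filter.univ_mem ?_ ?_ ?_ ?_ ?_ ?_).2
  · exact Filter.Eventually.of_forall fun t =>
      ((contDiff_comp_rot h a t).mul hψ).continuous_sphere.aestronglyMeasurable
  · exact ((contDiff_comp_rot h a t).mul hψ).integrable_sphere
  · exact ((contDiff_comp_rot (h.angDeriv a) a t).mul hψ).continuous_sphere.aestronglyMeasurable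
  · refine Filter.Eventually.of_forall fun x s _ => ?_
    rw [norm_mul]
    exact mul_le_mul (hC (srot a s x)) (hD x) (norm_nonneg _) hC0
  · exact integrable_const _
  · exact Filter.Eventually.of_forall fun x t _ => (hasDerivAt_comp_rot h a t x).mul_const _

lemma l2_comp_rot {f : S2 → ℝ} (hf : MemLp f 2 area) (a : Fin 3) (t : ℝ) :
    l2 (fun x => f (srot a t x)) = l2 f := by
  have m := hf.comp_measurePreserving (measurePreserving_sphereMap (rot a t))
  rw [← sq_eq_sq₀ lpNorm_nonneg lpNorm_nonneg, l2_sq hf]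
  exact (l2_sq m).trans (integral_sphereMap (rot a t) fun x => f x ^ 2)

/-- The increment of a smooth function under a rotation, minus its linearization with a coefficient
`c`, is controlled by integrating its velocity against the increment itself. -/
lemma l2_increment_le {φ χ : E3 → ℝ} (h : ContDiff ℝ ∞ φ) (hχ : ContDiff ℝ ∞ χ) (a : Fin 3) (t : ℝ)
    {B : ℝ} (hB : ∀ s, |s| ≤ |t| → l2 (fun x : S2 => angDeriv a φ (rot a s x) - χ x) ≤ B) :
    l2 (fun x : S2 => φ (rot a t x) - φ x - t * χ x) ≤ |t| * B := by
  -- `g` is the pairing with the increment `ψ` itself, so that `g t - g 0 = ‖ψ‖²`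
  set ψ : E3 → ℝ := fun x => φ (rot a t x) - φ x - t * χ x with hψd
  have hψ : ContDiff ℝ ∞ ψ := ((contDiff_comp_rot h a t).sub h).sub (contDiff_const.mul hχ)
  set g : ℝ → ℝ := fun s => (∫ x : S2, φ (rot a s x) * ψ x ∂area) - s * ∫ x : S2, χ x * ψ x ∂area
    with hg
  have hg' (s : ℝ) : HasDerivAt g (∫ x : S2, (angDeriv a φ (rot a s x) - χ x) * ψ x ∂area) s := by
    have := (hasDerivAt_integral_rot h hψ a s).sub
      ((hasDerivAt_id s).mul_const (∫ x : S2, χ x * ψ x ∂area))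
    refine this.congr_deriv ?_
    simp only [sub_mul, one_mul]
    rw [integral_sub ((contDiff_comp_rot (h.angDeriv a) a s).mul hψ).integrable_sphere
      (hχ.mul hψ).integrable_sphere]
  have hm (s : ℝ) : MemLp (fun x : S2 => angDeriv a φ (rot a s x) - χ x) 2 area :=
    ((contDiff_comp_rot (h.angDeriv a) a s).sub hχ).memLp_sphere 2
  have hbound : ∀ s ∈ Set.uIcc 0 t, ‖∫ x : S2, (angDeriv a φ (rot a s x) - χ x) * ψ x ∂area‖ ≤
      B * l2 (fun x : S2 => ψ x) := by
    intro s hs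
    refine (abs_integral_mul_le (hm s) (hψ.memLp_sphere 2)).trans ?_
    refine mul_le_mul_of_nonneg_right (hB s ?_) lpNorm_nonneg
    rcases Set.mem_uIcc.1 hs with ⟨h1, h2⟩ | ⟨h1, h2⟩
    · rw [abs_of_nonneg h1, abs_of_nonneg (h1.trans h2)]; exact h2
    · rw [abs_of_nonpos h2, abs_of_nonpos (h1.trans h2)]; linarith
  have hmv := (convex_uIcc (0 : ℝ) t).norm_image_sub_le_of_norm_hasDerivWithin_le (f := g)
    (fun s _ => (hg' s).hasDerivWithinAt) hbound Set.left_mem_uIcc Set.right_mem_uIcc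
  have e : g t - g 0 = l2 (fun x : S2 => ψ x) ^ 2 := by
    rw [l2_sq (hψ.memLp_sphere 2)]
    simp only [hg, rot_zero, zero_mul, sub_zero]
    rw [← integral_const_mul, ← integral_sub ((contDiff_comp_rot h a t).mul hψ).integrable_sphere
      (contDiff_const.mul (hχ.mul hψ)).integrable_sphere, ← integral_sub
      (((contDiff_comp_rot h a t).mul hψ).sub (contDiff_const.mul (hχ.mul hψ))).integrable_sphere
      (h.mul hψ).integrable_sphere]
    refine integral_congr_ae (Filter.Eventually.of_forall fun x => ?_)
    simp only [hψd]
    ring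
  rw [e, sub_zero, Real.norm_eq_abs, Real.norm_eq_abs, abs_of_nonneg (sq_nonneg _)] at hmv
  have hB0 : 0 ≤ B := lpNorm_nonneg.trans (hB t le_rfl)
  have hN : 0 ≤ l2 (fun x : S2 => ψ x) := lpNorm_nonneg
  rcases hN.eq_or_lt with h0 | h0
  · rw [← h0]; positivity
  · have : l2 (fun x : S2 => ψ x) * l2 (fun x : S2 => ψ x) ≤ (|t| * B) * l2 (fun x : S2 => ψ x) := by
      nlinarith
    exact le_of_mul_le_mul_right this h0

lemma l2_smooth_increment_le {φ : E3 → ℝ} (h : ContDiff ℝ ∞ φ) (a : Fin 3) (t : ℝ) :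
    l2 (fun x : S2 => φ (rot a t x) - φ x) ≤ |t| * l2 (fun x : S2 => angDeriv a φ x) := by
  have := l2_increment_le h contDiff_const (χ := fun _ => 0) a t
    (B := l2 (fun x : S2 => angDeriv a φ x)) (fun s _ => by
      simp only [sub_zero]
      exact (l2_comp_rot ((h.angDeriv a).memLp_sphere 2) a s).le)
  simpa using this

lemma l2_smooth_increment_sub_le {φ : E3 → ℝ} (h : ContDiff ℝ ∞ φ) (a : Fin 3) (t : ℝ) :
    l2 (fun x : S2 => φ (rot a t x) - φ x - t * angDeriv a φ x) ≤
      |t| * (|t| * l2 (fun x : S2 => angDeriv a (angDeriv a φ) x)) := by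
  refine l2_increment_le h (h.angDeriv a) a t fun s hs => ?_
  refine (l2_smooth_increment_le (h.angDeriv a) a s).trans ?_
  exact mul_le_mul_of_nonneg_right hs lpNorm_nonneg

lemma l2_const_mul (c : ℝ) (f : S2 → ℝ) : l2 (fun x => c * f x) = |c| * l2 f := by
  have h := lpNorm_const_smul c f area (p := 2)
  rw [coe_nnnorm, Real.norm_eq_abs] at h
  exact h

lemma TendstoL2.sub {f f' : ℕ → S2 → ℝ} {g g' : S2 → ℝ} (h : TendstoL2 f g)
    (h' : TendstoL2 f' g') : TendstoL2 (fun n x => f n x - f' n x) (fun x => g x - g' x) := by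
  simpa [sub_eq_add_neg] using h.add (h'.const_mul (-1))

lemma HasW1.l2_increment_le {f : S2 → ℝ} {F : Fin 3 → S2 → ℝ} (h : HasW1 f F) (a : Fin 3) (t : ℝ) :
    l2 (fun x => f (srot a t x) - f x) ≤ |t| * l2 (F a) := by
  have tf := tendstoL2_mollify h.memLp
  have t1 := ((tf.comp_sphereMap (rot a t)).sub tf).l2
  have t2 := ((tendstoL2_mollify (h.memLp_deriv a)).l2).const_mul |t|
  refine le_of_tendsto_of_tendsto' t1 t2 fun n => ?_
  have := l2_smooth_increment_le (contDiff_mollify n h.integrable) a t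
  rw [angDeriv_mollify n (h.deriv a)] at this
  exact this

/-- Rotational difference quotients of a function of class `W^{1,2}` converge in `L²` to the angular
derivative. -/
lemma HasW1.tendsto_diffQuot {f : S2 → ℝ} {F : Fin 3 → S2 → ℝ} (h : HasW1 f F) (a : Fin 3) :
    Filter.Tendsto (fun t => l2 (fun x => t⁻¹ * (f (srot a t x) - f x) - F a x))
      (nhdsWithin 0 {0}ᶜ) (nhds 0) := by
  rw [Metric.tendsto_nhds]
  intro ε hε
  have tF := tendstoL2_mollify (h.memLp_deriv a)
  obtain ⟨n, hn⟩ := ((Metric.tendsto_nhds.1 tF.tendsto) (ε / 4) (by positivity)).exists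
  rw [Real.dist_eq, sub_zero, abs_of_nonneg lpNorm_nonneg] at hn
  set φ := mollify n f with hφ
  have hc : ContDiff ℝ ∞ φ := contDiff_mollify n h.integrable
  have hd : angDeriv a φ = mollify n (F a) := angDeriv_mollify n (h.deriv a)
  set K := l2 (fun x : S2 => angDeriv a (angDeriv a φ) x) with hK
  have hK0 : 0 ≤ K := lpNorm_nonneg
  have hnear : ∀ᶠ t : ℝ in nhdsWithin 0 {0}ᶜ, |t| * K < ε / 4 := by
    have : Filter.Tendsto (fun t : ℝ => |t| * K) (nhds 0) (nhds 0) := by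
      have h1 : Continuous fun t : ℝ => |t| * K := by fun_prop
      simpa using h1.tendsto 0
    exact (this.mono_left nhdsWithin_le_nhds).eventually_lt_const (by positivity)
  filter_upwards [hnear, self_mem_nhdsWithin] with t ht ht0
  have ht0' : t ≠ 0 := ht0
  rw [Real.dist_eq, sub_zero, abs_of_nonneg lpNorm_nonneg]
  -- compare with the mollified function, whose difference quotients converge at the rate `|t|`
  have hdiff : HasW1 (fun x => f x - φ x) (fun b x => F b x - mollify n (F b) x) := by
    have := h.add ((h.mollified n).const_mul (-1))
    simpa [sub_eq_add_neg] using this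
  have h1 := hdiff.l2_increment_le a t
  have h2 := l2_smooth_increment_sub_le hc a t
  have hmf := h.memLp
  have hmR : MemLp (fun x => f (srot a t x)) 2 area := (h.comp_rot a t).memLp
  have m1 : MemLp (fun x : S2 => (f (srot a t x) - φ (rot a t x)) - (f x - φ x)) 2 area :=
    memLp_sub (memLp_sub hmR ((contDiff_comp_rot hc a t).memLp_sphere 2))
      (memLp_sub hmf (hc.memLp_sphere 2))
  have m2 : MemLp (fun x : S2 => φ (rot a t x) - φ x - t * angDeriv a φ x) 2 area :=
    (((contDiff_comp_rot hc a t).sub hc).sub (contDiff_const.mul (hc.angDeriv a))).memLp_sphere 2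
  have m3 : MemLp (fun x : S2 => mollify n (F a) x - F a x) 2 area :=
    memLp_sub (tF.memLp_seq n) tF.memLp
  have e : (fun x => t⁻¹ * (f (srot a t x) - f x) - F a x) =
      (fun x : S2 => t⁻¹ * ((f (srot a t x) - φ (rot a t x)) - (f x - φ x))) +
      ((fun x : S2 => t⁻¹ * (φ (rot a t x) - φ x - t * angDeriv a φ x)) +
        fun x : S2 => mollify n (F a) x - F a x) := by
    ext x
    simp only [Pi.add_apply, hd]
    field_simp
    ring
  rw [e]
  have b1 := lpNorm_add_le (m1.const_mul t⁻¹) (p := 2) (g :=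
    (fun x : S2 => t⁻¹ * (φ (rot a t x) - φ x - t * angDeriv a φ x)) +
        fun x : S2 => mollify n (F a) x - F a x) (by norm_num)
  have b2 := lpNorm_add_le (m2.const_mul t⁻¹) (p := 2)
    (g := fun x : S2 => mollify n (F a) x - F a x) (by norm_num)
  have habs : 0 < |t| := abs_pos.2 ht0'
  have s1 : l2 (fun x : S2 => t⁻¹ * ((f (srot a t x) - φ (rot a t x)) - (f x - φ x))) < ε / 4 := by
    rw [l2_const_mul, abs_inv, inv_mul_lt_iff₀ habs]
    refine h1.trans_lt ((mul_lt_mul_iff_right₀ habs).2 ?_)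
    exact (lpNorm_sub_comm _ _ _ _).trans_lt hn
  have s2 : l2 (fun x : S2 => t⁻¹ * (φ (rot a t x) - φ x - t * angDeriv a φ x)) < ε / 4 := by
    rw [l2_const_mul, abs_inv, inv_mul_lt_iff₀ habs]
    exact h2.trans_lt ((mul_lt_mul_iff_right₀ habs).2 ht)
  linarith

/-! ### Interpolation inequalities -/

lemma TendstoL2.exists_ae_subseq {f : ℕ → S2 → ℝ} {g : S2 → ℝ} (h : TendstoL2 f g) :
    ∃ u : ℕ → ℕ, StrictMono u ∧
      ∀ᵐ x ∂area, Filter.Tendsto (fun n => f (u n) x) Filter.atTop (nhds (g x)) := by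
  refine TendstoInMeasure.exists_seq_tendsto_ae (μ := area) ?_
  refine tendstoInMeasure_of_tendsto_eLpNorm (p := 2) (by norm_num)
    (fun n => (h.memLp_seq n).1) h.memLp.1 ?_
  have h1 := ENNReal.tendsto_ofReal h.tendsto
  rw [ENNReal.ofReal_zero] at h1
  refine h1.congr fun n => ?_
  exact ofReal_lpNorm (memLp_sub (h.memLp_seq n) h.memLp)

/-- Fatou's lemma for fourth powers along an `L²`-convergent sequence. -/
lemma TendstoL2.integral_pow_four_le {f : ℕ → S2 → ℝ} {g : S2 → ℝ} (h : TendstoL2 f g) {B : ℝ}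
    (hi : ∀ n, Integrable (fun x => f n x ^ 4) area) (hB : ∀ n, ∫ x, f n x ^ 4 ∂area ≤ B) :
    Integrable (fun x => g x ^ 4) area ∧ ∫ x, g x ^ 4 ∂area ≤ B := by
  obtain ⟨u, -, hu⟩ := h.exists_ae_subseq
  have hm : AEStronglyMeasurable (fun x => g x ^ 4) area := 
    (h.memLp.1.aemeasurable.pow_const 4).aestronglyMeasurable
  have h0 (k : S2 → ℝ) : 0 ≤ᵐ[area] fun x => k x ^ 4 :=
    Filter.Eventually.of_forall fun x => by positivity
  have hB0 : 0 ≤ B := (integral_nonneg_of_ae (h0 (f 0))).trans (hB 0)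
  have hfat : ∫⁻ x, ENNReal.ofReal (g x ^ 4) ∂area ≤ ENNReal.ofReal B := by
    have hae (n : ℕ) : AEMeasurable (fun x => ENNReal.ofReal (f (u n) x ^ 4)) area :=
      ENNReal.measurable_ofReal.comp_aemeasurable
        ((h.memLp_seq (u n)).1.aemeasurable.pow_const 4)
    have hl := lintegral_liminf_le' (u := Filter.atTop) hae
    calc ∫⁻ x, ENNReal.ofReal (g x ^ 4) ∂area
        = ∫⁻ x, Filter.liminf (fun n => ENNReal.ofReal (f (u n) x ^ 4)) Filter.atTop ∂area := by
          refine lintegral_congr_ae ?_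
          filter_upwards [hu] with x hx
          exact (ENNReal.tendsto_ofReal (hx.pow 4)).liminf_eq.symm
      _ ≤ _ := hl
      _ ≤ ENNReal.ofReal B := by
          refine Filter.liminf_le_of_frequently_le' (Filter.Frequently.of_forall fun n => ?_)
          rw [← ofReal_integral_eq_lintegral_ofReal (hi (u n)) (h0 _)]
          exact ENNReal.ofReal_le_ofReal (hB (u n))
  have hint : Integrable (fun x => g x ^ 4) area := by
    refine ⟨hm, ?_⟩
    rw [hasFiniteIntegral_iff_ofReal (h0 g)]
    exact hfat.trans_lt ENNReal.ofReal_lt_top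
  refine ⟨hint, ?_⟩
  rw [← ofReal_integral_eq_lintegral_ofReal hint (h0 g)] at hfat
  exact (ENNReal.ofReal_le_ofReal_iff hB0).1 hfat

lemma integral_abs_mul_le {f g : S2 → ℝ} (hf : MemLp f 2 area) (hg : MemLp g 2 area) :
    ∫ x, |f x| * |g x| ∂area ≤ l2 f * l2 g := by
  have h := abs_integral_mul_le hf.abs hg.abs
  have e1 : l2 |f| = l2 f := lpNorm_abs hf.1 2
  have e2 : l2 |g| = l2 g := lpNorm_abs hg.1 2
  rw [e1, e2] at h
  exact (le_abs_self _).trans h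

/-- Ladyzhenskaya's inequality for smooth functions: the endpoint inequality `W^{1,1} ⊂ L²`, applied to
`φ²`. -/
lemma ladyzhenskaya_smooth {φ : E3 → ℝ} (h : ContDiff ℝ ∞ φ) :
    ∫ x : S2, φ x ^ 4 ∂area ≤ 5000 * l2 (fun x : S2 => φ x) ^ 2 *
      (l2 (fun x : S2 => φ x) ^ 2 + ∑ a, l2 (fun x : S2 => angDeriv a φ x) ^ 2) := by
  have h1 := integral_sq_le_sq_integral (h.mul h)
  set N := l2 (fun x : S2 => φ x) with hN
  set M : Fin 3 → ℝ := fun a => l2 (fun x : S2 => angDeriv a φ x) with hM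
  have hN0 : 0 ≤ N := lpNorm_nonneg
  have hM0 (a : Fin 3) : 0 ≤ M a := lpNorm_nonneg
  have m0 := h.memLp_sphere 2
  have ma (a : Fin 3) := (h.angDeriv a).memLp_sphere 2
  have h2 : ∫ x : S2, angSize (fun x => φ x * φ x) x ∂area ≤ N ^ 2 + ∑ a, 2 * (N * M a) := by
    have e (x : S2) : angSize (fun x => φ x * φ x) x =
        φ x ^ 2 + ∑ a, 2 * (|φ x| * |angDeriv a φ x|) := by
      unfold angSize
      rw [abs_mul_self, pow_two]
      congr 1
      refine Finset.sum_congr rfl fun a _ => ?_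
      rw [angDeriv_mul h h, mul_comm (angDeriv a φ x), ← two_mul, abs_mul, abs_mul]
      simp
    have ia (a : Fin 3) : Integrable (fun x : S2 => 2 * (|φ x| * |angDeriv a φ x|)) area :=
      (integrable_mul_of_memLp m0.abs (ma a).abs).const_mul 2
    simp only [e]
    rw [integral_add m0.integrable_sq (integrable_finsetSum _ fun a _ => ia a),
      integral_finsetSum _ fun a _ => ia a, ← l2_sq m0]
    refine add_le_add le_rfl (Finset.sum_le_sum fun a _ => ?_)
    rw [integral_const_mul]
    exact mul_le_mul_of_nonneg_left (integral_abs_mul_le m0 (ma a)) (by norm_num)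
  have h3 : 0 ≤ ∫ x : S2, angSize (fun x => φ x * φ x) x ∂area :=
    integral_nonneg fun x => angSize_nonneg _ _
  have h4 := pow_le_pow_left₀ h3 h2 2
  have e4 : ∫ x : S2, φ x ^ 4 ∂area = ∫ x : S2, (φ x * φ x) ^ 2 ∂area := by
    congr 1; ext x; ring
  rw [e4]
  refine h1.trans ((mul_le_mul_of_nonneg_left h4 (by norm_num)).trans ?_)
  simp only [Fin.sum_univ_three]
  have h5 : (N ^ 2 + (2 * (N * M 0) + 2 * (N * M 1) + 2 * (N * M 2))) ^ 2 ≤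
      13 * (N ^ 2 * (N ^ 2 + (M 0 ^ 2 + M 1 ^ 2 + M 2 ^ 2))) := by
    have : (N + 2 * M 0 + 2 * M 1 + 2 * M 2) ^ 2 ≤ 13 * (N ^ 2 + (M 0 ^ 2 + M 1 ^ 2 + M 2 ^ 2)) := by
      nlinarith [sq_nonneg (2 * N - M 0), sq_nonneg (2 * N - M 1), sq_nonneg (2 * N - M 2),
        sq_nonneg (M 0 - M 1), sq_nonneg (M 0 - M 2), sq_nonneg (M 1 - M 2)]
    nlinarith [mul_le_mul_of_nonneg_left this (sq_nonneg N)]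
  have h6 : 0 ≤ N ^ 2 * (N ^ 2 + (M 0 ^ 2 + M 1 ^ 2 + M 2 ^ 2)) := by positivity
  linarith

/-- Ladyzhenskaya's inequality on the sphere. -/
lemma HasW1.ladyzhenskaya {f : S2 → ℝ} {F : Fin 3 → S2 → ℝ} (h : HasW1 f F) :
    Integrable (fun x => f x ^ 4) area ∧
      ∫ x, f x ^ 4 ∂area ≤ 5000 * l2 f ^ 2 * (l2 f ^ 2 + ∑ a, l2 (F a) ^ 2) := by
  refine (tendstoL2_mollify h.memLp).integral_pow_four_le (fun n => ?_) fun n => ?_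
  · exact ((contDiff_mollify n h.integrable).pow 4).integrable_sphere
  · refine (ladyzhenskaya_smooth (contDiff_mollify n h.integrable)).trans ?_
    simp only [angDeriv_mollify n (h.deriv _)]
    have h1 := l2_mollify_le n h.memLp
    have h2 (a : Fin 3) := l2_mollify_le n (h.memLp_deriv a)
    gcongr
    all_goals first | exact lpNorm_nonneg | exact h1 | exact h2 _

/-- Agmon's inequality for smooth functions: the endpoint inequality `W^{2,1} ⊂ L^∞`, applied to `φ²`. -/
lemma sup_sq_le_smooth {φ : E3 → ℝ} (h : ContDiff ℝ ∞ φ) (x : S2) :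
    φ x ^ 2 ≤ 64 * (l2 (fun x : S2 => φ x) ^ 2 + ∑ a, l2 (fun x : S2 => angDeriv a φ x) ^ 2 +
      ∑ a, ∑ b, l2 (fun x : S2 => φ x) * l2 (fun x : S2 => angDeriv b (angDeriv a φ) x)) := by
  have h1 := abs_le_integral_angSize (h.mul h) x
  have m0 := h.memLp_sphere 2
  have ma (a : Fin 3) := (h.angDeriv a).memLp_sphere 2
  have mab (a b : Fin 3) := ((h.angDeriv a).angDeriv b).memLp_sphere 2
  have hd (a : Fin 3) : angDeriv a (fun y => φ y * φ y) = fun y => 2 * (φ y * angDeriv a φ y) := by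
    ext y; rw [angDeriv_mul h h]; ring
  have hdd (a b : Fin 3) (y : E3) : angDeriv b (angDeriv a (fun y => φ y * φ y)) y =
      2 * (φ y * angDeriv b (angDeriv a φ) y + angDeriv b φ y * angDeriv a φ y) := by
    rw [hd, angDeriv_mul contDiff_const (h.mul (h.angDeriv a)), angDeriv_mul h (h.angDeriv a)]
    simp [angDeriv]
  have hpt (y : S2) : angSize (fun y => φ y * φ y) y +
      ∑ a, angSize (angDeriv a (fun y => φ y * φ y)) y ≤
      8 * (φ y ^ 2 + ∑ a, angDeriv a φ y ^ 2 +
        ∑ a, ∑ b, |φ y| * |angDeriv b (angDeriv a φ) y|) := by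
    unfold angSize
    simp only [hdd]
    simp only [hd, abs_mul_self, abs_mul, abs_two]
    have hsq (a : Fin 3) : 2 * (|φ y| * |angDeriv a φ y|) ≤ φ y ^ 2 + angDeriv a φ y ^ 2 := by
      have := two_mul_le_add_sq |φ y| |angDeriv a φ y|
      rw [sq_abs, sq_abs] at this
      linarith
    have hcr (a b : Fin 3) : 2 * |φ y * angDeriv b (angDeriv a φ) y + angDeriv b φ y * angDeriv a φ y|
        ≤ 2 * (|φ y| * |angDeriv b (angDeriv a φ) y|) + (angDeriv b φ y ^ 2 + angDeriv a φ y ^ 2) := by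
      have h3 := abs_add_le (φ y * angDeriv b (angDeriv a φ) y) (angDeriv b φ y * angDeriv a φ y)
      rw [abs_mul, abs_mul] at h3
      have := two_mul_le_add_sq |angDeriv b φ y| |angDeriv a φ y|
      rw [sq_abs, sq_abs] at this
      linarith
    have hp (a b : Fin 3) : 0 ≤ |φ y| * |angDeriv b (angDeriv a φ) y| := by positivity
    simp only [Fin.sum_univ_three]
    have := hsq 0; have := hsq 1; have := hsq 2
    have := hcr 0 0; have := hcr 0 1; have := hcr 0 2
    have := hcr 1 0; have := hcr 1 1; have := hcr 1 2
    have := hcr 2 0; have := hcr 2 1; have := hcr 2 2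
    have := hp 0 0; have := hp 0 1; have := hp 0 2
    have := hp 1 0; have := hp 1 1; have := hp 1 2
    have := hp 2 0; have := hp 2 1; have := hp 2 2
    have := sq_nonneg (φ y)
    nlinarith
  have hiab (a b : Fin 3) : Integrable (fun y : S2 => |φ y| * |angDeriv b (angDeriv a φ) y|) area :=
    integrable_mul_of_memLp m0.abs (mab a b).abs
  have hi1 : Integrable (fun y : S2 => ∑ a, angDeriv a φ y ^ 2) area :=
    integrable_finsetSum _ fun a _ => (ma a).integrable_sq
  have hi2 : Integrable (fun y : S2 => ∑ a, ∑ b, |φ y| * |angDeriv b (angDeriv a φ) y|) area :=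
    integrable_finsetSum _ fun a _ => integrable_finsetSum _ fun b _ => hiab a b
  have hi01 := m0.integrable_sq.add hi1
  have hi : Integrable (fun y : S2 => 8 * (φ y ^ 2 + ∑ a, angDeriv a φ y ^ 2 +
        ∑ a, ∑ b, |φ y| * |angDeriv b (angDeriv a φ) y|)) area := (hi01.add hi2).const_mul 8
  have h2 := integral_mono_of_nonneg (Filter.Eventually.of_forall fun y : S2 =>
    add_nonneg (angSize_nonneg (fun y => φ y * φ y) y)
      (Finset.sum_nonneg fun a _ => angSize_nonneg (angDeriv a (fun y => φ y * φ y)) y)) hi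
      (Filter.Eventually.of_forall hpt)
  have h3 : ∫ y : S2, 8 * (φ y ^ 2 + ∑ a, angDeriv a φ y ^ 2 +
        ∑ a, ∑ b, |φ y| * |angDeriv b (angDeriv a φ) y|) ∂area ≤ 8 *
      (l2 (fun x : S2 => φ x) ^ 2 + ∑ a, l2 (fun x : S2 => angDeriv a φ x) ^ 2 +
      ∑ a, ∑ b, l2 (fun x : S2 => φ x) * l2 (fun x : S2 => angDeriv b (angDeriv a φ) x)) := by
    rw [integral_const_mul]
    refine mul_le_mul_of_nonneg_left ?_ (by norm_num)
    refine (integral_add hi01 hi2).trans_le ?_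
    refine add_le_add (le_of_eq ?_) ?_
    · refine (integral_add m0.integrable_sq hi1).trans ?_
      rw [integral_finsetSum _ fun a _ => (ma a).integrable_sq, l2_sq m0]
      simp only [l2_sq (ma _)]
    · rw [integral_finsetSum _ fun a _ => integrable_finsetSum _ fun b _ => hiab a b]
      refine Finset.sum_le_sum fun a _ => ?_
      rw [integral_finsetSum _ fun b _ => hiab a b]
      exact Finset.sum_le_sum fun b _ => integral_abs_mul_le m0 (mab a b)
  rw [abs_mul_self, ← pow_two] at h1
  linarith

/-- Agmon's inequality on the sphere. -/
lemma HasW2.sup_sq_le {f : S2 → ℝ} {F : Fin 3 → S2 → ℝ} {H : Fin 3 → Fin 3 → S2 → ℝ}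
    (h : HasW2 f F H) : ∀ᵐ x ∂area, f x ^ 2 ≤
      64 * (l2 f ^ 2 + ∑ a, l2 (F a) ^ 2 + ∑ a, ∑ b, l2 f * l2 (H a b)) := by
  obtain ⟨u, -, hu⟩ := (tendstoL2_mollify h.fst.memLp).exists_ae_subseq
  filter_upwards [hu] with x hx
  refine le_of_tendsto' (hx.pow 2) fun n => ?_
  refine (sup_sq_le_smooth (contDiff_mollify (u n) h.fst.integrable) x).trans ?_
  have h1 (a : Fin 3) := angDeriv_mollify (u n) (h.fst.deriv a)
  have h2 (a b : Fin 3) := angDeriv_mollify (u n) ((h.snd a).deriv b)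
  simp only [h1, h2]
  have b0 := l2_mollify_le (u n) h.fst.memLp
  have b1 (a : Fin 3) := l2_mollify_le (u n) (h.fst.memLp_deriv a)
  have b2 (a b : Fin 3) := l2_mollify_le (u n) ((h.snd a).memLp_deriv b)
  have p0 : 0 ≤ l2 (fun x : S2 => mollify (u n) f x) := lpNorm_nonneg
  have p1 (a : Fin 3) : 0 ≤ l2 (fun x : S2 => mollify (u n) (F a) x) := lpNorm_nonneg
  have p2 (a b : Fin 3) : 0 ≤ l2 (fun x : S2 => mollify (u n) (H a b) x) := lpNorm_nonneg
  have q0 : 0 ≤ l2 f := lpNorm_nonneg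
  gcongr
  all_goals first | exact lpNorm_nonneg | exact b0 | exact b1 _ | exact b2 _ _

/-- The Laplacian `∑ₐ LₐLₐ f`, read off the array of second derivatives. -/
def trace2 (H : Fin 3 → Fin 3 → S2 → ℝ) (x : S2) : ℝ := ∑ a, H a a x

lemma HasW2.memLp_trace2 {f : S2 → ℝ} {F : Fin 3 → S2 → ℝ} {H : Fin 3 → Fin 3 → S2 → ℝ}
    (h : HasW2 f F H) : MemLp (trace2 H) 2 area := by
  unfold trace2
  exact memLp_finsetSum _ fun a _ => (h.snd a).memLp_deriv a

/-- Bochner's identity for functions of class `W^{2,2}`. -/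
lemma HasW2.bochner {f : S2 → ℝ} {F : Fin 3 → S2 → ℝ} {H : Fin 3 → Fin 3 → S2 → ℝ}
    (h : HasW2 f F H) : ∑ a, ∑ b, l2 (H a b) ^ 2 = l2 (trace2 H) ^ 2 := by
  have t (a b : Fin 3) := tendstoL2_mollify ((h.snd a).memLp_deriv b)
  have t1 := tendsto_finsetSum Finset.univ fun a _ =>
    tendsto_finsetSum Finset.univ fun b _ => ((t a b).l2).pow 2
  have t2 := (TendstoL2.sum Finset.univ fun a => t a a).l2.pow 2
  refine tendsto_nhds_unique t1 (t2.congr fun n => ?_)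
  have hc := contDiff_mollify n h.fst.integrable
  have h1 (a : Fin 3) := angDeriv_mollify n (h.fst.deriv a)
  have h2 (a b : Fin 3) := angDeriv_mollify n ((h.snd a).deriv b)
  have key := integral_sq_angDeriv_angDeriv hc
  unfold angLaplacian at key
  simp only [h1, h2] at key
  rw [l2_sq ((TendstoL2.sum Finset.univ fun a => t a a).memLp_seq n), ← key]
  simp only [l2_sq ((t _ _).memLp_seq n)]

/-- The commutators of the second derivatives are first derivatives, so that the gradient is
controlled by the Laplacian. -/
lemma HasW2.gradient_le {f : S2 → ℝ} {F : Fin 3 → S2 → ℝ} {H : Fin 3 → Fin 3 → S2 → ℝ}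
    (h : HasW2 f F H) : ∑ a, l2 (F a) ^ 2 ≤ 2 * l2 (trace2 H) ^ 2 := by
  have hcomm (a : Fin 3) : (fun x => H (a + 1) a x - H a (a + 1) x) =ᵐ[area]
      fun x => -F (a + 2) x := by
    have t1 := (tendstoL2_mollify ((h.snd (a + 1)).memLp_deriv a)).sub
      (tendstoL2_mollify ((h.snd a).memLp_deriv (a + 1)))
    have t2 := (tendstoL2_mollify (h.fst.memLp_deriv (a + 2))).const_mul (-1)
    have key : (fun x => (H (a + 1) a x - H a (a + 1) x) + F (a + 2) x) =ᵐ[area] 0 := by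
      refine ae_eq_zero_of_integral_smooth ((t1.memLp.add (h.fst.memLp_deriv (a + 2))).integrable
        (by norm_num)) fun φ hφ => ?_
      have t3 := (t1.add (tendstoL2_mollify (h.fst.memLp_deriv (a + 2)))).integral_mul_right
        (hφ.memLp_sphere 2)
      refine tendsto_nhds_unique t3 (Filter.Tendsto.congr (fun n => ?_) tendsto_const_nhds)
      have hc := contDiff_mollify n h.fst.integrable
      have h1 (a : Fin 3) := angDeriv_mollify n (h.fst.deriv a)
      have h2 (a b : Fin 3) := angDeriv_mollify n ((h.snd a).deriv b)
      have h3 (x : E3) := angDeriv_comm hc a x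
      simp only [h1, h2] at h3
      simp [h3]
    filter_upwards [key] with x hx
    simp only [Pi.zero_apply] at hx
    linarith
  have hF (a : Fin 3) : l2 (F (a + 2)) ^ 2 ≤ 2 * l2 (H (a + 1) a) ^ 2 + 2 * l2 (H a (a + 1)) ^ 2 := by
    have m1 := (h.snd (a + 1)).memLp_deriv a
    have m2 := (h.snd a).memLp_deriv (a + 1)
    rw [l2_sq (h.fst.memLp_deriv _), l2_sq m1, l2_sq m2, ← integral_const_mul, ← integral_const_mul,
      ← integral_add (m1.integrable_sq.const_mul 2) (m2.integrable_sq.const_mul 2)]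
    refine integral_mono_ae (h.fst.memLp_deriv _).integrable_sq
      ((m1.integrable_sq.const_mul 2).add (m2.integrable_sq.const_mul 2)) ?_
    filter_upwards [hcomm a] with x hx
    have : F (a + 2) x = H a (a + 1) x - H (a + 1) a x := by linarith
    simp only [this]
    nlinarith [sq_nonneg (H a (a + 1) x + H (a + 1) a x)]
  rw [← h.bochner]
  have h0 := hF 0; have h1 := hF 1; have h2 := hF 2
  simp only [Fin.sum_univ_three]
  have e1 : (1 : Fin 3) + 1 = 2 := rfl
  have e2 : (1 : Fin 3) + 2 = 0 := rfl
  have e3 : (2 : Fin 3) + 1 = 0 := rfl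
  have e4 : (2 : Fin 3) + 2 = 1 := rfl
  simp only [zero_add, e1, e2, e3, e4] at h0 h1 h2
  nlinarith [sq_nonneg (l2 (H 0 0)), sq_nonneg (l2 (H 1 1)), sq_nonneg (l2 (H 2 2))]

/-! ### Products of functions of class `W^{2,2}` -/

lemma memLp_mul_top {f g : S2 → ℝ} (hf : MemLp f ⊤ area) (hg : MemLp g 2 area) :
    MemLp (fun x => f x * g x) 2 area :=
  MemLp.mul (r := 2) hg hf

lemma memLp_mul_four {f g : S2 → ℝ} (hf : MemLp f 4 area) (hg : MemLp g 4 area) :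
    MemLp (fun x => f x * g x) 2 area :=
  haveI : ENNReal.HolderTriple 4 4 2 := ⟨by
    rw [← two_mul, show (4 : ENNReal) = 2 * 2 by norm_num,
      ENNReal.mul_inv (by simp) (by simp), ← mul_assoc,
      ENNReal.mul_inv_cancel (by simp) (by simp), one_mul]⟩
  MemLp.mul (r := 2) hg hf

lemma HasW1.memLp_four {f : S2 → ℝ} {F : Fin 3 → S2 → ℝ} (h : HasW1 f F) : MemLp f 4 area := by
  have h4 := h.ladyzhenskaya.1
  rw [← integrable_norm_rpow_iff h.memLp.1 (by simp) (by simp)]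
  refine h4.congr (Filter.Eventually.of_forall fun x => ?_)
  have : (4 : ENNReal).toReal = ((4 : ℕ) : ℝ) := by simp
  simp only [this, Real.rpow_natCast, Real.norm_eq_abs]
  exact (Even.pow_abs (by decide) _).symm

lemma HasW2.memLp_top {f : S2 → ℝ} {F : Fin 3 → S2 → ℝ} {H : Fin 3 → Fin 3 → S2 → ℝ}
    (h : HasW2 f F H) : MemLp f ⊤ area := by
  refine memLp_top_of_bound h.fst.memLp.1 (Real.sqrt
    (64 * (l2 f ^ 2 + ∑ a, l2 (F a) ^ 2 + ∑ a, ∑ b, l2 f * l2 (H a b)))) ?_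
  filter_upwards [h.sup_sq_le] with x hx
  exact Real.abs_le_sqrt hx

lemma HasW1.mul {f g : S2 → ℝ} {F G : Fin 3 → S2 → ℝ} (h : HasW1 f F) (h' : HasW1 g G)
    (hm : MemLp (fun x => f x * g x) 2 area)
    (hd : ∀ a, MemLp (fun x => f x * G a x + F a x * g x) 2 area) :
    HasW1 (fun x => f x * g x) (fun a x => f x * G a x + F a x * g x) :=
  ⟨hm, hd, fun a => h.hasAngDeriv_mul h' a⟩

lemma HasW1.mul_top {f g : S2 → ℝ} {F G : Fin 3 → S2 → ℝ} (h : HasW1 f F) (h' : HasW1 g G)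
    (hf : MemLp f ⊤ area) (hg : MemLp g ⊤ area) :
    HasW1 (fun x => f x * g x) (fun a x => f x * G a x + F a x * g x) := by
  refine h.mul h' (memLp_mul_top hf h'.memLp) fun a => ?_
  have := memLp_mul_top hg (h.memLp_deriv a)
  simp only [mul_comm (g _)] at this
  exact (memLp_mul_top hf (h'.memLp_deriv a)).add this

lemma HasW1.mul_smooth {f : S2 → ℝ} {F : Fin 3 → S2 → ℝ} (h : HasW1 f F) {ψ : E3 → ℝ}
    (hψ : ContDiff ℝ ∞ ψ) :
    HasW1 (fun x => f x * ψ x) (fun a x => f x * angDeriv a ψ x + F a x * ψ x) :=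
  h.mul hψ.hasW1 ((TendstoL2.const h.memLp).mul_smooth hψ).memLp fun a =>
    ((TendstoL2.const h.memLp).mul_smooth (hψ.angDeriv a)).memLp.add
      ((TendstoL2.const (h.memLp_deriv a)).mul_smooth hψ).memLp

/-- `W^{2,2}(S²)` is an algebra, by Agmon's and Ladyzhenskaya's inequalities. -/
lemma HasW2.mul {f g : S2 → ℝ} {F G : Fin 3 → S2 → ℝ} {H K : Fin 3 → Fin 3 → S2 → ℝ}
    (h : HasW2 f F H) (h' : HasW2 g G K) :
    HasW2 (fun x => f x * g x) (fun a x => f x * G a x + F a x * g x)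
      (fun a b x => (f x * K a b x + F b x * G a x) + (F a x * G b x + H a b x * g x)) := by
  refine ⟨h.fst.mul_top h'.fst h.memLp_top h'.memLp_top, fun a => ?_⟩
  have comm {p q : S2 → ℝ} (hm : MemLp (fun x => p x * q x) 2 area) :
      MemLp (fun x => q x * p x) 2 area := by simpa only [mul_comm] using hm
  have m1 (a b : Fin 3) := memLp_mul_top h.memLp_top ((h'.snd a).memLp_deriv b)
  have m2 (a b : Fin 3) := comm (memLp_mul_top h'.memLp_top ((h.snd a).memLp_deriv b))
  have m3 (a b : Fin 3) := memLp_mul_four (h.snd a).memLp_four (h'.snd b).memLp_four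
  exact (h.fst.mul (h'.snd a) (memLp_mul_top h.memLp_top (h'.snd a).memLp)
      fun b => (m1 a b).add (m3 b a)).add
    ((h.snd a).mul h'.fst (comm (memLp_mul_top h'.memLp_top (h.snd a).memLp))
      fun b => (m3 a b).add (m2 a b))

/-- The radial component of the gradient vanishes. -/
lemma HasW1.sum_coord_mul_deriv {f : S2 → ℝ} {F : Fin 3 → S2 → ℝ} (h : HasW1 f F) :
    ∀ᵐ x : S2 ∂area, ∑ a, (x : E3) a * F a x = 0 := by
  have hi (a : Fin 3) (φ : E3 → ℝ) (hφ : ContDiff ℝ ∞ φ) :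
      Integrable (fun x : S2 => F a x * φ x) area := integrable_mul_smooth (h.deriv a).2.1 hφ
  have hi' (a : Fin 3) (φ : E3 → ℝ) (hφ : ContDiff ℝ ∞ φ) :
      Integrable (fun x : S2 => f x * φ x) area := integrable_mul_smooth h.integrable hφ
  have key : (fun x : S2 => ∑ a, (x : E3) a * F a x) =ᵐ[area] 0 := by
    refine ae_eq_zero_of_integral_smooth (integrable_finsetSum _ fun a _ => ?_) fun φ hφ => ?_
    · simpa only [mul_comm] using hi a _ (contDiff_coord a)
    · have e1 : ∀ x : S2, (∑ a, (x : E3) a * F a x) * φ x =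
          ∑ a, F a x * ((x : E3) a * φ x) := fun x => by
        rw [Finset.sum_mul]; exact Finset.sum_congr rfl fun a _ => by ring
      simp only [e1]
      rw [integral_finsetSum _ fun a _ => hi a _ ((contDiff_coord a).mul hφ)]
      have e2 (a : Fin 3) : ∫ x : S2, F a x * ((x : E3) a * φ x) ∂area =
          -∫ x : S2, f x * ((x : E3) a * angDeriv a φ x) ∂area := by
        have := (h.deriv a).2.2 _ ((contDiff_coord a).mul hφ)
        simpa only [angDeriv_mul (contDiff_coord a) hφ, angDeriv_coord, crossVec_apply_self,
          zero_mul, add_zero] using this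
      simp only [e2, Finset.sum_neg_distrib]
      rw [← integral_finsetSum _ fun a _ => hi' a _ ((contDiff_coord a).mul (hφ.angDeriv a)),
        neg_eq_zero]
      refine integral_eq_zero_of_ae (Filter.Eventually.of_forall fun x => ?_)
      simp only [← Finset.mul_sum, Pi.zero_apply]
      have : ∑ a, (x : E3) a * angDeriv a φ x =
          fderiv ℝ φ x (∑ a, (x : E3) a • crossVec a x) := by
        simp [angDeriv]
      rw [this]
      have : ∑ a, (x : E3) a • crossVec a x = 0 := by
        ext i; fin_cases i <;> simp [Fin.sum_univ_three, crossVec] <;> ring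
      rw [this, map_zero, mul_zero]
  exact key

/-! ### Tangential and angular derivatives -/

lemma IsWeakDeriv.congr_left {i : Fin 3} {f f' g : S2 → ℝ} (h : IsWeakDeriv i f g)
    (hf : f =ᵐ[area] f') : IsWeakDeriv i f' g := by
  refine ⟨h.1.congr hf, h.2.1, fun φ hφ => ?_⟩
  have h1 : ∫ x, f' x * tangentialDeriv i φ x ∂area = ∫ x, f x * tangentialDeriv i φ x ∂area := by
    refine integral_congr_ae ?_
    filter_upwards [hf] with x hx; rw [hx]
  have h2 : ∫ x : S2, f' x * φ x * (x : E3) i ∂area = ∫ x : S2, f x * φ x * (x : E3) i ∂area := by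
    refine integral_congr_ae ?_
    filter_upwards [hf] with x hx; rw [hx]
  rw [h1, h2, h.2.2 φ hφ]

lemma IsWeakDeriv.unique {i : Fin 3} {f g g' : S2 → ℝ} (h : IsWeakDeriv i f g)
    (h' : IsWeakDeriv i f g') : g =ᵐ[area] g' := by
  have : (fun x => g x - g' x) =ᵐ[area] 0 := by
    refine ae_eq_zero_of_integral_smooth (h.2.1.sub h'.2.1) fun φ hφ => ?_
    simp only [sub_mul]
    rw [integral_sub (integrable_mul_smooth h.2.1 hφ) (integrable_mul_smooth h'.2.1 hφ),
      h.2.2 φ hφ, h'.2.2 φ hφ, sub_self]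
  filter_upwards [this] with x hx
  exact sub_eq_zero.1 hx

lemma IsWeakDeriv.weakDeriv_ae {i : Fin 3} {f g : S2 → ℝ} (h : IsWeakDeriv i f g) :
    weakDeriv i f =ᵐ[area] g := by
  have hex : ∃ g, IsWeakDeriv i f g := ⟨g, h⟩
  unfold weakDeriv
  rw [dif_pos hex]
  exact hex.choose_spec.unique h

lemma sphere_sum_sq (x : S2) (a : Fin 3) :
    (x : E3) a ^ 2 + (x : E3) (a + 1) ^ 2 + (x : E3) (a + 2) ^ 2 = 1 := by
  rw [← norm_sq_cyclic]; simp

/-- The weak form of `D = -x × L`. -/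
lemma HasW1.isWeakDeriv {f : S2 → ℝ} {F : Fin 3 → S2 → ℝ} (h : HasW1 f F) (i : Fin 3) :
    IsWeakDeriv i f (fun x => F (i + 1) x * (x : E3) (i + 2) - F (i + 2) x * (x : E3) (i + 1)) := by
  have i1 (a : Fin 3) {φ : E3 → ℝ} (hφ : ContDiff ℝ ∞ φ) := integrable_mul_smooth (h.deriv a).2.1 hφ
  have i0 {φ : E3 → ℝ} (hφ : ContDiff ℝ ∞ φ) := integrable_mul_smooth h.integrable hφ
  have c (j : Fin 3) := contDiff_coord j
  refine ⟨h.integrable, (i1 (i + 1) (c (i + 2))).sub (i1 (i + 2) (c (i + 1))), fun φ hφ => ?_⟩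
  have e1 := (h.deriv (i + 1)).2.2 _ ((c (i + 2)).mul hφ)
  have e2 := (h.deriv (i + 2)).2.2 _ ((c (i + 1)).mul hφ)
  simp only [angDeriv_mul (c _) hφ, angDeriv_coord] at e1 e2
  have j1 : Integrable (fun x : S2 => f x * ((x : E3) (i + 2) * angDeriv (i + 1) φ x +
      crossVec (i + 1) x (i + 2) * φ x)) area := i0 (((c (i + 2)).mul (hφ.angDeriv (i + 1))).add
    (((contDiff_coord (i + 2)).comp (contDiff_crossVec (i + 1))).mul hφ))
  have j2 : Integrable (fun x : S2 => f x * ((x : E3) (i + 1) * angDeriv (i + 2) φ x +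
      crossVec (i + 2) x (i + 1) * φ x)) area := i0 (((c (i + 1)).mul (hφ.angDeriv (i + 2))).add
    (((contDiff_coord (i + 1)).comp (contDiff_crossVec (i + 2))).mul hφ))
  have j3 := i0 (hφ.mul (c i))
  have hl : ∫ x : S2, (F (i + 1) x * (x : E3) (i + 2) - F (i + 2) x * (x : E3) (i + 1)) * φ x ∂area =
      (∫ x : S2, F (i + 1) x * ((x : E3) (i + 2) * φ x) ∂area) -
        ∫ x : S2, F (i + 2) x * ((x : E3) (i + 1) * φ x) ∂area := by
    simp only [sub_mul, mul_assoc]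
    exact integral_sub (i1 _ ((c _).mul hφ)) (i1 _ ((c _).mul hφ))
  have hr : (∫ x : S2, f x * tangentialDeriv i φ x ∂area) =
      ((∫ x : S2, f x * ((x : E3) (i + 2) * angDeriv (i + 1) φ x +
          crossVec (i + 1) x (i + 2) * φ x) ∂area) -
        ∫ x : S2, f x * ((x : E3) (i + 1) * angDeriv (i + 2) φ x +
          crossVec (i + 2) x (i + 1) * φ x) ∂area) + 2 * ∫ x : S2, f x * (φ x * (x : E3) i) ∂area := by
    rw [← integral_sub j1 j2, ← integral_const_mul]
    have j12 := j1.sub j2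
    refine Eq.trans ?_ (integral_add j12 (j3.const_mul 2))
    refine integral_congr_ae (Filter.Eventually.of_forall fun x => ?_)
    have hx := sphere_sum_sq x i
    have e3 : (x : E3) (i + 2) • crossVec (i + 1) x - (x : E3) (i + 1) • crossVec (i + 2) x =
        EuclideanSpace.single i (1 : ℝ) - (x : E3) i • (x : E3) := by
      have e0 : i + 1 + 1 = i + 2 := by fin_cases i <;> rfl
      have e1 : i + 1 + 2 = i := by fin_cases i <;> rfl
      have e2 : i + 2 + 1 = i := by fin_cases i <;> rfl
      have e3 : i + 2 + 2 = i + 1 := by fin_cases i <;> rfl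
      have hne := cyc_ne i
      apply ext_cyclic i <;> simp [crossVec, e0, e1, e2, e3, hne] <;>
        first | linear_combination hx | ring
    have e4 : crossVec (i + 1) (x : E3) (i + 2) = -(x : E3) i := by
      have := crossVec_apply_one (i + 1) (x : E3)
      have e0 : i + 1 + 1 = i + 2 := by fin_cases i <;> rfl
      have e1 : i + 1 + 2 = i := by fin_cases i <;> rfl
      rwa [e0, e1] at this
    have e5 : crossVec (i + 2) (x : E3) (i + 1) = (x : E3) i := by
      have := crossVec_apply_two (i + 2) (x : E3)
      have e2 : i + 2 + 1 = i := by fin_cases i <;> rfl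
      have e3 : i + 2 + 2 = i + 1 := by fin_cases i <;> rfl
      rwa [e2, e3] at this
    have e6 : tangentialDeriv i φ x = (x : E3) (i + 2) * angDeriv (i + 1) φ x -
        (x : E3) (i + 1) * angDeriv (i + 2) φ x := by
      unfold tangentialDeriv angDeriv
      rw [← e3, map_sub, map_smul, map_smul]; rfl
    simp only [e4, e5, e6]
    ring
  rw [hl, hr, e1, e2]
  simp only [mul_assoc]
  ring

/-- The weak form of `L = x × D`. -/
lemma HasAngDeriv.of_isWeakDeriv {f : S2 → ℝ} {g : Fin 3 → S2 → ℝ} (h : ∀ i, IsWeakDeriv i f (g i))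
    (a : Fin 3) : HasAngDeriv a f
      (fun x => g (a + 2) x * (x : E3) (a + 1) - g (a + 1) x * (x : E3) (a + 2)) := by
  have i1 (a : Fin 3) {φ : E3 → ℝ} (hφ : ContDiff ℝ ∞ φ) := integrable_mul_smooth (h a).2.1 hφ
  have i0 {φ : E3 → ℝ} (hφ : ContDiff ℝ ∞ φ) := integrable_mul_smooth (h 0).1 hφ
  have c (j : Fin 3) := contDiff_coord j
  refine ⟨(h 0).1, (i1 (a + 2) (c (a + 1))).sub (i1 (a + 1) (c (a + 2))), fun φ hφ => ?_⟩
  -- on the sphere, tangential derivatives are combinations of angular derivatives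
  have tan (i : Fin 3) (ψ : E3 → ℝ) (x : S2) : tangentialDeriv i ψ x =
      fderiv ℝ ψ x (basisVec i - (x : E3) i • (x : E3)) := rfl
  have tmul (i j : Fin 3) (x : S2) : tangentialDeriv i (fun y => y j * φ y) x =
      (x : E3) j * tangentialDeriv i φ x +
        (basisVec i j - (x : E3) i * (x : E3) j) * φ x := by
    rw [tan, fderiv_fun_mul ((c j).diffAt _) (hφ.diffAt _)]
    simp only [add_apply, smul_apply, fderiv_coord,
      smul_eq_mul, tan]
    simp only [PiLp.sub_apply, PiLp.smul_apply, smul_eq_mul]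
    ring
  have hx2 (i j : Fin 3) (hij : i ≠ j) : ∫ x : S2, g i x * ((x : E3) j * φ x) ∂area =
      -∫ x : S2, f x * ((x : E3) j * tangentialDeriv i φ x - 3 * ((x : E3) i * (x : E3) j * φ x))
        ∂area := by
    have := (h i).2.2 _ ((c j).mul hφ)
    rw [this]
    have ct : ContDiff ℝ ∞ (fun x : E3 => fderiv ℝ φ x (basisVec i - x i • x)) :=
      (hφ.fderiv_right (m := ∞) (by simp)).clm_apply
        (contDiff_const.sub ((c i).smul contDiff_id))
    have j1 : Integrable (fun x : S2 => f x * ((x : E3) j * tangentialDeriv i φ x)) area :=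
      i0 ((c j).mul ct)
    have j2 := i0 (((c i).mul (c j)).mul hφ)
    have hb : basisVec i j = 0 := by simp [hij]
    simp only [tmul, hb]
    have e1 : ∫ x : S2, f x * ((x : E3) j * tangentialDeriv i φ x +
        (0 - (x : E3) i * (x : E3) j) * φ x) ∂area =
        (∫ x : S2, f x * ((x : E3) j * tangentialDeriv i φ x) ∂area) -
          ∫ x : S2, f x * ((x : E3) i * (x : E3) j * φ x) ∂area := by
      rw [← integral_sub j1 j2]
      exact integral_congr_ae (Filter.Eventually.of_forall fun x => by simp only; ring)
    have e2 : ∫ x : S2, f x * ((x : E3) j * tangentialDeriv i φ x -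
        3 * ((x : E3) i * (x : E3) j * φ x)) ∂area =
        (∫ x : S2, f x * ((x : E3) j * tangentialDeriv i φ x) ∂area) -
          3 * ∫ x : S2, f x * ((x : E3) i * (x : E3) j * φ x) ∂area := by
      rw [← integral_const_mul, ← integral_sub j1 (j2.const_mul 3)]
      exact integral_congr_ae (Filter.Eventually.of_forall fun x => by simp only; ring)
    have e3 : ∫ x : S2, f x * ((x : E3) j * φ x) * (x : E3) i ∂area =
        ∫ x : S2, f x * ((x : E3) i * (x : E3) j * φ x) ∂area :=
      integral_congr_ae (Filter.Eventually.of_forall fun x => by simp only; ring)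
    rw [e1, e2, e3]
    ring
  have hne := cyc_ne a
  have hl : ∫ x : S2, (g (a + 2) x * (x : E3) (a + 1) - g (a + 1) x * (x : E3) (a + 2)) * φ x ∂area =
      (∫ x : S2, g (a + 2) x * ((x : E3) (a + 1) * φ x) ∂area) -
        ∫ x : S2, g (a + 1) x * ((x : E3) (a + 2) * φ x) ∂area := by
    simp only [sub_mul, mul_assoc]
    exact integral_sub (i1 _ ((c _).mul hφ)) (i1 _ ((c _).mul hφ))
  rw [hl, hx2 _ _ hne.2.2.2.2.2, hx2 _ _ hne.2.2.1]
  have ct (i : Fin 3) : ContDiff ℝ ∞ (fun x : E3 => fderiv ℝ φ x (basisVec i - x i • x)) :=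
    (hφ.fderiv_right (m := ∞) (by simp)).clm_apply (contDiff_const.sub ((c i).smul contDiff_id))
  have k (i j : Fin 3) : Integrable (fun x : S2 => f x * ((x : E3) j * tangentialDeriv i φ x -
      3 * ((x : E3) i * (x : E3) j * φ x))) area :=
    i0 (((c j).mul (ct i)).sub (contDiff_const.mul (((c i).mul (c j)).mul hφ)))
  have hneg (p q : ℝ) : -p - -q = -(p - q) := by ring
  rw [hneg, ← integral_sub (k _ _) (k _ _)]
  congr 1
  refine integral_congr_ae (Filter.Eventually.of_forall fun x => ?_)
  have e6 : angDeriv a φ x = (x : E3) (a + 1) * tangentialDeriv (a + 2) φ x -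
      (x : E3) (a + 2) * tangentialDeriv (a + 1) φ x := by
    simp only [tan, angDeriv]
    rw [← smul_eq_mul, ← smul_eq_mul, ← map_smul, ← map_smul, ← map_sub]
    congr 1
    unfold crossVec
    simp only [smul_sub, smul_smul, mul_comm ((x : E3) (a + 1))]
    abel
  simp only [e6]
  ring

lemma HasW1.of_isWeakDeriv {f : S2 → ℝ} {g : Fin 3 → S2 → ℝ} (hf : MemLp f 2 area)
    (h : ∀ i, IsWeakDeriv i f (g i)) (hg : ∀ i, MemLp (g i) 2 area) :
    HasW1 f (fun a x => g (a + 2) x * (x : E3) (a + 1) - g (a + 1) x * (x : E3) (a + 2)) :=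
  ⟨hf, fun _ => memLp_sub ((TendstoL2.const (hg _)).mul_smooth (contDiff_coord _)).memLp
    ((TendstoL2.const (hg _)).mul_smooth (contDiff_coord _)).memLp,
    fun a => HasAngDeriv.of_isWeakDeriv h a⟩

lemma HasW1.sub {f f' : S2 → ℝ} {F F' : Fin 3 → S2 → ℝ} (h : HasW1 f F) (h' : HasW1 f' F') :
    HasW1 (fun x => f x - f' x) (fun a x => F a x - F' a x) := by
  simpa [sub_eq_add_neg] using h.add (h'.const_mul (-1))

lemma MemW12.exists_hasW1 {f : S2 → ℝ} (h : MemW12 f) : ∃ F, HasW1 f F := by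
  choose g hg hg' using h.2
  exact ⟨_, HasW1.of_isWeakDeriv h.1 hg hg'⟩

lemma MemW22.exists_hasW2 {f : S2 → ℝ} (h : MemW22 f) : ∃ F H, HasW2 f F H := by
  choose g hg hg' using h.2
  choose K hK using fun i => (hg' i).exists_hasW1
  exact ⟨_, _, HasW1.of_isWeakDeriv h.1 hg fun i => (hg' i).1, fun a =>
    ((hK (a + 2)).mul_smooth (contDiff_coord (a + 1))).sub
      ((hK (a + 1)).mul_smooth (contDiff_coord (a + 2)))⟩

lemma HasW1.memW12 {f : S2 → ℝ} {F : Fin 3 → S2 → ℝ} (h : HasW1 f F) : MemW12 f :=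
  ⟨h.memLp, fun i => ⟨_, h.isWeakDeriv i,
    memLp_sub ((TendstoL2.const (h.memLp_deriv _)).mul_smooth (contDiff_coord _)).memLp
      ((TendstoL2.const (h.memLp_deriv _)).mul_smooth (contDiff_coord _)).memLp⟩⟩

/-- The first derivatives of the tangential derivative `Dᵢf = -(x × Lf)ᵢ`. -/
lemma HasW2.hasW1_tangential {f : S2 → ℝ} {F : Fin 3 → S2 → ℝ} {H : Fin 3 → Fin 3 → S2 → ℝ}
    (h : HasW2 f F H) (i : Fin 3) :
    HasW1 (fun x => F (i + 1) x * (x : E3) (i + 2) - F (i + 2) x * (x : E3) (i + 1))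
      (fun b x => (F (i + 1) x * crossVec b x (i + 2) + H (i + 1) b x * (x : E3) (i + 2)) -
        (F (i + 2) x * crossVec b x (i + 1) + H (i + 2) b x * (x : E3) (i + 1))) := by
  have := ((h.snd (i + 1)).mul_smooth (contDiff_coord (i + 2))).sub
      ((h.snd (i + 2)).mul_smooth (contDiff_coord (i + 1)))
  simpa only [angDeriv_coord] using this

lemma HasW2.memW22 {f : S2 → ℝ} {F : Fin 3 → S2 → ℝ} {H : Fin 3 → Fin 3 → S2 → ℝ}
    (h : HasW2 f F H) : MemW22 f :=
  ⟨h.fst.memLp, fun i => ⟨_, h.fst.isWeakDeriv i, (h.hasW1_tangential i).memW12⟩⟩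

/-- The vectors `Df` and `Lf` have the same length, because `Df = -x × Lf` and `Lf` is perpendicular to
the unit vector `x`. -/
lemma HasW1.sum_weakDeriv_sq {f : S2 → ℝ} {F : Fin 3 → S2 → ℝ} (h : HasW1 f F) :
    ∀ᵐ x ∂area, ∑ i, weakDeriv i f x ^ 2 = ∑ a, F a x ^ 2 := by
  have hw := ae_all_iff.2 fun i => (h.isWeakDeriv i).weakDeriv_ae
  filter_upwards [h.sum_coord_mul_deriv, hw] with x hx hw
  have hs := sphere_sum_sq x 0
  simp only [hw, Fin.sum_univ_three] at hx ⊢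
  simp only [zero_add, show (1 : Fin 3) + 1 = 2 from rfl, show (1 : Fin 3) + 2 = 0 from rfl,
    show (2 : Fin 3) + 1 = 0 from rfl, show (2 : Fin 3) + 2 = 1 from rfl] at hs ⊢
  linear_combination (F 0 x ^ 2 + F 1 x ^ 2 + F 2 x ^ 2) * hs -
    ((x : E3) 0 * F 0 x + (x : E3) 1 * F 1 x + (x : E3) 2 * F 2 x) * hx

/-- The operators `∑ᵢ DᵢDᵢ` and `∑ₐ LₐLₐ` agree. -/
lemma HasW2.laplacian_ae {f : S2 → ℝ} {F : Fin 3 → S2 → ℝ} {H : Fin 3 → Fin 3 → S2 → ℝ}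
    (h : HasW2 f F H) : laplacian f =ᵐ[area] trace2 H := by
  have h1 (i : Fin 3) := ((h.hasW1_tangential i).isWeakDeriv i).congr_left
    (h.fst.isWeakDeriv i).weakDeriv_ae.symm
  have hw := ae_all_iff.2 fun i => (h1 i).weakDeriv_ae
  have hr := ae_all_iff.2 fun a => (h.snd a).sum_coord_mul_deriv
  filter_upwards [hr, hw] with x hr hw
  have hs := sphere_sum_sq x 0
  have hr0 := hr 0
  have hr1 := hr 1
  have hr2 := hr 2
  simp only [laplacian, trace2, hw, Fin.sum_univ_three] at hr0 hr1 hr2 ⊢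
  have c00 := crossVec_apply_self 0 (x : E3)
  have c01 := crossVec_apply_one 0 (x : E3)
  have c02 := crossVec_apply_two 0 (x : E3)
  have c11 := crossVec_apply_self 1 (x : E3)
  have c12 := crossVec_apply_one 1 (x : E3)
  have c10 := crossVec_apply_two 1 (x : E3)
  have c22 := crossVec_apply_self 2 (x : E3)
  have c20 := crossVec_apply_one 2 (x : E3)
  have c21 := crossVec_apply_two 2 (x : E3)
  simp only [zero_add, show (1 : Fin 3) + 1 = 2 from rfl, show (1 : Fin 3) + 2 = 0 from rfl,
    show (2 : Fin 3) + 1 = 0 from rfl, show (2 : Fin 3) + 2 = 1 from rfl] at *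
  simp only [c00, c01, c02, c10, c11, c12, c20, c21, c22]
  linear_combination (H 0 0 x + H 1 1 x + H 2 2 x) * hs - (x : E3) 0 * hr0 -
    (x : E3) 1 * hr1 - (x : E3) 2 * hr2

/-- The energy in terms of angular derivatives. -/
lemma energy_eq (ε : ℝ) {v : S2 → E3} {F : Fin 3 → Fin 3 → S2 → ℝ}
    {H : Fin 3 → Fin 3 → Fin 3 → S2 → ℝ} (h : ∀ k, HasW2 (fun x => v x k) (F k) (H k)) :
    energy ε v = 1 / 2 * ∑ k, (∑ a, ∫ x, F k a x ^ 2 ∂area + ε * ∫ x, trace2 (H k) x ^ 2 ∂area) := by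
  have i1 (k a : Fin 3) := ((h k).fst.memLp_deriv a).integrable_sq
  have i2 (k : Fin 3) := (h k).memLp_trace2.integrable_sq
  have i3 (k : Fin 3) : Integrable (fun x => ∑ a, F k a x ^ 2) area :=
    integrable_finsetSum _ fun a _ => i1 k a
  have e (k : Fin 3) : ∑ a, ∫ x, F k a x ^ 2 ∂area + ε * ∫ x, trace2 (H k) x ^ 2 ∂area =
      ∫ x, (∑ a, F k a x ^ 2 + ε * trace2 (H k) x ^ 2) ∂area := by
    rw [integral_add (i3 k) ((i2 k).const_mul ε), integral_const_mul,
      integral_finsetSum _ fun a _ => i1 k a]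
  unfold energy
  congr 1
  have i4 (k : Fin 3) : Integrable (fun x => ∑ a, F k a x ^ 2 + ε * trace2 (H k) x ^ 2) area :=
    (i3 k).add ((i2 k).const_mul ε)
  rw [Finset.sum_congr rfl fun k _ => e k, ← integral_finsetSum _ fun k _ => i4 k]
  have hg := ae_all_iff.2 fun k => (h k).fst.sum_weakDeriv_sq
  have hl := ae_all_iff.2 fun k => (h k).laplacian_ae
  refine integral_congr_ae ?_
  filter_upwards [hg, hl] with x hg hl
  simp only [gradSq, laplacianSq, hg, hl, Finset.sum_add_distrib, Finset.mul_sum]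

/-! ### The first variation -/

lemma l2_le_of_ae_le {f g : S2 → ℝ} (hf : AEStronglyMeasurable f area) (hg : MemLp g 2 area)
    {c : ℝ} (hc : 0 ≤ c) (h : ∀ᵐ x ∂area, |f x| ≤ c * |g x|) : l2 f ≤ c * l2 g := by
  have hm : MemLp f 2 area := by
    refine (hg.const_mul c).mono hf (h.mono fun x hx => ?_)
    rw [Real.norm_eq_abs, Real.norm_eq_abs, abs_mul, abs_of_nonneg hc]
    exact hx
  refine l2_le_of_sq_le hm (mul_nonneg hc lpNorm_nonneg) ?_
  rw [mul_pow, l2_sq hg, ← integral_const_mul]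
  refine integral_mono_ae hm.integrable_sq (hg.integrable_sq.const_mul _) (h.mono fun x hx => ?_)
  simp only
  rw [← mul_pow]
  refine sq_le_sq.2 (hx.trans (le_of_eq ?_))
  rw [abs_mul, abs_of_nonneg hc]

/-- The derivative at `0` of the squared norm of `A + t B + R t` ignores a remainder of second order. -/
lemma hasDerivAt_integral_sq {A B : S2 → ℝ} {R : ℝ → S2 → ℝ} (hA : MemLp A 2 area)
    (hB : MemLp B 2 area) (hR : ∀ t, MemLp (R t) 2 area) {C : ℝ}
    (hC : ∀ t, |t| ≤ 1 → l2 (R t) ≤ C * t ^ 2) :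
    HasDerivAt (fun t => ∫ x, (A x + t * B x + R t x) ^ 2 ∂area) (2 * ∫ x, A x * B x ∂area) 0 := by
  have hdef (t : ℝ) : (∫ x, (A x + t * B x + R t x) ^ 2 ∂area) =
      (l2 A ^ 2 + t * (2 * ∫ x, A x * B x ∂area)) + (t ^ 2 * l2 B ^ 2 + (l2 (R t) ^ 2 +
        (2 * ∫ x, A x * R t x ∂area) + (2 * t) * ∫ x, B x * R t x ∂area)) := by
    have iAB := integrable_mul_of_memLp hA hB
    have iAR := integrable_mul_of_memLp hA (hR t)
    have iBR := integrable_mul_of_memLp hB (hR t)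
    have iA := hA.integrable_sq
    have iB := hB.integrable_sq
    have iR := (hR t).integrable_sq
    rw [l2_sq hA, l2_sq hB, l2_sq (hR t), ← integral_const_mul, ← integral_const_mul,
      ← integral_const_mul, ← integral_const_mul, ← integral_const_mul]
    have j1 := iA.add ((iAB.const_mul 2).const_mul t)
    have j3 := iR.add (iAR.const_mul 2)
    have j4 := j3.add (iBR.const_mul (2 * t))
    have j2 := (iB.const_mul (t ^ 2)).add j4
    have e1 := integral_add iA ((iAB.const_mul 2).const_mul t)
    have e3 := integral_add iR (iAR.const_mul 2)
    have e4 := integral_add j3 (iBR.const_mul (2 * t))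
    have e2 := integral_add (iB.const_mul (t ^ 2)) j4
    have e5 := integral_add j1 j2
    simp only [Pi.add_apply] at e1 e2 e3 e4 e5
    rw [← e1, ← e3, ← e4, ← e2, ← e5]
    refine integral_congr_ae (Filter.Eventually.of_forall fun x => ?_)
    simp only
    ring
  have hbig : (fun t => t ^ 2 * l2 B ^ 2 + (l2 (R t) ^ 2 +
        (2 * ∫ x, A x * R t x ∂area) + (2 * t) * ∫ x, B x * R t x ∂area))
      =O[nhds 0] fun t : ℝ => ‖t - 0‖ ^ 2 := by
    refine Asymptotics.IsBigO.of_bound (l2 B ^ 2 + C ^ 2 + 2 * (l2 A * C) + 2 * (l2 B * C)) ?_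
    filter_upwards [Metric.closedBall_mem_nhds (0 : ℝ) one_pos] with t ht
    have ht1 : |t| ≤ 1 := by simpa using ht
    have hr := hC t ht1
    have hr0 : 0 ≤ l2 (R t) := lpNorm_nonneg
    have a1 := abs_integral_mul_le hA (hR t)
    have a2 := abs_integral_mul_le hB (hR t)
    have hA0 : 0 ≤ l2 A := lpNorm_nonneg
    have hB0 : 0 ≤ l2 B := lpNorm_nonneg
    have b1 := mul_le_mul_of_nonneg_left hr hA0
    have b2 := mul_le_mul_of_nonneg_left hr hB0
    have ht2 : t ^ 2 ≤ 1 := by rw [← sq_abs]; exact pow_le_one₀ (abs_nonneg _) ht1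
    have b3 : l2 (R t) ^ 2 ≤ C ^ 2 * t ^ 2 := by
      have := pow_le_pow_left₀ hr0 hr 2
      have h4 : (C * t ^ 2) ^ 2 = C ^ 2 * t ^ 2 * t ^ 2 := by ring
      have h5 : C ^ 2 * t ^ 2 * t ^ 2 ≤ C ^ 2 * t ^ 2 * 1 :=
        mul_le_mul_of_nonneg_left ht2 (by positivity)
      linarith
    have b4 : |t * ∫ x, B x * R t x ∂area| ≤ l2 B * (C * t ^ 2) := by
      rw [abs_mul]
      have := mul_le_mul ht1 (a2.trans b2) (abs_nonneg _) zero_le_one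
      linarith
    rw [sub_zero, norm_pow, norm_norm, Real.norm_eq_abs, Real.norm_eq_abs, sq_abs]
    have c1 := abs_le.1 (a1.trans b1)
    have c2 := abs_le.1 b4
    have p1 : 0 ≤ t ^ 2 * l2 B ^ 2 := by positivity
    have p2 : 0 ≤ l2 (R t) ^ 2 := by positivity
    have p3 : 0 ≤ C ^ 2 * t ^ 2 := by positivity
    rw [abs_le]
    constructor <;> nlinarith
  have h1 := hbig.hasFDerivAt (𝕜 := ℝ) one_lt_two
  have h2 : HasDerivAt (fun t => t ^ 2 * l2 B ^ 2 + (l2 (R t) ^ 2 +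
        (2 * ∫ x, A x * R t x ∂area) + (2 * t) * ∫ x, B x * R t x ∂area)) 0 0 := by
    simpa using h1.hasDerivAt
  have h3 := (((hasDerivAt_id (0 : ℝ)).mul_const (2 * ∫ x, A x * B x ∂area)).const_add
    (l2 A ^ 2)).add h2
  simp only [one_mul, add_zero] at h3
  refine h3.congr_of_eventuallyEq (Filter.Eventually.of_forall fun t => ?_)
  exact hdef t

lemma HasW1.congr {f f' : S2 → ℝ} {F F' : Fin 3 → S2 → ℝ} (h : HasW1 f F)
    (hf : ∀ x, f x = f' x) (hF : ∀ a x, F a x = F' a x) : HasW1 f' F' := by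
  obtain rfl : f = f' := funext hf
  obtain rfl : F = F' := funext fun a => funext (hF a)
  exact h

/-- The chain rule for `(1 + f)^{-1/2}` on `W^{2,2}`; the products of first derivatives are square
integrable by Ladyzhenskaya's inequality. -/
lemma HasW2.nrmFactor_comp {f : S2 → ℝ} {F : Fin 3 → S2 → ℝ} {H : Fin 3 → Fin 3 → S2 → ℝ}
    (h : HasW2 f F H) (h0 : ∀ x, 0 ≤ f x) :
    HasW2 (fun x => nrmFactor (f x)) (fun a x => -(1 / 2) * (nrmFactor (f x) ^ 3 * F a x))
      (fun a b x => -(1 / 2) * (nrmFactor (f x) ^ 3 * H a b x -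
        3 / 2 * (nrmFactor (f x) ^ 5 * (F a x * F b x)))) := by
  have h1 := h.fst.nrmFactor_comp h0
  have mt := memLp_nrmFactor h.fst.memLp.1 h0 ⊤
  have hm : Measurable nrmFactor := by unfold nrmFactor; fun_prop
  have mpow (n : ℕ) : MemLp (fun x => nrmFactor (f x) ^ n) ⊤ area := by
    refine memLp_top_of_bound ((hm.comp_aemeasurable
      h.fst.memLp.1.aemeasurable).pow_const n).aestronglyMeasurable 1
      (Filter.Eventually.of_forall fun x => ?_)
    have h1 := nrmFactor_pos (h0 x)
    rw [Real.norm_of_nonneg (by positivity)]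
    exact pow_le_one₀ h1.le (nrmFactor_le_one (h0 x))
  have h3 : HasW1 (fun x => nrmFactor (f x) ^ 3)
      (fun a x => -(3 / 2) * (nrmFactor (f x) ^ 5 * F a x)) := by
    refine HasW1.congr ((h1.mul_top h1 mt mt).mul_top h1 ?_ mt) (fun x => by ring)
      fun a x => by ring
    simpa only [pow_two] using mpow 2
  refine ⟨h1, fun a => (HasW1.congr (h3.mul (h.snd a) ?_ fun b => ?_)
    (fun x => rfl) (F' := fun b x => nrmFactor (f x) ^ 3 * H a b x -
        3 / 2 * (nrmFactor (f x) ^ 5 * (F a x * F b x))) fun b x => by ring).const_mul _⟩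
  · exact memLp_mul_top (mpow 3) (h.snd a).memLp
  · refine (memLp_mul_top (mpow 3) ((h.snd a).memLp_deriv b)).add ?_
    have := (memLp_mul_top (mpow 5)
      (memLp_mul_four (h.snd b).memLp_four (h.snd a).memLp_four)).const_mul (-(3 / 2))
    simpa only [mul_assoc] using this

lemma HasW2.one : HasW2 (fun _ => 1) (fun _ _ => 0) (fun _ _ _ => 0) := by
  have h (c : ℝ) : HasW1 (fun _ => c) (fun _ _ => 0) := by
    have := ContDiff.hasW1 (contDiff_const (c := c) (E := E3) (𝕜 := ℝ) (n := ∞))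
    simpa [angDeriv] using this
  exact ⟨h 1, fun _ => h 0⟩

lemma HasW2.sub {f f' : S2 → ℝ} {F F' : Fin 3 → S2 → ℝ} {H H' : Fin 3 → Fin 3 → S2 → ℝ}
    (h : HasW2 f F H) (h' : HasW2 f' F' H') :
    HasW2 (fun x => f x - f' x) (fun a x => F a x - F' a x) (fun a b x => H a b x - H' a b x) :=
  ⟨h.fst.sub h'.fst, fun a => (h.snd a).sub (h'.snd a)⟩

lemma HasW2.sum {ι : Type*} (s : Finset ι) {f : ι → S2 → ℝ} {F : ι → Fin 3 → S2 → ℝ}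
    {H : ι → Fin 3 → Fin 3 → S2 → ℝ} (h : ∀ i, HasW2 (f i) (F i) (H i)) :
    HasW2 (fun x => ∑ i ∈ s, f i x) (fun a x => ∑ i ∈ s, F i a x)
      (fun a b x => ∑ i ∈ s, H i a b x) :=
  ⟨HasW1.sum s fun i => (h i).fst, fun a => HasW1.sum s fun i => (h i).snd a⟩

lemma HasW2.exists_bound {f : S2 → ℝ} {F : Fin 3 → S2 → ℝ} {H : Fin 3 → Fin 3 → S2 → ℝ}
    (h : HasW2 f F H) : ∃ B, 0 ≤ B ∧ ∀ᵐ x ∂area, |f x| ≤ B :=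
  ⟨Real.sqrt (64 * (l2 f ^ 2 + ∑ a, l2 (F a) ^ 2 + ∑ a, ∑ b, l2 f * l2 (H a b))),
    Real.sqrt_nonneg _, h.sup_sq_le.mono fun _ hx => Real.abs_le_sqrt hx⟩

/-- Normalizing `f + t g` by the factor `(1 + t² p)^{-1/2}` changes it by a function whose size in
`W^{2,2}` is of second order in `t`. -/
lemma HasW2.normalization_remainder {f g p : S2 → ℝ} {F G P : Fin 3 → S2 → ℝ}
    {H K Q : Fin 3 → Fin 3 → S2 → ℝ} (hf : HasW2 f F H) (hg : HasW2 g G K) (hp : HasW2 p P Q)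
    (h0 : ∀ x, 0 ≤ p x) : ∃ C : ℝ, ∀ t : ℝ, ∃ R S,
      HasW2 (fun x => (f x + t * g x) * (nrmFactor (t ^ 2 * p x) - 1)) R S ∧
        (|t| ≤ 1 → (∀ a, l2 (R a) ≤ C * t ^ 2) ∧ l2 (trace2 S) ≤ C * t ^ 2) := by
  obtain ⟨Bf, hBf0, hBf⟩ := hf.exists_bound
  obtain ⟨Bg, hBg0, hBg⟩ := hg.exists_bound
  obtain ⟨Bp, hBp0, hBp⟩ := hp.exists_bound
  -- pointwise majorants of the derivatives of the remainder divided by `t²`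
  set D1 : Fin 3 → S2 → ℝ := fun a x =>
    (Bf + Bg) * |P a x| + Bp * (|F a x| + |G a x|) with hD1
  set D2 : S2 → ℝ := fun x => ∑ a, ((Bf + Bg) * (|Q a a x| + |P a x| * |P a x|) +
    2 * ((|F a x| + |G a x|) * |P a x|) + Bp * (|H a a x| + |K a a x|)) with hD2
  have mD1 (a : Fin 3) : MemLp (D1 a) 2 area :=
    ((hp.fst.memLp_deriv a).abs.const_mul _).add
      (((hf.fst.memLp_deriv a).abs.add (hg.fst.memLp_deriv a).abs).const_mul Bp)
  have mD2 : MemLp D2 2 area := by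
    refine memLp_finsetSum _ fun a _ => ?_
    have e1 : MemLp (fun x => |Q a a x| + |P a x| * |P a x|) 2 area :=
      ((hp.snd a).memLp_deriv a).abs.add
        (memLp_mul_four (hp.snd a).memLp_four.abs (hp.snd a).memLp_four.abs)
    have e2 : MemLp (fun x => (|F a x| + |G a x|) * |P a x|) 2 area :=
      memLp_mul_four ((hf.snd a).memLp_four.abs.add (hg.snd a).memLp_four.abs)
        (hp.snd a).memLp_four.abs
    have e3 : MemLp (fun x => |H a a x| + |K a a x|) 2 area :=
      ((hf.snd a).memLp_deriv a).abs.add ((hg.snd a).memLp_deriv a).abs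
    exact ((e1.const_mul (Bf + Bg)).add (e2.const_mul 2)).add (e3.const_mul Bp)
  refine ⟨∑ a, l2 (D1 a) + l2 D2, fun t => ?_⟩
  have hn := ((hp.const_mul (t ^ 2)).nrmFactor_comp fun x => mul_nonneg (sq_nonneg t) (h0 x)).sub
    HasW2.one
  have hw := (hf.add (hg.const_mul t)).mul hn
  refine ⟨_, _, hw, fun ht => ?_⟩
  have hl (a : Fin 3) : 0 ≤ l2 (D1 a) := lpNorm_nonneg
  have hl2 : 0 ≤ l2 D2 := lpNorm_nonneg
  have ht2 : t ^ 2 ≤ 1 := by rw [← sq_abs]; exact pow_le_one₀ (abs_nonneg _) ht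
  -- pointwise bounds on the factors
  have fac {y z : ℝ} : |y + t * z| ≤ |y| + |z| := by
    refine (abs_add_le _ _).trans (add_le_add le_rfl ?_)
    rw [abs_mul]
    exact mul_le_of_le_one_left (abs_nonneg _) ht
  have nb (x : S2) (n : ℕ) : |nrmFactor (t ^ 2 * p x) ^ n| ≤ 1 := by
    have h1 := mul_nonneg (sq_nonneg t) (h0 x)
    have h2 := nrmFactor_pos h1
    rw [abs_of_nonneg (by positivity)]
    exact pow_le_one₀ h2.le (nrmFactor_le_one h1)
  have n0 (x : S2) (hx : |p x| ≤ Bp) : |nrmFactor (t ^ 2 * p x) - 1| ≤ t ^ 2 * Bp := by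
    have h1 := abs_nrmFactor_sub_le (mul_nonneg (sq_nonneg t) (h0 x)) le_rfl
    have h2 : nrmFactor 0 = 1 := by simp [nrmFactor]
    rw [h2, sub_zero, abs_mul, abs_of_nonneg (sq_nonneg t)] at h1
    exact h1.trans (mul_le_mul_of_nonneg_left hx (sq_nonneg t))
  have n1 (x : S2) (a : Fin 3) : |-(1 / 2) * (nrmFactor (t ^ 2 * p x) ^ 3 * (t ^ 2 * P a x)) - 0| ≤
      t ^ 2 * |P a x| := by
    rw [sub_zero, abs_mul, abs_mul, abs_mul, abs_neg, abs_of_nonneg (sq_nonneg t),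
      abs_of_nonneg (by norm_num : (0 : ℝ) ≤ 1 / 2)]
    have := mul_le_mul_of_nonneg_right (nb x 3) (by positivity : 0 ≤ t ^ 2 * |P a x|)
    have h2 : 0 ≤ t ^ 2 * |P a x| := by positivity
    linarith
  have n2 (x : S2) (a : Fin 3) : |-(1 / 2) * (nrmFactor (t ^ 2 * p x) ^ 3 * (t ^ 2 * Q a a x) -
        3 / 2 * (nrmFactor (t ^ 2 * p x) ^ 5 * ((t ^ 2 * P a x) * (t ^ 2 * P a x)))) - 0| ≤
      t ^ 2 * (|Q a a x| + |P a x| * |P a x|) := by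
    rw [sub_zero, abs_mul, abs_neg, abs_of_nonneg (by norm_num : (0 : ℝ) ≤ 1 / 2)]
    have h1 := abs_sub (nrmFactor (t ^ 2 * p x) ^ 3 * (t ^ 2 * Q a a x))
      (3 / 2 * (nrmFactor (t ^ 2 * p x) ^ 5 * ((t ^ 2 * P a x) * (t ^ 2 * P a x))))
    simp only [abs_mul (nrmFactor _ ^ _), abs_mul (3 / 2 : ℝ), abs_mul (t ^ 2),
      abs_mul (t ^ 2 * _) (t ^ 2 * _),
      abs_of_nonneg (sq_nonneg t), abs_of_nonneg (by norm_num : (0 : ℝ) ≤ 3 / 2)] at h1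
    have q1 : 0 ≤ t ^ 2 * |Q a a x| := by positivity
    have q2 : 0 ≤ (t ^ 2 * |P a x|) * (t ^ 2 * |P a x|) := by positivity
    have h2 := mul_le_mul_of_nonneg_right (nb x 3) q1
    have h3 := mul_le_mul_of_nonneg_right (nb x 5) q2
    have q3 : 0 ≤ t ^ 2 * (|P a x| * |P a x|) := by positivity
    have h4 : (t ^ 2 * |P a x|) * (t ^ 2 * |P a x|) ≤ t ^ 2 * (|P a x| * |P a x|) := by
      have := mul_le_mul_of_nonneg_right ht2 q3
      linarith
    linarith
  constructor
  · intro a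
    have hle : l2 (D1 a) ≤ ∑ a, l2 (D1 a) + l2 D2 := by
      have := Finset.single_le_sum (f := fun a => l2 (D1 a)) (fun a _ => hl a) (Finset.mem_univ a)
      linarith
    refine le_trans ?_ (mul_le_mul_of_nonneg_right hle (sq_nonneg t))
    rw [mul_comm]
    refine l2_le_of_ae_le (hw.fst.memLp_deriv a).1 (mD1 a) (sq_nonneg t) ?_
    filter_upwards [hBf, hBg, hBp] with x h1 h2 h3
    have b1 := (fac (y := f x) (z := g x)).trans (add_le_add h1 h2)
    have c1 := mul_le_mul b1 (n1 x a) (abs_nonneg _) (by positivity)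
    have c2 := mul_le_mul (fac (y := F a x) (z := G a x)) (n0 x h3) (abs_nonneg _) (by positivity)
    rw [← abs_mul] at c1 c2
    refine (abs_add_le _ _).trans ((add_le_add c1 c2).trans ?_)
    refine le_trans (le_of_eq ?_) (mul_le_mul_of_nonneg_left (le_abs_self (D1 a x)) (sq_nonneg t))
    simp only [hD1]
    ring
  · have hle : l2 D2 ≤ ∑ a, l2 (D1 a) + l2 D2 := by
      have := Finset.sum_nonneg (s := Finset.univ) fun a _ => hl a
      linarith
    refine le_trans ?_ (mul_le_mul_of_nonneg_right hle (sq_nonneg t))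
    rw [mul_comm]
    refine l2_le_of_ae_le hw.memLp_trace2.1 mD2 (sq_nonneg t) ?_
    filter_upwards [hBf, hBg, hBp] with x h1 h2 h3
    refine le_trans ?_ (mul_le_mul_of_nonneg_left (le_abs_self (D2 x)) (sq_nonneg t))
    unfold trace2
    refine (Finset.abs_sum_le_sum_abs _ _).trans ?_
    simp only [hD2, Finset.mul_sum]
    refine Finset.sum_le_sum fun a _ => ?_
    have b1 := (fac (y := f x) (z := g x)).trans (add_le_add h1 h2)
    have c1 := mul_le_mul b1 (n2 x a) (abs_nonneg _) (by positivity)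
    have c2 := mul_le_mul (fac (y := F a x) (z := G a x)) (n1 x a) (abs_nonneg _) (by positivity)
    have c3 := mul_le_mul (fac (y := H a a x) (z := K a a x)) (n0 x h3) (abs_nonneg _)
      (by positivity)
    rw [← abs_mul] at c1 c2 c3
    refine (abs_add_le _ _).trans ((add_le_add (abs_add_le _ _) (abs_add_le _ _)).trans ?_)
    refine (add_le_add (add_le_add c1 c2) (add_le_add c2 c3)).trans (le_of_eq ?_)
    ring

/-- For a tangential vector `z` at `y`, `|y + t z|² = 1 + t² |z|²`, so that the projection to the sphere
has no first-order effect. -/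
lemma proj_add_smul {y z : E3} (hy : ‖y‖ = 1) (hyz : ∑ k, y k * z k = 0) (t : ℝ) (k : Fin 3) :
    proj (y + t • z) k = (y k + t * z k) * nrmFactor (t ^ 2 * ∑ j, z j * z j) := by
  have hn : ‖y + t • z‖ = Real.sqrt (1 + t ^ 2 * ∑ j, z j * z j) := by
    rw [← Real.sqrt_sq (norm_nonneg (y + t • z))]
    congr 1
    have h1 : ‖y‖ ^ 2 = 1 := by rw [hy]; norm_num
    rw [EuclideanSpace.real_norm_sq_eq] at h1 ⊢
    simp only [Fin.sum_univ_three, PiLp.add_apply, PiLp.smul_apply, smul_eq_mul] at *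
    linear_combination h1 + 2 * t * hyz
  simp only [proj, hn, PiLp.smul_apply, PiLp.add_apply, smul_eq_mul, nrmFactor]
  ring

/-- The Euler–Lagrange equation, tested with a field `φ` which is tangential along `u`. -/
lemma IsCriticalPoint.first_variation {ε : ℝ} {u : S2 → S2} (hu : IsCriticalPoint ε u)
    {F : Fin 3 → Fin 3 → S2 → ℝ} {H : Fin 3 → Fin 3 → Fin 3 → S2 → ℝ}
    (h : ∀ k, HasW2 (fun x => (u x : E3) k) (F k) (H k)) {φ : Fin 3 → S2 → ℝ}
    {Φ : Fin 3 → Fin 3 → S2 → ℝ} {Ψ : Fin 3 → Fin 3 → Fin 3 → S2 → ℝ}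
    (hφ : ∀ k, HasW2 (φ k) (Φ k) (Ψ k)) (htan : ∀ x, ∑ k, (u x : E3) k * φ k x = 0) :
    ∑ k, (∑ a, ∫ x, F k a x * Φ k a x ∂area + ε * ∫ x, trace2 (H k) x * trace2 (Ψ k) x ∂area) =
      0 := by
  have hp := HasW2.sum Finset.univ fun k => (hφ k).mul (hφ k)
  have hp0 (x : S2) : 0 ≤ ∑ k, φ k x * φ k x := Finset.sum_nonneg fun k _ => mul_self_nonneg _
  choose C R S hRS hC using fun k => (h k).normalization_remainder (hφ k) hp hp0
  set φ' : S2 → E3 := fun x => WithLp.toLp 2 fun k => φ k x with hφ'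
  have hcrit := hu.2 φ' fun k => (hφ k).memW22
  have hnorm (x : S2) : ‖(u x : E3)‖ = 1 := norm_eq_of_mem_sphere (u x)
  have hw (t : ℝ) (k : Fin 3) : HasW2 (fun x => proj ((u x : E3) + t • φ' x) k)
      (fun a x => F k a x + t * Φ k a x + R k t a x)
      (fun a b x => H k a b x + t * Ψ k a b x + S k t a b x) := by
    have h1 := ((h k).add ((hφ k).const_mul t)).add (hRS k t)
    have e (x : S2) : proj ((u x : E3) + t • φ' x) k = (u x : E3) k + t * φ k x +
        ((u x : E3) k + t * φ k x) * (nrmFactor (t ^ 2 * ∑ j, φ j x * φ j x) - 1) := by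
      rw [proj_add_smul (hnorm x) (htan x)]
      simp only [hφ']
      ring
    simpa only [e] using h1
  have htr (t : ℝ) (k : Fin 3) (x : S2) :
      trace2 (fun a b x => H k a b x + t * Ψ k a b x + S k t a b x) x =
        trace2 (H k) x + t * trace2 (Ψ k) x + trace2 (S k t) x := by
    simp only [trace2, Finset.sum_add_distrib, Finset.mul_sum]
  have d1 (k a : Fin 3) := hasDerivAt_integral_sq ((h k).fst.memLp_deriv a)
    ((hφ k).fst.memLp_deriv a) (fun t => (hRS k t).fst.memLp_deriv a)
    fun t ht => (hC k t ht).1 a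
  have d2 (k : Fin 3) := hasDerivAt_integral_sq (h k).memLp_trace2
    (hφ k).memLp_trace2 (fun t => (hRS k t).memLp_trace2) fun t ht => (hC k t ht).2
  have d3 := (HasDerivAt.fun_sum (u := Finset.univ) fun k _ =>
    (HasDerivAt.fun_sum (u := Finset.univ) fun a _ => d1 k a).add ((d2 k).const_mul ε)).const_mul
      (1 / 2)
  have hE (t : ℝ) := energy_eq ε (hw t)
  simp only [htr] at hE
  have key := hcrit.unique (d3.congr_of_eventuallyEq (Filter.Eventually.of_forall hE))
  rw [key]
  simp only [Finset.mul_sum, mul_add]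
  refine Finset.sum_congr rfl fun k _ => ?_
  congr 1
  · exact Finset.sum_congr rfl fun a _ => by ring
  · ring

/-! ### The quadratic form of the energy -/

/-- The polarization of `f ↦ ∫ |∇f|² + ε |Δf|²`, as a function of the derivatives of the two
functions. -/
def energyForm (ε : ℝ) (F : Fin 3 → S2 → ℝ) (H : Fin 3 → Fin 3 → S2 → ℝ) (G : Fin 3 → S2 → ℝ)
    (K : Fin 3 → Fin 3 → S2 → ℝ) : ℝ :=
  ∑ a, ∫ x, F a x * G a x ∂area + ε * ∫ x, trace2 H x * trace2 K x ∂area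

lemma trace2_sub (H K : Fin 3 → Fin 3 → S2 → ℝ) (x : S2) :
    trace2 (fun a b x => H a b x - K a b x) x = trace2 H x - trace2 K x := by
  simp [trace2]

lemma trace2_add (H K : Fin 3 → Fin 3 → S2 → ℝ) (x : S2) :
    trace2 (fun a b x => H a b x + K a b x) x = trace2 H x + trace2 K x := by
  simp [trace2, Finset.sum_add_distrib]

lemma trace2_const_mul (c : ℝ) (H : Fin 3 → Fin 3 → S2 → ℝ) (x : S2) :
    trace2 (fun a b x => c * H a b x) x = c * trace2 H x := by
  simp only [trace2, Finset.mul_sum]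

section Form

variable {ε : ℝ} {f g k : S2 → ℝ} {F G L : Fin 3 → S2 → ℝ} {H K N : Fin 3 → Fin 3 → S2 → ℝ}

lemma energyForm_eq_integral (hf : HasW2 f F H) (hg : HasW2 g G K) : energyForm ε F H G K =
    ∫ x, (∑ a, F a x * G a x + ε * (trace2 H x * trace2 K x)) ∂area := by
  have i1 (a : Fin 3) := integrable_mul_of_memLp (hf.fst.memLp_deriv a) (hg.fst.memLp_deriv a)
  have i2 := integrable_mul_of_memLp hf.memLp_trace2 hg.memLp_trace2
  have i3 : Integrable (fun x => ∑ a, F a x * G a x) area :=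
    integrable_finsetSum _ fun a _ => i1 a
  rw [integral_add i3 (i2.const_mul ε), integral_const_mul,
    integral_finsetSum _ fun a _ => i1 a, energyForm]

lemma integrable_energyForm (ε : ℝ) (hf : HasW2 f F H) (hg : HasW2 g G K) :
    Integrable (fun x => ∑ a, F a x * G a x + ε * (trace2 H x * trace2 K x)) area := by
  have i1 (a : Fin 3) := integrable_mul_of_memLp (hf.fst.memLp_deriv a) (hg.fst.memLp_deriv a)
  exact (integrable_finsetSum _ fun a _ => i1 a).add
    ((integrable_mul_of_memLp hf.memLp_trace2 hg.memLp_trace2).const_mul ε)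

lemma energyForm_comm : energyForm ε F H G K = energyForm ε G K F H := by
  simp only [energyForm, mul_comm]

lemma energyForm_sub_right (hf : HasW2 f F H) (hg : HasW2 g G K) (hk : HasW2 k L N) :
    energyForm ε F H (fun a x => G a x - L a x) (fun a b x => K a b x - N a b x) =
      energyForm ε F H G K - energyForm ε F H L N := by
  rw [energyForm_eq_integral hf (hg.sub hk), energyForm_eq_integral hf hg,
    energyForm_eq_integral hf hk,
    ← integral_sub (integrable_energyForm ε hf hg) (integrable_energyForm ε hf hk)]
  refine integral_congr_ae (Filter.Eventually.of_forall fun x => ?_)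
  simp only [trace2_sub, mul_sub, Finset.sum_sub_distrib]
  ring

lemma energyForm_add_right (hf : HasW2 f F H) (hg : HasW2 g G K) (hk : HasW2 k L N) :
    energyForm ε F H (fun a x => G a x + L a x) (fun a b x => K a b x + N a b x) =
      energyForm ε F H G K + energyForm ε F H L N := by
  rw [energyForm_eq_integral hf (hg.add hk), energyForm_eq_integral hf hg,
    energyForm_eq_integral hf hk,
    ← integral_add (integrable_energyForm ε hf hg) (integrable_energyForm ε hf hk)]
  refine integral_congr_ae (Filter.Eventually.of_forall fun x => ?_)
  simp only [trace2_add, mul_add, Finset.sum_add_distrib]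
  ring

lemma energyForm_const_mul_right (c : ℝ) : energyForm ε F H (fun a x => c * G a x)
    (fun a b x => c * K a b x) = c * energyForm ε F H G K := by
  simp only [energyForm, trace2_const_mul, mul_left_comm _ c, integral_const_mul,
    ← Finset.mul_sum]
  ring

lemma HasW2.unique (hf : HasW2 f F H) (hg : HasW2 f G K) :
    ∀ᵐ x ∂area, (∀ a, F a x = G a x) ∧ ∀ a b, H a b x = K a b x := by
  have h1 (a : Fin 3) : F a =ᵐ[area] G a := (hf.fst.deriv a).unique (hg.fst.deriv a)
  have h2 (a b : Fin 3) : H a b =ᵐ[area] K a b :=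
    (((hf.snd a).deriv b).congr (h1 a) Filter.EventuallyEq.rfl).unique ((hg.snd a).deriv b)
  filter_upwards [ae_all_iff.2 h1, ae_all_iff.2 fun a => ae_all_iff.2 (h2 a)] with x e1 e2
  exact ⟨e1, e2⟩

/-- The form is invariant under rotations. -/
lemma energyForm_rot {f' g' : S2 → ℝ} {F' G' : Fin 3 → S2 → ℝ} {H' K' : Fin 3 → Fin 3 → S2 → ℝ}
    (hf : HasW2 f F H) (hg : HasW2 g G K) (hf' : HasW2 f' F' H') (hg' : HasW2 g' G' K')
    (a : Fin 3) (t : ℝ) (ef : ∀ x, f' x = f (srot a t x)) (eg : ∀ x, g' x = g (srot a t x)) :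
    energyForm ε F' H' G' K' = energyForm ε F H G K := by
  obtain rfl : f' = fun x => f (srot a t x) := funext ef
  obtain rfl : g' = fun x => g (srot a t x) := funext eg
  rw [energyForm_eq_integral hf hg, energyForm_eq_integral hf' hg',
    ← integral_sphereMap (rot a t) fun x => ∑ a, F a x * G a x + ε * (trace2 H x * trace2 K x)]
  refine integral_congr_ae ?_
  filter_upwards [hf'.unique (hf.comp_rot a t), hg'.unique (hg.comp_rot a t)] with x h1 h2
  simp only [h1, h2, trace2, sum_rotEntry_mul, sum_rotEntry_trace a t fun c e => H c e _,
    sum_rotEntry_trace a t fun c e => K c e _]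

end Form

lemma HasW2.diffQuot {f : S2 → ℝ} {F : Fin 3 → S2 → ℝ} {H : Fin 3 → Fin 3 → S2 → ℝ}
    (h : HasW2 f F H) (a : Fin 3) (t : ℝ) :
    HasW2 (fun x => t⁻¹ * (f (srot a t x) - f x))
      (fun b x => t⁻¹ * (∑ c, rotEntry a t b c * F c (srot a t x) - F b x))
      (fun b d x => t⁻¹ * (∑ c, rotEntry a t b c * ∑ e, rotEntry a t d e * H c e (srot a t x) -
        H b d x)) :=
  ((h.comp_rot a t).sub h).const_mul t⁻¹

lemma srot_srot_neg (a : Fin 3) (t : ℝ) (x : S2) : srot a t (srot a (-t) x) = x := by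
  ext1
  simp only [coe_sphereMap]
  rw [← rot_add, add_neg_cancel, rot_zero]

lemma srot_neg_srot (a : Fin 3) (t : ℝ) (x : S2) : srot a (-t) (srot a t x) = x := by
  simpa using srot_srot_neg a (-t) x

/-- Testing with the second difference quotient of a function amounts to testing its first
difference quotient with itself. -/
lemma energyForm_second_diffQuot {ε : ℝ} {f v v' : S2 → ℝ} {F V V' : Fin 3 → S2 → ℝ}
    {H W W' : Fin 3 → Fin 3 → S2 → ℝ} (h : HasW2 f F H) (hv : HasW2 v V W) (hv' : HasW2 v' V' W')
    (a : Fin 3) (t : ℝ) (ev : ∀ x, v x = t⁻¹ * (f (srot a t x) - f x))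
    (ev' : ∀ x, v' x = v (srot a (-t) x)) :
    energyForm ε F H (fun b x => t⁻¹ * (V b x - V' b x)) (fun b c x => t⁻¹ * (W b c x - W' b c x)) =
      -energyForm ε V W V W := by
  obtain rfl : v = fun x => t⁻¹ * (f (srot a t x) - f x) := funext ev
  have e1 := energyForm_rot (ε := ε) h hv' (h.comp_rot a t) hv a t (fun _ => rfl) fun x => by
    rw [ev', srot_neg_srot]
  have hq := h.diffQuot a t
  have e2 := energyForm_rot (ε := ε) hv hv hq hv a 0
    (fun x => by rw [show srot a 0 x = x from Subtype.ext (rot_zero a x)])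
    (fun x => by rw [show srot a 0 x = x from Subtype.ext (rot_zero a x)])
  rw [energyForm_const_mul_right, energyForm_sub_right h hv hv', ← e1, ← e2]
  rw [energyForm_comm (F := fun b x => t⁻¹ * _), energyForm_const_mul_right,
    energyForm_sub_right hv (h.comp_rot a t) h, energyForm_comm (G := F), energyForm_comm (F := V)]
  ring

/-- Differentiating `|u|² = 1` twice. -/
lemma sphere_constraint {u : Fin 3 → S2 → ℝ} {F : Fin 3 → Fin 3 → S2 → ℝ}
    {H : Fin 3 → Fin 3 → Fin 3 → S2 → ℝ} (h : ∀ k, HasW2 (u k) (F k) (H k))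
    (h1 : ∀ x, ∑ k, u k x * u k x = 1) : ∀ᵐ x ∂area, (∀ a, ∑ k, u k x * F k a x = 0) ∧
      ∑ k, u k x * trace2 (H k) x = -∑ k, ∑ a, F k a x ^ 2 := by
  have hs := HasW2.sum Finset.univ fun k => (h k).mul (h k)
  simp only [h1] at hs
  filter_upwards [hs.unique HasW2.one] with x hx
  constructor
  · intro a
    have := hx.1 a
    simp only [Fin.sum_univ_three] at this ⊢
    linarith
  · have h0 := hx.2 0 0
    have h1 := hx.2 1 1
    have h2 := hx.2 2 2
    simp only [Fin.sum_univ_three, trace2] at h0 h1 h2 ⊢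
    linarith

/-- The density of the energy form paired with `q u`, for a map `u` into the sphere with first
derivatives `F` and Laplacian `T`, where `q` has gradient `Q` and Laplacian `N`. -/
def normalDensity (ε : ℝ) (F : Fin 3 → Fin 3 → ℝ) (T : Fin 3 → ℝ) (q : ℝ) (Q : Fin 3 → ℝ) (N : ℝ) :
    ℝ :=
  q * (∑ k, ∑ a, F k a ^ 2 + ε * ∑ k, T k ^ 2) +
    ε * (2 * ∑ k, T k * ∑ a, Q a * F k a - (∑ k, ∑ a, F k a ^ 2) * N)

/-- Testing with the normal field `q u`: the constraint `|u|² = 1` gives `⟨u, ∇u⟩ = 0` and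
`⟨u, Δu⟩ = -|∇u|²`, which leaves a density in the derivatives of `u` and of `q` alone. -/
lemma sum_energyForm_mul {ε : ℝ} {u : Fin 3 → S2 → ℝ} {F : Fin 3 → Fin 3 → S2 → ℝ}
    {H : Fin 3 → Fin 3 → Fin 3 → S2 → ℝ} (h : ∀ k, HasW2 (u k) (F k) (H k))
    (h1 : ∀ x, ∑ k, u k x * u k x = 1) {q : S2 → ℝ} {Q : Fin 3 → S2 → ℝ}
    {N : Fin 3 → Fin 3 → S2 → ℝ} (hq : HasW2 q Q N) :
    Integrable (fun x => normalDensity ε (fun k a => F k a x) (fun k => trace2 (H k) x) (q x)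
      (fun a => Q a x) (trace2 N x)) area ∧
    ∑ k, energyForm ε (F k) (H k) (fun a x => q x * F k a x + Q a x * u k x)
      (fun a b x => (q x * H k a b x + Q b x * F k a x) + (Q a x * F k b x + N a b x * u k x)) =
    ∫ x, normalDensity ε (fun k a => F k a x) (fun k => trace2 (H k) x) (q x) (fun a => Q a x)
      (trace2 N x) ∂area := by
  have hm (k : Fin 3) := hq.mul (h k)
  have hi := integrable_finsetSum Finset.univ fun k _ => integrable_energyForm ε (h k) (hm k)
  have hae : (fun x => ∑ k, (∑ a, F k a x * (q x * F k a x + Q a x * u k x) +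
      ε * (trace2 (H k) x * trace2 (fun a b x => (q x * H k a b x + Q b x * F k a x) +
        (Q a x * F k b x + N a b x * u k x)) x))) =ᵐ[area] fun x =>
      normalDensity ε (fun k a => F k a x) (fun k => trace2 (H k) x) (q x)
      (fun a => Q a x) (trace2 N x) := by
    filter_upwards [sphere_constraint h h1] with x hx
    have tr (k : Fin 3) : trace2 (fun a b x => (q x * H k a b x + Q b x * F k a x) +
        (Q a x * F k b x + N a b x * u k x)) x =
        q x * trace2 (H k) x + 2 * ∑ a, Q a x * F k a x + trace2 N x * u k x := by
      simp only [trace2, Fin.sum_univ_three]; ring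
    simp only [tr]
    have c0 := hx.1 0
    have c1 := hx.1 1
    have c2 := hx.1 2
    have c3 := hx.2
    simp only [normalDensity]
    generalize trace2 N x = n
    generalize (fun k => trace2 (H k) x) = T at *
    simp only [Fin.sum_univ_three] at *
    linear_combination Q 0 x * c0 + Q 1 x * c1 + Q 2 x * c2 + ε * n * c3
  refine ⟨hi.congr hae, ?_⟩
  rw [← integral_congr_ae hae, integral_finsetSum _ fun k _ => integrable_energyForm ε (h k) (hm k)]
  exact Finset.sum_congr rfl fun k _ => energyForm_eq_integral (h k) (hm k)

/-! ### The identity for difference quotients -/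

/-- The normal density for `q = |v|²`, where `v` has first derivatives `V` and Laplacian `τ`. -/
def sqDensity (ε : ℝ) (F : Fin 3 → Fin 3 → ℝ) (T : Fin 3 → ℝ) (v : Fin 3 → ℝ)
    (V : Fin 3 → Fin 3 → ℝ) (τ : Fin 3 → ℝ) : ℝ :=
  normalDensity ε F T (∑ j, v j ^ 2) (fun a => 2 * ∑ j, v j * V j a)
    (2 * (∑ j, v j * τ j + ∑ j, ∑ a, V j a ^ 2))

/-- The case `q = |v|²` of the formula for the normal test field `q u`. -/
lemma sum_energyForm_sq_mul {ε : ℝ} {u : Fin 3 → S2 → ℝ} {F : Fin 3 → Fin 3 → S2 → ℝ}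
    {H : Fin 3 → Fin 3 → Fin 3 → S2 → ℝ} (h : ∀ k, HasW2 (u k) (F k) (H k))
    (h1 : ∀ x, ∑ k, u k x * u k x = 1) {v : Fin 3 → S2 → ℝ} {V : Fin 3 → Fin 3 → S2 → ℝ}
    {W : Fin 3 → Fin 3 → Fin 3 → S2 → ℝ} (hv : ∀ j, HasW2 (v j) (V j) (W j)) :
    ∃ Φ : Fin 3 → Fin 3 → S2 → ℝ, ∃ Ψ : Fin 3 → Fin 3 → Fin 3 → S2 → ℝ,
      (∀ k, HasW2 (fun x => (∑ j, v j x * v j x) * u k x) (Φ k) (Ψ k)) ∧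
      Integrable (fun x => sqDensity ε (fun k a => F k a x) (fun k => trace2 (H k) x)
        (fun j => v j x) (fun j a => V j a x) (fun j => trace2 (W j) x)) area ∧
      ∑ k, energyForm ε (F k) (H k) (Φ k) (Ψ k) =
        ∫ x, sqDensity ε (fun k a => F k a x) (fun k => trace2 (H k) x)
          (fun j => v j x) (fun j a => V j a x) (fun j => trace2 (W j) x) ∂area := by
  have hq := HasW2.sum Finset.univ fun j => (hv j).mul (hv j)
  have key := sum_energyForm_mul (ε := ε) h h1 hq
  have e (x : S2) : normalDensity ε (fun k a => F k a x) (fun k => trace2 (H k) x)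
      (∑ j, v j x * v j x) (fun a => ∑ j, (v j x * V j a x + V j a x * v j x))
      (trace2 (fun a b x => ∑ j, ((v j x * W j a b x + V j b x * V j a x) +
        (V j a x * V j b x + W j a b x * v j x))) x) =
      sqDensity ε (fun k a => F k a x) (fun k => trace2 (H k) x)
        (fun j => v j x) (fun j a => V j a x) (fun j => trace2 (W j) x) := by
    unfold sqDensity
    congr 1
    · exact Finset.sum_congr rfl fun j _ => (pow_two _).symm
    · ext a
      rw [Finset.mul_sum]
      exact Finset.sum_congr rfl fun j _ => by ring
    · simp only [trace2, Fin.sum_univ_three]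
      ring
  simp only [e] at key
  exact ⟨_, _, fun k => hq.mul (h k), key⟩

/-- The identity for difference quotients of critical points: the second difference quotient of `u`,
projected to the tangent space, is an admissible test field. -/
lemma IsCriticalPoint.diffQuot_identity {ε : ℝ} {u : S2 → S2} (hu : IsCriticalPoint ε u)
    {F : Fin 3 → Fin 3 → S2 → ℝ} {H : Fin 3 → Fin 3 → Fin 3 → S2 → ℝ}
    (h : ∀ k, HasW2 (fun x => (u x : E3) k) (F k) (H k)) (a : Fin 3) (t : ℝ)
    {v v' : Fin 3 → S2 → ℝ} {V V' : Fin 3 → Fin 3 → S2 → ℝ}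
    {W W' : Fin 3 → Fin 3 → Fin 3 → S2 → ℝ} (hv : ∀ j, HasW2 (v j) (V j) (W j))
    (hv' : ∀ j, HasW2 (v' j) (V' j) (W' j))
    (ev : ∀ k x, v k x = t⁻¹ * ((u (srot a t x) : E3) k - (u x : E3) k))
    (ev' : ∀ k x, v' k x = v k (srot a (-t) x)) :
    ∑ k, energyForm ε (V k) (W k) (V k) (W k) =
      1 / 2 * ∫ x, sqDensity ε (fun k a => F k a x) (fun k => trace2 (H k) x)
          (fun j => v j x) (fun j a => V j a x) (fun j => trace2 (W j) x) ∂area +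
      1 / 2 * ∫ x, sqDensity ε (fun k a => F k a x) (fun k => trace2 (H k) x)
          (fun j => v' j x) (fun j a => V' j a x) (fun j => trace2 (W' j) x) ∂area := by
  have hnorm (x : S2) : ∑ k, (u x : E3) k * (u x : E3) k = 1 := by
    have := sphere_sum_sq (u x) 0
    simp only [Fin.sum_univ_three, ← pow_two]
    exact this
  obtain ⟨Φ, Ψ, hΦ, -, e1⟩ := sum_energyForm_sq_mul (ε := ε) h hnorm hv
  obtain ⟨Φ', Ψ', hΦ', -, e2⟩ := sum_energyForm_sq_mul (ε := ε) h hnorm hv'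
  have hη (k : Fin 3) := ((hv k).sub (hv' k)).const_mul t⁻¹
  have hb (k : Fin 3) := ((hΦ k).const_mul (1 / 2)).add ((hΦ' k).const_mul (1 / 2))
  -- The test field is `η + ½ (|v|² + |v'|²) u`, where `η = t⁻¹ (v - v')` is the second difference
  -- quotient. It is tangential because `⟨u, η⟩ = -½ (|v|² + |v'|²)`, by `|u|² = 1` at the three points
  -- `x`, `R x` and `R⁻¹ x`.
  have key := hu.first_variation h (fun k => (hη k).add (hb k)) fun x => by
    have n1 := hnorm x
    have n2 := hnorm (srot a t x)
    have n3 := hnorm (srot a (-t) x)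
    simp only [ev', ev, srot_srot_neg, Fin.sum_univ_three] at n1 n2 n3 ⊢
    linear_combination (1 / 2 * t⁻¹ ^ 2 * ((u (srot a t x) : E3) 0 * (u (srot a t x) : E3) 0 +
      (u (srot a t x) : E3) 1 * (u (srot a t x) : E3) 1 +
      (u (srot a t x) : E3) 2 * (u (srot a t x) : E3) 2 +
      (u (srot a (-t) x) : E3) 0 * (u (srot a (-t) x) : E3) 0 +
      (u (srot a (-t) x) : E3) 1 * (u (srot a (-t) x) : E3) 1 +
      (u (srot a (-t) x) : E3) 2 * (u (srot a (-t) x) : E3) 2) +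
      t⁻¹ ^ 2 * ((u x : E3) 0 * (u x : E3) 0 + (u x : E3) 1 * (u x : E3) 1 +
      (u x : E3) 2 * (u x : E3) 2) - t⁻¹ ^ 2 * ((u x : E3) 0 * (u (srot a t x) : E3) 0 +
      (u x : E3) 1 * (u (srot a t x) : E3) 1 + (u x : E3) 2 * (u (srot a t x) : E3) 2 +
      (u x : E3) 0 * (u (srot a (-t) x) : E3) 0 + (u x : E3) 1 * (u (srot a (-t) x) : E3) 1 +
      (u x : E3) 2 * (u (srot a (-t) x) : E3) 2) - t⁻¹ ^ 2) * n1 +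
      1 / 2 * t⁻¹ ^ 2 * (n2 + n3)
  have hk (k : Fin 3) := energyForm_add_right (ε := ε) (h k) (hη k) (hb k)
  have hk2 (k : Fin 3) := energyForm_add_right (ε := ε) (h k) ((hΦ k).const_mul (1 / 2))
    ((hΦ' k).const_mul (1 / 2))
  have hk3 (k : Fin 3) := energyForm_second_diffQuot (ε := ε) (h k) (hv k) (hv' k) a t (ev k) (ev' k)
  have key' : ∑ k, energyForm ε (F k) (H k) (fun a x => t⁻¹ * (V k a x - V' k a x) +
      (1 / 2 * Φ k a x + 1 / 2 * Φ' k a x)) (fun a b x => t⁻¹ * (W k a b x - W' k a b x) +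
      (1 / 2 * Ψ k a b x + 1 / 2 * Ψ' k a b x)) = 0 := key
  simp only [hk, hk2, hk3, energyForm_const_mul_right, Finset.sum_add_distrib,
    ← Finset.mul_sum, e1, e2, Finset.sum_neg_distrib] at key'
  linarith

/-! ### Estimates for difference quotients -/

/-- The term `-2 ε |∇u|² ⟨v, Δv⟩` is split by the inequality between the means with a free weight `s`;
the term `-2 ε |∇u|² |∇v|²` has a good sign and is dropped. -/
lemma sqDensity_le {ε M s : ℝ} (hε : 0 ≤ ε) (hs : 0 < s) (F : Fin 3 → Fin 3 → ℝ) (T : Fin 3 → ℝ)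
    (v : Fin 3 → ℝ) (V : Fin 3 → Fin 3 → ℝ) (τ : Fin 3 → ℝ) (hM : ∑ j, v j ^ 2 ≤ M) :
    sqDensity ε F T v V τ ≤ (∑ j, v j ^ 2) * (∑ k, ∑ a, F k a ^ 2) +
      ε * (7 * M * ∑ k, T k ^ 2 + 2 * ((∑ j, ∑ a, V j a ^ 2) * ∑ k, ∑ a, F k a ^ 2) +
        (s⁻¹ * M * (∑ k, ∑ a, F k a ^ 2) ^ 2 + s * ∑ j, τ j ^ 2)) := by
  set B := ∑ k, ∑ a, F k a ^ 2 with hB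
  have hB0 : 0 ≤ B := by positivity
  have hT0 : 0 ≤ ∑ k, T k ^ 2 := by positivity
  have hV0 : 0 ≤ ∑ j, ∑ a, V j a ^ 2 := by positivity
  have h1 : 2 * ∑ k, T k * ∑ a, (2 * ∑ j, v j * V j a) * F k a ≤
      6 * M * ∑ k, T k ^ 2 + 2 * ((∑ j, ∑ a, V j a ^ 2) * B) := by
    have e1 : 2 * ∑ k, T k * ∑ a, (2 * ∑ j, v j * V j a) * F k a =
        ∑ k, ∑ a, ∑ j, 4 * (T k * v j) * (V j a * F k a) := by
      simp only [Finset.mul_sum, Finset.sum_mul]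
      exact Finset.sum_congr rfl fun k _ => Finset.sum_congr rfl fun a _ =>
        Finset.sum_congr rfl fun j _ => by ring
    have e2 : ∑ k, ∑ a, ∑ j, 4 * (T k * v j) * (V j a * F k a) ≤
        ∑ k, ∑ a, ∑ j, (2 * (T k ^ 2 * v j ^ 2) + 2 * (V j a ^ 2 * F k a ^ 2)) :=
      Finset.sum_le_sum fun k _ => Finset.sum_le_sum fun a _ => Finset.sum_le_sum fun j _ => by
        nlinarith [sq_nonneg (T k * v j - V j a * F k a)]
    have e3 : ∑ k, ∑ a : Fin 3, ∑ j, 2 * (T k ^ 2 * v j ^ 2) =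
        6 * ((∑ j, v j ^ 2) * ∑ k, T k ^ 2) := by
      simp only [Fin.sum_univ_three]; ring
    have e4 : ∑ k, ∑ a, ∑ j, 2 * (V j a ^ 2 * F k a ^ 2) ≤ 2 * ((∑ j, ∑ a, V j a ^ 2) * B) := by
      have e5 : ∑ k, ∑ a, ∑ j, 2 * (V j a ^ 2 * F k a ^ 2) =
          2 * ∑ j, ∑ a, V j a ^ 2 * ∑ k, F k a ^ 2 := by
        simp only [Fin.sum_univ_three]; ring
      rw [e5, Finset.sum_mul]
      refine mul_le_mul_of_nonneg_left (Finset.sum_le_sum fun j _ => ?_) zero_le_two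
      rw [Finset.sum_mul]
      refine Finset.sum_le_sum fun a _ => mul_le_mul_of_nonneg_left ?_ (sq_nonneg _)
      exact Finset.sum_le_sum fun k _ =>
        Finset.single_le_sum (f := fun a => F k a ^ 2) (fun a _ => sq_nonneg _) (Finset.mem_univ a)
    have e6 := mul_le_mul_of_nonneg_right hM hT0
    simp only [Finset.sum_add_distrib] at e2
    linarith
  have h2 : -(B * (2 * ∑ j, v j * τ j)) ≤ s⁻¹ * M * B ^ 2 + s * ∑ j, τ j ^ 2 := by
    have e1 : -(B * (2 * ∑ j, v j * τ j)) ≤ ∑ j, (s⁻¹ * B ^ 2 * v j ^ 2 + s * τ j ^ 2) := by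
      rw [Finset.mul_sum, Finset.mul_sum, ← Finset.sum_neg_distrib]
      refine Finset.sum_le_sum fun j _ => ?_
      have hi : 0 < s⁻¹ := inv_pos.2 hs
      have e : s⁻¹ * B ^ 2 * v j ^ 2 + s * τ j ^ 2 + 2 * (B * (v j * τ j)) =
          s⁻¹ * (B * v j + s * τ j) ^ 2 := by
        field_simp
        ring
      have : 0 ≤ s⁻¹ * (B * v j + s * τ j) ^ 2 := by positivity
      linarith
    rw [Finset.sum_add_distrib, ← Finset.mul_sum, ← Finset.mul_sum] at e1
    have := mul_le_mul_of_nonneg_left hM (by positivity : 0 ≤ s⁻¹ * B ^ 2)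
    linarith
  have h3 := mul_le_mul_of_nonneg_right hM hT0
  have h4 : 0 ≤ B * (2 * ∑ j, ∑ a, V j a ^ 2) := by positivity
  unfold sqDensity normalDensity
  have h5 : (∑ j, v j ^ 2) * ∑ k, T k ^ 2 + (2 * ∑ k, T k * ∑ a, (2 * ∑ j, v j * V j a) * F k a -
      B * (2 * (∑ j, v j * τ j + ∑ j, ∑ a, V j a ^ 2))) ≤
      7 * M * ∑ k, T k ^ 2 + 2 * ((∑ j, ∑ a, V j a ^ 2) * B) +
        (s⁻¹ * M * B ^ 2 + s * ∑ j, τ j ^ 2) := by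
    have : B * (2 * (∑ j, v j * τ j + ∑ j, ∑ a, V j a ^ 2)) =
      B * (2 * ∑ j, v j * τ j) + B * (2 * ∑ j, ∑ a, V j a ^ 2) := by ring
    linarith
  have h6 := mul_le_mul_of_nonneg_left h5 hε
  linarith

/-- Cauchy–Schwarz for squares of functions in `L⁴`. -/
lemma integral_sq_mul_sq_le {f g : S2 → ℝ} (hf : MemLp f 4 area) (hg : MemLp g 4 area) {A B C : ℝ}
    (hA : ∫ x, f x ^ 4 ∂area ≤ A) (hB : ∫ x, g x ^ 4 ∂area ≤ B) (hC : 0 ≤ C) (hABC : A * B ≤ C ^ 2) :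
    Integrable (fun x => f x ^ 2 * g x ^ 2) area ∧ ∫ x, f x ^ 2 * g x ^ 2 ∂area ≤ C := by
  have mf : MemLp (fun x => f x ^ 2) 2 area := by
    simpa only [pow_two] using memLp_mul_four hf hf
  have mg : MemLp (fun x => g x ^ 2) 2 area := by
    simpa only [pow_two] using memLp_mul_four hg hg
  refine ⟨integrable_mul_of_memLp mf mg, ?_⟩
  refine (le_abs_self _).trans ((abs_integral_mul_le mf mg).trans ?_)
  refine le_of_sq_le_sq ?_ hC
  have e (k : S2 → ℝ) (hk : MemLp (fun x => k x ^ 2) 2 area) :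
      l2 (fun x => k x ^ 2) ^ 2 = ∫ x, k x ^ 4 ∂area := by
    rw [l2_sq hk]; congr 1; ext x; ring
  rw [mul_pow, e f mf, e g mg]
  have h0 : 0 ≤ ∫ x, g x ^ 4 ∂area := integral_nonneg fun x => by positivity
  have h1 : 0 ≤ ∫ x, f x ^ 4 ∂area := integral_nonneg fun x => by positivity
  exact (mul_le_mul hA hB h0 (h1.trans hA)).trans hABC

lemma integral_sum_le {ι : Type*} [Fintype ι] {f : ι → S2 → ℝ} {C : ℝ}
    (h : ∀ i, Integrable (f i) area ∧ ∫ x, f i x ∂area ≤ C) :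
    Integrable (fun x => ∑ i, f i x) area ∧ ∫ x, ∑ i, f i x ∂area ≤ Fintype.card ι * C := by
  refine ⟨integrable_finsetSum _ fun i _ => (h i).1, ?_⟩
  rw [integral_finsetSum _ fun i _ => (h i).1]
  refine (Finset.sum_le_sum fun i _ => (h i).2).trans (le_of_eq ?_)
  simp

/-- The estimate of the right-hand side of the identity for difference quotients; `G`, `X`, `Y`
bound the Dirichlet energy of `u` and the first- and second-order energies of its difference
quotients. -/
lemma integral_sqDensity_le {ε G X Y m : ℝ} (hε : 0 ≤ ε) (hG : 0 < G) (hGX : G ≤ 8 * X)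
    (hm0 : 0 ≤ m) (hm : m ^ 2 = G * Y) (hXm : X ≤ m)
    {u : Fin 3 → S2 → ℝ} {F : Fin 3 → Fin 3 → S2 → ℝ} {H : Fin 3 → Fin 3 → Fin 3 → S2 → ℝ}
    (h : ∀ k, HasW2 (u k) (F k) (H k)) {v : Fin 3 → S2 → ℝ} {V : Fin 3 → Fin 3 → S2 → ℝ}
    {W : Fin 3 → Fin 3 → Fin 3 → S2 → ℝ} (hv : ∀ j, HasW2 (v j) (V j) (W j))
    (hF : ∑ k, ∑ a, l2 (F k a) ^ 2 ≤ G) (hT : ∑ k, l2 (trace2 (H k)) ^ 2 ≤ 4 * X)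
    (hvG : ∀ j, l2 (v j) ^ 2 ≤ G) (hVX : ∑ j, ∑ a, l2 (V j a) ^ 2 ≤ X)
    (hY : ∑ j, l2 (trace2 (W j)) ^ 2 ≤ Y)
    (hi : Integrable (fun x => sqDensity ε (fun k a => F k a x) (fun k => trace2 (H k) x)
          (fun j => v j x) (fun j a => V j a x) (fun j => trace2 (W j) x)) area) :
    ∫ x, sqDensity ε (fun k a => F k a x) (fun k => trace2 (H k) x)
          (fun j => v j x) (fun j a => V j a x) (fun j => trace2 (W j) x) ∂area ≤
      2 * 10 ^ 10 * G * (X + ε * Y) := by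
  have hX : 0 < X := by linarith
  have hmpos : 0 < m := hX.trans_le hXm
  have hY0 : 0 < Y := by
    have : 0 < G * Y := by rw [← hm]; positivity
    exact pos_of_mul_pos_right this hG.le
  have hXY : X ≤ 8 * Y := by
    have : X ^ 2 ≤ G * Y := by rw [← hm]; exact pow_le_pow_left₀ hX.le hXm 2
    have h2 : G * Y ≤ 8 * X * Y := mul_le_mul_of_nonneg_right hGX hY0.le
    have h3 : X * X ≤ X * (8 * Y) := by nlinarith
    exact le_of_mul_le_mul_left h3 hX
  have sF (k a : Fin 3) : l2 (F k a) ^ 2 ≤ G := by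
    refine le_trans ?_ hF
    refine le_trans ?_ (Finset.single_le_sum (f := fun k => ∑ a, l2 (F k a) ^ 2)
      (fun k _ => by positivity) (Finset.mem_univ k))
    exact Finset.single_le_sum (f := fun a => l2 (F k a) ^ 2) (fun a _ => by positivity)
      (Finset.mem_univ a)
  have sV' (j : Fin 3) : ∑ a, l2 (V j a) ^ 2 ≤ X := by
    refine le_trans ?_ hVX
    exact Finset.single_le_sum (f := fun k => ∑ a, l2 (V k a) ^ 2)
      (fun k _ => by positivity) (Finset.mem_univ j)
  have sV (j a : Fin 3) : l2 (V j a) ^ 2 ≤ X :=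
    (Finset.single_le_sum (f := fun a => l2 (V j a) ^ 2) (fun a _ => by positivity)
      (Finset.mem_univ a)).trans (sV' j)
  have sH (k b : Fin 3) : ∑ c, l2 (H k b c) ^ 2 ≤ 4 * X := by
    refine le_trans ?_ hT
    refine le_trans ?_ (Finset.single_le_sum (f := fun k => l2 (trace2 (H k)) ^ 2)
      (fun k _ => by positivity) (Finset.mem_univ k))
    rw [← (h k).bochner]
    exact Finset.single_le_sum (f := fun b => ∑ c, l2 (H k b c) ^ 2) (fun a _ => by positivity)
      (Finset.mem_univ b)
  have sW' (j : Fin 3) : ∑ b, ∑ c, l2 (W j b c) ^ 2 ≤ Y := by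
    refine le_trans ?_ hY
    rw [(hv j).bochner]
    exact Finset.single_le_sum (f := fun k => l2 (trace2 (W k)) ^ 2)
      (fun k _ => by positivity) (Finset.mem_univ j)
  have sW (j b : Fin 3) : ∑ c, l2 (W j b c) ^ 2 ≤ Y :=
    (Finset.single_le_sum (f := fun b => ∑ c, l2 (W j b c) ^ 2) (fun a _ => by positivity)
      (Finset.mem_univ b)).trans (sW' j)
  -- fourth powers
  have q1 (j : Fin 3) : ∫ x, v j x ^ 4 ∂area ≤ 60000 * (G * X) := by
    refine (hv j).fst.ladyzhenskaya.2.trans ?_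
    have h1 : 5000 * l2 (v j) ^ 2 ≤ 5000 * G := by linarith [hvG j]
    have h2 : l2 (v j) ^ 2 + ∑ a, l2 (V j a) ^ 2 ≤ 9 * X := by linarith [hvG j, sV' j]
    refine (mul_le_mul h1 h2 (by positivity) (by positivity)).trans ?_
    nlinarith [mul_pos hG hX]
  have q2 (k a : Fin 3) : ∫ x, F k a x ^ 4 ∂area ≤ 60000 * (G * X) := by
    refine ((h k).snd a).ladyzhenskaya.2.trans ?_
    have h1 : 5000 * l2 (F k a) ^ 2 ≤ 5000 * G := by linarith [sF k a]
    have h2 : l2 (F k a) ^ 2 + ∑ c, l2 (H k a c) ^ 2 ≤ 12 * X := by linarith [sF k a, sH k a]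
    refine (mul_le_mul h1 h2 (by positivity) (by positivity)).trans ?_
    nlinarith [mul_pos hG hX]
  have q3 (j a : Fin 3) : ∫ x, V j a x ^ 4 ∂area ≤ 60000 * (X * Y) := by
    refine ((hv j).snd a).ladyzhenskaya.2.trans ?_
    have h1 : 5000 * l2 (V j a) ^ 2 ≤ 5000 * X := by linarith [sV j a]
    have h2 : l2 (V j a) ^ 2 + ∑ c, l2 (W j a c) ^ 2 ≤ 9 * Y := by linarith [sV j a, sW j a]
    refine (mul_le_mul h1 h2 (by positivity) (by positivity)).trans ?_
    nlinarith [mul_pos hX hY0]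
  -- the supremum of `v`
  have qsup : ∀ᵐ x ∂area, ∑ j, v j x ^ 2 ≤ 2304 * m := by
    have hj (j : Fin 3) : 64 * (l2 (v j) ^ 2 + ∑ a, l2 (V j a) ^ 2 +
        ∑ a, ∑ b, l2 (v j) * l2 (W j a b)) ≤ 768 * m := by
      have h1 : ∑ a, ∑ b, l2 (v j) * l2 (W j a b) ≤ 3 * m := by
        refine le_of_sq_le_sq ?_ (by positivity)
        simp only [← Finset.mul_sum]
        rw [mul_pow, mul_pow, hm]
        have c1 : (∑ a, ∑ b, l2 (W j a b)) ^ 2 ≤ 9 * Y := by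
          have c2 : (∑ a, ∑ b, l2 (W j a b)) ^ 2 ≤ 3 * ∑ a, (∑ b, l2 (W j a b)) ^ 2 := by
            simpa using sq_sum_le_card_mul_sum_sq (s := Finset.univ)
              (f := fun a => ∑ b, l2 (W j a b))
          have c3 : ∑ a, (∑ b, l2 (W j a b)) ^ 2 ≤ ∑ a, 3 * ∑ b, l2 (W j a b) ^ 2 :=
            Finset.sum_le_sum fun a _ => by
              simpa using sq_sum_le_card_mul_sum_sq (s := Finset.univ) (f := fun b => l2 (W j a b))
          rw [← Finset.mul_sum] at c3
          linarith [sW' j]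
        refine (mul_le_mul (hvG j) c1 (sq_nonneg _) hG.le).trans (le_of_eq (by ring))
      linarith [hvG j, sV' j]
    filter_upwards [ae_all_iff.2 fun j => (hv j).sup_sq_le] with x hx
    have := Finset.sum_le_sum (s := Finset.univ) fun j _ => (hx j).trans (hj j)
    simp only [Finset.sum_const, Finset.card_univ, Fintype.card_fin, nsmul_eq_mul] at this
    refine this.trans (le_of_eq ?_)
    push_cast
    ring
  -- products of squares
  have hGX0 : 0 ≤ G * X := by positivity
  have hXm2 : X * m ≤ G * Y := by
    have := mul_le_mul_of_nonneg_right hXm hm0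
    nlinarith
  have p1 (j k a : Fin 3) := integral_sq_mul_sq_le (hv j).fst.memLp_four ((h k).snd a).memLp_four
    (q1 j) (q2 k a) (C := 60000 * (G * X)) (by positivity) (le_of_eq (by ring))
  have p2 (j b k a : Fin 3) := integral_sq_mul_sq_le ((hv j).snd b).memLp_four
    ((h k).snd a).memLp_four (q3 j b) (q2 k a) (C := 60000 * (X * m)) (by positivity) (by
      rw [mul_pow, mul_pow, hm]; exact le_of_eq (by ring))
  have p3 (l b k a : Fin 3) := integral_sq_mul_sq_le ((h l).snd b).memLp_four
    ((h k).snd a).memLp_four (q2 l b) (q2 k a) (C := 60000 * (G * X)) (by positivity)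
      (le_of_eq (by ring))
  have r1 : Integrable (fun x => (∑ j, v j x ^ 2) * ∑ k, ∑ a, F k a x ^ 2) area ∧
      ∫ x, (∑ j, v j x ^ 2) * ∑ k, ∑ a, F k a x ^ 2 ∂area ≤ 27 * (60000 * (G * X)) := by
    have e (x : S2) : (∑ j, v j x ^ 2) * (∑ k, ∑ a, F k a x ^ 2) =
        ∑ i : Fin 3 × Fin 3 × Fin 3, v i.1 x ^ 2 * F i.2.1 i.2.2 x ^ 2 := by
      simp only [Fintype.sum_prod_type, Fin.sum_univ_three]
      ring
    simp only [e]
    have := integral_sum_le (fun i : Fin 3 × Fin 3 × Fin 3 => p1 i.1 i.2.1 i.2.2)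
    simpa using this
  have r2 : Integrable (fun x => (∑ j, ∑ a, V j a x ^ 2) * ∑ k, ∑ a, F k a x ^ 2) area ∧
      ∫ x, (∑ j, ∑ a, V j a x ^ 2) * ∑ k, ∑ a, F k a x ^ 2 ∂area ≤ 81 * (60000 * (X * m)) := by
    have e (x : S2) : (∑ j, ∑ a, V j a x ^ 2) * (∑ k, ∑ a, F k a x ^ 2) =
        ∑ i : (Fin 3 × Fin 3) × Fin 3 × Fin 3, V i.1.1 i.1.2 x ^ 2 * F i.2.1 i.2.2 x ^ 2 := by
      simp only [Fintype.sum_prod_type, Fin.sum_univ_three]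
      ring
    simp only [e]
    have := integral_sum_le (fun i : (Fin 3 × Fin 3) × Fin 3 × Fin 3 =>
      p2 i.1.1 i.1.2 i.2.1 i.2.2)
    simpa using this
  have r3 : Integrable (fun x => (∑ k, ∑ a, F k a x ^ 2) ^ 2) area ∧
      ∫ x, (∑ k, ∑ a, F k a x ^ 2) ^ 2 ∂area ≤ 81 * (60000 * (G * X)) := by
    have e (x : S2) : (∑ k, ∑ a, F k a x ^ 2) ^ 2 =
        ∑ i : (Fin 3 × Fin 3) × Fin 3 × Fin 3, F i.1.1 i.1.2 x ^ 2 * F i.2.1 i.2.2 x ^ 2 := by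
      simp only [Fintype.sum_prod_type, Fin.sum_univ_three]
      ring
    simp only [e]
    have := integral_sum_le (fun i : (Fin 3 × Fin 3) × Fin 3 × Fin 3 =>
      p3 i.1.1 i.1.2 i.2.1 i.2.2)
    simpa using this
  have iT : Integrable (fun x => ∑ k, trace2 (H k) x ^ 2) area :=
    integrable_finsetSum _ fun k _ => (h k).memLp_trace2.integrable_sq
  have iτ : Integrable (fun x => ∑ j, trace2 (W j) x ^ 2) area :=
    integrable_finsetSum _ fun j _ => (hv j).memLp_trace2.integrable_sq
  have r4 : ∫ x, ∑ k, trace2 (H k) x ^ 2 ∂area ≤ 4 * X := by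
    rw [integral_finsetSum _ fun k _ => (h k).memLp_trace2.integrable_sq]
    simpa only [l2_sq (h _).memLp_trace2] using hT
  have r5 : ∫ x, ∑ j, trace2 (W j) x ^ 2 ∂area ≤ Y := by
    rw [integral_finsetSum _ fun j _ => (hv j).memLp_trace2.integrable_sq]
    simpa only [l2_sq (hv _).memLp_trace2] using hY
  have j1 := (iT.const_mul (7 * (2304 * m))).add (r2.1.const_mul 2)
  have j2 := (r3.1.const_mul (G⁻¹ * (2304 * m))).add (iτ.const_mul G)
  have j3 := (j1.add j2).const_mul ε
  -- The weight is `s = G`: then `s ∫ |Δv|² ≤ G Y`, and the other half of the split term is bounded by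
  -- a multiple of `G⁻¹ m G X = m X ≤ m² = G Y`.
  have hle := integral_mono_ae hi (r1.1.add j3) (qsup.mono fun x hx =>
    sqDensity_le hε hG (fun k a => F k a x) (fun k => trace2 (H k) x) (fun j => v j x)
      (fun j a => V j a x) (fun j => trace2 (W j) x) hx)
  refine hle.trans ?_
  have s1 := integral_add r1.1 j3
  have s2 := integral_add j1 j2
  have s3 := integral_add (iT.const_mul (7 * (2304 * m))) (r2.1.const_mul 2)
  have s4 := integral_add (r3.1.const_mul (G⁻¹ * (2304 * m))) (iτ.const_mul G)
  simp only [Pi.add_apply, integral_const_mul] at s1 s2 s3 s4 ⊢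
  rw [s1, s2, s3, s4]
  have t1 := mul_le_mul_of_nonneg_left r4 (by positivity : 0 ≤ 7 * (2304 * m))
  have t3 := mul_le_mul_of_nonneg_left r3.2 (by positivity : 0 ≤ G⁻¹ * (2304 * m))
  have t5 := mul_le_mul_of_nonneg_left r5 hG.le
  have t3' : G⁻¹ * (2304 * m) * (81 * (60000 * (G * X))) = 2304 * 81 * 60000 * (X * m) := by
    field_simp
  rw [t3'] at t3
  have hGY0 : 0 ≤ G * Y := by positivity
  have hin : 7 * (2304 * m) * (∫ x, ∑ k, trace2 (H k) x ^ 2 ∂area) +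
      2 * (∫ x, (∑ j, ∑ a, V j a x ^ 2) * ∑ k, ∑ a, F k a x ^ 2 ∂area) +
      (G⁻¹ * (2304 * m) * (∫ x, (∑ k, ∑ a, F k a x ^ 2) ^ 2 ∂area) +
        G * ∫ x, ∑ j, trace2 (W j) x ^ 2 ∂area) ≤ 2 * 10 ^ 10 * (G * Y) := by
    linarith [r2.2]
  have := mul_le_mul_of_nonneg_left hin hε
  have h8 : 2 * 10 ^ 10 * G * (X + ε * Y) = 2 * 10 ^ 10 * (G * X) +
    ε * (2 * 10 ^ 10 * (G * Y)) := by ring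
  rw [h8]
  linarith [r1.2]

lemma sum_sum_sq_nonneg (f : Fin 3 → Fin 3 → ℝ) : 0 ≤ ∑ k, ∑ a, f k a ^ 2 :=
  Finset.sum_nonneg fun _ _ => Finset.sum_nonneg fun _ _ => sq_nonneg _

lemma sq_le_sum_sum_sq (f : Fin 3 → Fin 3 → ℝ) (k a : Fin 3) : f k a ^ 2 ≤ ∑ k, ∑ a, f k a ^ 2 :=
  (Finset.single_le_sum (f := fun a => f k a ^ 2) (fun _ _ => sq_nonneg _)
    (Finset.mem_univ a)).trans
  (Finset.single_le_sum (f := fun k => ∑ a, f k a ^ 2)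
    (fun _ _ => Finset.sum_nonneg fun _ _ => sq_nonneg _) (Finset.mem_univ k))

lemma sq_sum_sum_le {x p q f : Fin 3 → Fin 3 → ℝ} (h : ∀ a k, x a k ≤ p a k * q a k)
    (hp : ∀ a k, 0 ≤ p a k) (hpf : ∀ a k, p a k ≤ f k a) (hx : 0 ≤ ∑ a, ∑ k, x a k) :
    (∑ a, ∑ k, x a k) ^ 2 ≤ (∑ k, ∑ a, f k a ^ 2) * ∑ a, ∑ k, q a k ^ 2 := by
  have c1 : ∑ a, ∑ k, x a k ≤ ∑ i : Fin 3 × Fin 3, p i.1 i.2 * q i.1 i.2 := by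
    rw [Fintype.sum_prod_type]
    exact Finset.sum_le_sum fun a _ => Finset.sum_le_sum fun k _ => h a k
  refine (pow_le_pow_left₀ hx c1 2).trans ((Finset.sum_mul_sq_le_sq_mul_sq _ _ _).trans ?_)
  rw [Fintype.sum_prod_type, Fintype.sum_prod_type]
  refine mul_le_mul_of_nonneg_right ?_ (sum_sum_sq_nonneg q)
  rw [Finset.sum_comm]
  exact Finset.sum_le_sum fun k _ => Finset.sum_le_sum fun a _ =>
    pow_le_pow_left₀ (hp a k) (hpf a k) 2

lemma HasW1.sum_l2_comp_rot {f : S2 → ℝ} {F : Fin 3 → S2 → ℝ} (h : HasW1 f F) (a : Fin 3) (t : ℝ) :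
    ∑ b, l2 (fun x => ∑ c, rotEntry a t b c * F c (srot a t x)) ^ 2 = ∑ c, l2 (F c) ^ 2 := by
  have hR := h.comp_rot a t
  simp only [l2_sq (hR.memLp_deriv _), l2_sq (h.memLp_deriv _)]
  rw [← integral_finsetSum _ fun b _ => (hR.memLp_deriv b).integrable_sq,
    ← integral_finsetSum _ fun b _ => (h.memLp_deriv b).integrable_sq,
    ← integral_sphereMap (rot a t) fun x => ∑ c, F c x ^ 2]
  simp only [pow_two, sum_rotEntry_mul]

lemma HasW2.l2_trace2_comp_rot {f : S2 → ℝ} {F : Fin 3 → S2 → ℝ} {H : Fin 3 → Fin 3 → S2 → ℝ}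
    (h : HasW2 f F H) (a : Fin 3) (t : ℝ) :
    l2 (trace2 fun b d x => ∑ c, rotEntry a t b c * ∑ e, rotEntry a t d e * H c e (srot a t x)) =
      l2 (trace2 H) := by
  rw [← l2_comp_rot h.memLp_trace2 a t]
  congr 1
  ext x
  exact sum_rotEntry_trace a t fun c e => H c e (srot a t x)

/-- The rotation about the `a`-th axis fixes `e_a`; hence `L_a` commutes with it. -/
lemma rotEntry_self (a : Fin 3) (t : ℝ) (c : Fin 3) : rotEntry a t a c = if c = a then 1 else 0 := by
  have hc : crossVec a (basisVec a) = 0 := by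
    have := cyc_ne a
    simp [crossVec, this]
  unfold rotEntry
  rw [rot_def, hc]
  simp

/-- Interpolation: `∫ |∇f|² = -∫ f Δf`, so that `‖∇f‖² ≤ ‖f‖ ‖Δf‖`. -/
lemma HasW2.sum_l2_sq_le {f : S2 → ℝ} {F : Fin 3 → S2 → ℝ} {H : Fin 3 → Fin 3 → S2 → ℝ}
    (h : HasW2 f F H) : ∑ b, l2 (F b) ^ 2 ≤ l2 f * l2 (trace2 H) := by
  have e : ∑ b, l2 (F b) ^ 2 = -∫ x, f x * trace2 H x ∂area := by
    simp only [trace2, Finset.mul_sum]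
    rw [integral_finsetSum _ fun b _ =>
      integrable_mul_of_memLp h.fst.memLp ((h.snd b).memLp_deriv b), ← Finset.sum_neg_distrib]
    refine Finset.sum_congr rfl fun b _ => ?_
    rw [h.fst.integral_mul_deriv (h.snd b) b, l2_sq (h.fst.memLp_deriv b), neg_neg]
    simp only [pow_two]
  rw [e]
  exact (neg_le_abs _).trans (abs_integral_mul_le h.fst.memLp h.memLp_trace2)

lemma HasW1.l2_diffQuot_le {f : S2 → ℝ} {F : Fin 3 → S2 → ℝ} (h : HasW1 f F) (a : Fin 3) {t : ℝ}
    (ht : t ≠ 0) : l2 (fun x => t⁻¹ * (f (srot a t x) - f x)) ≤ l2 (F a) := by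
  rw [l2_const_mul, abs_inv, inv_mul_le_iff₀ (abs_pos.2 ht)]
  exact h.l2_increment_le a t

/-- At a suitable scale the difference quotients see a quarter of the second-order energy. -/
lemma exists_diffQuot_scale {u : Fin 3 → S2 → ℝ} {F : Fin 3 → Fin 3 → S2 → ℝ}
    {H : Fin 3 → Fin 3 → Fin 3 → S2 → ℝ} (h : ∀ k, HasW2 (u k) (F k) (H k))
    (hpos : 0 < ∑ k, l2 (trace2 (H k)) ^ 2) : ∃ t : ℝ, t ≠ 0 ∧
      ∑ k, l2 (trace2 (H k)) ^ 2 ≤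
        4 * ∑ a, ∑ k, l2 (fun x => t⁻¹ * (F k a (srot a t x) - F k a x)) ^ 2 := by
  have h1 (k a : Fin 3) : Filter.Tendsto
      (fun t : ℝ => l2 (fun x => t⁻¹ * (F k a (srot a t x) - F k a x))) (nhdsWithin 0 {0}ᶜ)
      (nhds (l2 (H k a a))) := by
    have h2 := ((h k).snd a).tendsto_diffQuot a
    rw [tendsto_iff_dist_tendsto_zero]
    refine squeeze_zero (fun t => dist_nonneg) (fun t => ?_) h2
    have m1 : MemLp (fun x => t⁻¹ * (F k a (srot a t x) - F k a x)) 2 area :=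
      (memLp_sub (((h k).snd a).comp_rot a t).memLp ((h k).snd a).memLp).const_mul _
    have m2 := ((h k).snd a).memLp_deriv a
    have b1 := lpNorm_le_lpNorm_add_lpNorm_sub' m2 (p := 2) (by norm_num)
      (f := fun x => t⁻¹ * (F k a (srot a t x) - F k a x))
    have b2 := lpNorm_le_lpNorm_add_lpNorm_sub m1 (p := 2) (by norm_num) (f := H k a a)
    have e : (fun x => t⁻¹ * (F k a (srot a t x) - F k a x)) - H k a a =
        fun x => t⁻¹ * (F k a (srot a t x) - F k a x) - H k a a x := rfl
    rw [e] at b1 b2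
    rw [Real.dist_eq, abs_le]
    constructor <;> linarith
  have h3 := tendsto_finsetSum Finset.univ fun a _ =>
    tendsto_finsetSum Finset.univ fun k _ => (h1 k a).pow 2
  -- only the diagonal entries enter; the constant `4 > 3` leaves room for the limit `t → 0`
  have h4 : ∑ k, l2 (trace2 (H k)) ^ 2 ≤ 3 * ∑ a, ∑ k, l2 (H k a a) ^ 2 := by
    rw [Finset.sum_comm, Finset.mul_sum]
    refine Finset.sum_le_sum fun k _ => ?_
    have m (a : Fin 3) := (((h k).snd a).memLp_deriv a).integrable_sq
    rw [l2_sq (h k).memLp_trace2]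
    simp only [l2_sq (((h k).snd _).memLp_deriv _)]
    rw [← integral_finsetSum _ fun a _ => m a, ← integral_const_mul]
    refine integral_mono (h k).memLp_trace2.integrable_sq
      ((integrable_finsetSum _ fun a _ => m a).const_mul 3) fun x => ?_
    simpa [trace2] using sq_sum_le_card_mul_sum_sq (s := Finset.univ) (f := fun a => H k a a x)
  have h5 : 1 / 4 * ∑ k, l2 (trace2 (H k)) ^ 2 < ∑ a, ∑ k, l2 (H k a a) ^ 2 := by linarith
  obtain ⟨t, ht, ht0⟩ := ((h3.eventually_const_lt h5).and self_mem_nhdsWithin).exists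
  exact ⟨t, ht0, by linarith⟩

/-- A critical point with small Dirichlet energy has vanishing second-order energy. -/
lemma IsCriticalPoint.sum_l2_trace2_eq_zero {ε : ℝ} (hε : 0 ≤ ε) {u : S2 → S2}
    (hu : IsCriticalPoint ε u) {F : Fin 3 → Fin 3 → S2 → ℝ}
    {H : Fin 3 → Fin 3 → Fin 3 → S2 → ℝ} (h : ∀ k, HasW2 (fun x => (u x : E3) k) (F k) (H k))
    (hsmall : 6 * 10 ^ 10 * ∑ k, ∑ a, l2 (F k a) ^ 2 < 1) :
    ∑ k, l2 (trace2 (H k)) ^ 2 = 0 := by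
  by_contra hne
  have hpos : 0 < ∑ k, l2 (trace2 (H k)) ^ 2 := 
    lt_of_le_of_ne (Finset.sum_nonneg fun k _ => sq_nonneg _) (Ne.symm hne)
  obtain ⟨t, ht0, ht⟩ := exists_diffQuot_scale h hpos
  have hv (a k : Fin 3) := (h k).diffQuot a t
  have hv' (a k : Fin 3) := (hv a k).comp_rot a (-t)
  set v : Fin 3 → Fin 3 → S2 → ℝ := fun a k x =>
    t⁻¹ * ((u (srot a t x) : E3) k - (u x : E3) k) with hvdef
  set V : Fin 3 → Fin 3 → Fin 3 → S2 → ℝ := fun a k b x =>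
    t⁻¹ * (∑ c, rotEntry a t b c * F k c (srot a t x) - F k b x) with hVdef
  set W : Fin 3 → Fin 3 → Fin 3 → Fin 3 → S2 → ℝ := fun a k b d x =>
    t⁻¹ * (∑ c, rotEntry a t b c * ∑ e, rotEntry a t d e * H k c e (srot a t x) - H k b d x)
    with hWdef
  change ∀ a k, HasW2 (v a k) (V a k) (W a k) at hv
  set G := ∑ k, ∑ a, l2 (F k a) ^ 2 with hGdef
  set X := ∑ a, ∑ k, ∑ b, l2 (V a k b) ^ 2 with hXdef
  set Y := ∑ a, ∑ k, l2 (trace2 (W a k)) ^ 2 with hYdef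
  -- for `b = a` the derivative `V a k b` is the difference quotient of `L_a u`, as `L_a` commutes
  -- with the rotations about the same axis
  have hHX : ∑ k, l2 (trace2 (H k)) ^ 2 ≤ 4 * X := by
    refine ht.trans (mul_le_mul_of_nonneg_left ?_ (by norm_num))
    refine Finset.sum_le_sum fun a _ => Finset.sum_le_sum fun k _ => ?_
    have e : V a k a = fun x => t⁻¹ * (F k a (srot a t x) - F k a x) := by
      simp [hVdef, rotEntry_self]
    rw [← e]
    exact Finset.single_le_sum (f := fun b => l2 (V a k b) ^ 2) (fun b _ => by positivity)
      (Finset.mem_univ a)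
  have hX : 0 < X := by linarith
  have hGX : G ≤ 8 * X := by
    have : G ≤ 2 * ∑ k, l2 (trace2 (H k)) ^ 2 := by
      rw [Finset.mul_sum]
      exact Finset.sum_le_sum fun k _ => (h k).gradient_le
    linarith
  have hG0 : 0 ≤ G := sum_sum_sq_nonneg fun k a => l2 (F k a)
  have hY0 : 0 ≤ Y := sum_sum_sq_nonneg fun a k => l2 (trace2 (W a k))
  have hvF (a k : Fin 3) : l2 (v a k) ≤ l2 (F k a) := (h k).fst.l2_diffQuot_le a ht0
  -- interpolation between `‖v‖² ≤ G` and `‖Δv‖² ≤ Y`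
  have hXGY : X ^ 2 ≤ G * Y := sq_sum_sum_le (fun a k => (hv a k).sum_l2_sq_le)
    (fun _ _ => lpNorm_nonneg) hvF hX.le
  have hG : 0 < G := by
    refine lt_of_le_of_ne hG0 fun h0 => ?_
    rw [← h0, zero_mul] at hXGY
    exact absurd hXGY (not_le.2 (pow_pos hX 2))
  have hXm : X ≤ Real.sqrt (G * Y) := Real.le_sqrt_of_sq_le hXGY
  have hm := Real.sq_sqrt (mul_nonneg hG0 hY0)
  have hvG (a k : Fin 3) : l2 (v a k) ^ 2 ≤ G := by
    exact (pow_le_pow_left₀ lpNorm_nonneg (hvF a k) 2).trans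
      (sq_le_sum_sum_sq (fun k a => l2 (F k a)) k a)
  have hVX (a : Fin 3) : ∑ k, ∑ b, l2 (V a k b) ^ 2 ≤ X :=
    Finset.single_le_sum (f := fun a => ∑ k, ∑ b, l2 (V a k b) ^ 2)
      (fun a _ => sum_sum_sq_nonneg fun k b => l2 (V a k b))
      (Finset.mem_univ a)
  have hWY (a : Fin 3) : ∑ k, l2 (trace2 (W a k)) ^ 2 ≤ Y :=
    Finset.single_le_sum (f := fun a => ∑ k, l2 (trace2 (W a k)) ^ 2) (fun a _ => by positivity)
      (Finset.mem_univ a)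
  have hnorm (x : S2) : ∑ k, (u x : E3) k * (u x : E3) k = 1 := by
    have := sphere_sum_sq (u x) 0
    simp only [Fin.sum_univ_three, ← pow_two]
    exact this
  have haxis (a : Fin 3) : ∑ k, energyForm ε (V a k) (W a k) (V a k) (W a k) ≤
      2 * 10 ^ 10 * G * (X + ε * Y) := by
    rw [hu.diffQuot_identity h a t (hv a) (hv' a) (fun _ _ => rfl) fun _ _ => rfl]
    obtain ⟨-, -, -, i1, -⟩ := sum_energyForm_sq_mul (ε := ε) h hnorm (hv a)
    obtain ⟨-, -, -, i2, -⟩ := sum_energyForm_sq_mul (ε := ε) h hnorm (hv' a)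
    have b1 := integral_sqDensity_le hε hG hGX (Real.sqrt_nonneg _) hm hXm h (hv a) le_rfl hHX
      (hvG a) (hVX a) (hWY a) i1
    have b2 := integral_sqDensity_le hε hG hGX (Real.sqrt_nonneg _) hm hXm h (hv' a) le_rfl hHX
      (fun j => by rw [l2_comp_rot (hv a j).fst.memLp]; exact hvG a j)
      ((Finset.sum_congr rfl fun j _ => (hv a j).fst.sum_l2_comp_rot a (-t)).trans_le (hVX a))
      ((Finset.sum_congr rfl fun j _ => by rw [(hv a j).l2_trace2_comp_rot a (-t)]).trans_le (hWY a))
      i2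
    linarith
  have htotal : ∑ a, ∑ k, energyForm ε (V a k) (W a k) (V a k) (W a k) = X + ε * Y := by
    rw [hXdef, hYdef, Finset.mul_sum, ← Finset.sum_add_distrib]
    refine Finset.sum_congr rfl fun a _ => ?_
    rw [Finset.mul_sum, ← Finset.sum_add_distrib]
    refine Finset.sum_congr rfl fun k _ => ?_
    simp only [energyForm, ← pow_two, l2_sq ((hv a k).fst.memLp_deriv _),
      l2_sq (hv a k).memLp_trace2]
  have hsum := Finset.sum_le_sum (s := Finset.univ) fun a _ => haxis a
  rw [htotal] at hsum
  simp only [Finset.sum_const, Finset.card_univ, Fintype.card_fin, nsmul_eq_mul] at hsum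
  push_cast at hsum
  have hXY : 0 < X + ε * Y := add_pos_of_pos_of_nonneg hX (mul_nonneg hε hY0)
  -- `X + ε Y ≤ 6 · 10¹⁰ G (X + ε Y)` contradicts the smallness of `G`
  nlinarith

/-! ### Maps with vanishing gradient -/

lemma exists_rot_apply_two_eq_zero (a : Fin 3) (x : E3) : ∃ s, rot a s x (a + 2) = 0 ∧
    0 ≤ rot a s x (a + 1) := by
  set z : ℂ := ⟨x (a + 1), x (a + 2)⟩ with hz
  have h1 : ‖z‖ * Real.cos z.arg = x (a + 1) := Complex.norm_mul_cos_arg z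
  have h2 : ‖z‖ * Real.sin z.arg = x (a + 2) := Complex.norm_mul_sin_arg z
  refine ⟨-z.arg, ?_, ?_⟩
  · rw [rot_apply_two, Real.cos_neg, Real.sin_neg, ← h1, ← h2]
    ring
  · rw [rot_apply_one, Real.cos_neg, Real.sin_neg, ← h1, ← h2]
    have : Real.cos z.arg * (‖z‖ * Real.cos z.arg) - -Real.sin z.arg * (‖z‖ * Real.sin z.arg) =
        ‖z‖ := by
      linear_combination ‖z‖ * Real.sin_sq_add_cos_sq z.arg
    rw [this]
    exact norm_nonneg z

/-- Rotations about two coordinate axes move every point of the sphere to a pole. -/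
lemma exists_rot_rot_eq (x : S2) : ∃ s t, rot 1 t (rot 2 s x) = basisVec 2 := by
  obtain ⟨s, hs, -⟩ := exists_rot_apply_two_eq_zero 2 (x : E3)
  obtain ⟨t, ht, ht'⟩ := exists_rot_apply_two_eq_zero 1 (rot 2 s x)
  refine ⟨s, t, ?_⟩
  have h1 : rot 1 t (rot 2 s x) 1 = 0 := by rw [rot_apply_self]; exact hs
  have h0 : rot 1 t (rot 2 s x) 0 = 0 := ht
  have hp : 0 ≤ rot 1 t (rot 2 s x) 2 := ht'
  have hn : ‖rot 1 t (rot 2 s x)‖ ^ 2 = 1 := by simp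
  rw [norm_sq_cyclic 0] at hn
  simp only [zero_add] at hn
  rw [h0, h1] at hn
  have h2 : rot 1 t (rot 2 s x) 2 = 1 := by nlinarith
  ext i
  fin_cases i
  · simpa using h0
  · simpa using h1
  · simpa using h2

/-- A smooth function with vanishing angular derivatives is invariant under the rotations about the
coordinate axes, which move every point to the pole. -/
lemma eq_pole_of_angDeriv_eq_zero {φ : E3 → ℝ} (h : ContDiff ℝ ∞ φ)
    (h0 : ∀ a x, angDeriv a φ x = 0) (x : S2) : φ x = φ (basisVec 2) := by
  have hrot (a : Fin 3) (t : ℝ) (y : E3) : φ (rot a t y) = φ y := by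
    have hd (s : ℝ) : HasDerivAt (fun s => φ (rot a s y)) 0 s := by
      have := hasDerivAt_comp_rot h a s y
      rwa [h0] at this
    have := is_const_of_deriv_eq_zero (fun s => (hd s).differentiableAt) (fun s => (hd s).deriv) t 0
    simpa [rot_zero] using this
  obtain ⟨s, t, hst⟩ := exists_rot_rot_eq x
  rw [← hst, hrot, hrot]

/-- The mollifications have vanishing angular derivatives, so they are constant. -/
lemma HasW1.ae_eq_const {f : S2 → ℝ} {F : Fin 3 → S2 → ℝ} (h : HasW1 f F)
    (h0 : ∀ a, F a =ᵐ[area] 0) : ∃ c : ℝ, ∀ᵐ x ∂area, f x = c := by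
  have hconst (n : ℕ) (x : S2) : mollify n f x = mollify n f (basisVec 2) := by
    refine eq_pole_of_angDeriv_eq_zero (contDiff_mollify n h.integrable) (fun a y => ?_) x
    rw [angDeriv_mollify n ((h.deriv a).congr Filter.EventuallyEq.rfl (h0 a))]
    simp [mollify, zonal]
  obtain ⟨w, -, hw⟩ := (tendstoL2_mollify h.memLp).exists_ae_subseq
  simp only [hconst] at hw
  obtain ⟨y, hy⟩ := hw.exists
  exact ⟨f y, hw.mono fun x hx => tendsto_nhds_unique hx hy⟩

lemma ae_eq_zero_of_l2_eq_zero {f : S2 → ℝ} (hf : MemLp f 2 area) (h : l2 f = 0) : f =ᵐ[area] 0 := by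
  have h1 := l2_sq hf
  rw [h, zero_pow two_ne_zero, eq_comm, integral_eq_zero_iff_of_nonneg (fun x => sq_nonneg _)
    hf.integrable_sq] at h1
  filter_upwards [h1] with x hx
  exact pow_eq_zero_iff two_ne_zero |>.1 hx

end EpsHarmonic

end

theorem mainTheorem6 :
    ∃ δ : ℝ, 0 < δ ∧ ∃ ε₀ : ℝ, 0 < ε₀ ∧
      ∀ ε : ℝ, 0 < ε → ε ≤ ε₀ →
        ∀ u : EpsHarmonic.S2 → EpsHarmonic.S2,
          EpsHarmonic.MemW22Sphere u →
          EpsHarmonic.IsCriticalPoint ε u →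
          EpsHarmonic.energy ε (fun x => (u x : EpsHarmonic.E3)) < δ →
            EpsHarmonic.energy ε (fun x => (u x : EpsHarmonic.E3)) = 0 ∧
              ∃ c : EpsHarmonic.S2, ∀ᵐ x ∂EpsHarmonic.area, u x = c := by
  -- all constants are independent of `ε`, so that any `ε₀` will do; the Dirichlet energy is at most
  -- `2 δ`, and `δ` is chosen with `6 · 10¹⁰ · 2 δ < 1`
  refine ⟨10⁻¹ ^ 12, by norm_num, 1, one_pos, fun ε hε _ u hu hcrit hE => ?_⟩
  choose F H h using fun k => (hu k).exists_hasW2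
  have hen : EpsHarmonic.energy ε (fun x => (u x : EpsHarmonic.E3)) =
      1 / 2 * (∑ k, ∑ a, EpsHarmonic.l2 (F k a) ^ 2 +
        ε * ∑ k, EpsHarmonic.l2 (EpsHarmonic.trace2 (H k)) ^ 2) := by
    rw [EpsHarmonic.energy_eq ε h]
    simp only [Finset.sum_add_distrib, Finset.mul_sum,
      EpsHarmonic.l2_sq ((h _).fst.memLp_deriv _), EpsHarmonic.l2_sq (h _).memLp_trace2]
  have hT0 : 0 ≤ ε * ∑ k, EpsHarmonic.l2 (EpsHarmonic.trace2 (H k)) ^ 2 :=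
    mul_nonneg hε.le (Finset.sum_nonneg fun k _ => sq_nonneg _)
  have hT := hcrit.sum_l2_trace2_eq_zero hε.le h (by rw [hen] at hE; norm_num at hE; linarith)
  have hG : ∑ k, ∑ a, EpsHarmonic.l2 (F k a) ^ 2 = 0 := by
    refine le_antisymm ?_ (EpsHarmonic.sum_sum_sq_nonneg fun k a => EpsHarmonic.l2 (F k a))
    have := Finset.sum_le_sum (s := Finset.univ) fun k _ => (h k).gradient_le
    rwa [← Finset.mul_sum, hT, mul_zero] at this
  have hF (k a : Fin 3) : EpsHarmonic.l2 (F k a) = 0 := by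
    have h1 := EpsHarmonic.sq_le_sum_sum_sq (fun k a => EpsHarmonic.l2 (F k a)) k a
    rw [hG] at h1
    exact pow_eq_zero_iff two_ne_zero |>.1 (le_antisymm h1 (sq_nonneg _))
  refine ⟨by rw [hen, hG, hT]; ring, ?_⟩
  choose c hc using fun k => (h k).fst.ae_eq_const fun a =>
    EpsHarmonic.ae_eq_zero_of_l2_eq_zero ((h k).fst.memLp_deriv a) (hF k a)
  have hall := MeasureTheory.ae_all_iff.2 hc
  obtain ⟨y, hy⟩ := hall.exists
  refine ⟨u y, hall.mono fun x hx => Subtype.ext ?_⟩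
  ext k
  rw [hx k, hy k]
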